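/- **Setting.** Let $1\le r\le n$ and $\lambda,\eta>0$. A multilinear polynomial is $p(z)=\sum_{I\subseteq[n]}\widehat p(I)z_I$, $z_I=\prod_{i\in I}z_i$, with $\|p\|_1=\sum_I|\widehat p(I)|$ and $\partial_u p(z)=\sum_{J\not\ni u}\widehat p(J\cup\{u\})z_J$. A *maximal monomial* of $p$ is a $J$ with $\widehat p(J)\ne0$ and $\widehat p(I)=0$ for all $I\supsetneq J$. An *$r$-wise Markov random field* (MRF) on $\{-1,1\}^n$ consists of a graph $G$ on $[n]$ whose maximal cliques have at most $r$ vertices, a polynomial $p$ whose monomials are all cliques of $G$ of size at most $r$, and the distribution $\mathcal D$ with $\Pr[Z=z]\propto e^{p(z)}$. It is *$\eta$-identifiable* if $|\widehat p(J)|\ge\eta$ for every maximal monomial $J$ of $p$ and every edge of $G$ is contained in some $I$ with $\widehat p(I)\neq0$. **Sparsitron.** The input is a bound $\Lambda$, $T$ training and $M'$ validation examples $(X,Y)\in\{-1,0,1\}^d\times\{0,1\}$. Let $\sigma(t)=1/(1+e^{-t})$, $\beta=1-\sqrt{\log_2 d/T}$, $w^{(0)}=(1/d,\dots,1/d)$;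 for $t=1,\dots,T$ let $v^{(t)}=\Lambda w^{(t-1)}/\|w^{(t-1)}\|_1$ and $w^{(t)}_i=w^{(t-1)}_i\beta^{\ell_i}$ with $\ell_i=\frac12\bigl(1+(\sigma(v^{(t)}\cdot X^{(t)})-Y^{(t)})X^{(t)}_i\bigr)$. The *validating* Sparsitron returns a $v^{(t)}$ that minimizes the empirical risk $\frac1{M'}\sum_m(\sigma(v^{(t)}\cdot X^{(T+m)})-Y^{(T+m)})^2$; the *averaging* Sparsitron returns $\frac1T\sum_t v^{(t)}$. **Iterative algorithm at a vertex $u$** (inputs $\lambda,\eta,r$ and the samples). Start with $J=S=\emptyset$. For $l=r-1,r-2,\dots,1$, as long as $|S|<n-1$: let $F$ consist of all $I\subseteq[n]\setminus\{u\}$ with $|I|\le l$ and all larger $I$ contained in a member of $J$; call the Sparsitron once, with $\Lambda=2\lambda$ and the examples $X=\bigl((Z_I)_{I\in F},(-Z_I)_{I\in F},0\bigr)$, $Y=(1-Z_u)/2$, and write its output as $(q_1,q_2,q_3)$ and $\widehat q=q_1-q_2$; then, for each $I\subseteq[n]\setminus\{u\}$ with $|I|=l$ that is contained in no member of $J$ (as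 it was at the beginning of this round), add $I$ to $J$ and its elements to $S$ if $|\widehat q(I)|>\eta$. Return $S$. Thus the Sparsitron is called at most $r-1$ times, and no median is computed. **Theorem.** There is an absolute constant $C>0$ such that for all integers $1\le r\le n$, all $\lambda,\eta>0$, $\rho\in(0,1)$ and every integer $$M\ \ge\ e^{Cr}\,e^{C\lambda r}\,\frac{\max\{1,\log_2(nr/(\rho\eta))\}}{\eta^4}$$ the following holds, where the first $T=\lfloor M/2\rfloor$ of $M$ samples are used for training and the others for validation. 1. For every $r$-wise, $\eta$-identifiable MRF on $\{-1,1\}^n$ with $\max_i\|\partial_i p\|_1\le\lambda$, given $M$ independent samples from $\mathcal D$, the iterative algorithm run at every vertex (on the same samples) returns, with probability at least $1-\rho$, exactly the neighbourhoods of all vertices in $G$. This holds with the validating Sparsitron, and also with the averaging Sparsitron. 2. On every sequence of $M$ samples, running the iterative algorithm at all $n$ vertices takes at most $C\,M\,n^r$ elementary steps with the averaging Sparsitron, and at most $C\,M^2\,n^r$ elementary steps with the validating one. (Elementary steps are those of a real-number RAM: arithmetic, exponential, logarithm, powers, sigmoid, comparisons, memory accesses and list operations.) -/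

import Mathlib

open MeasureTheory

noncomputable section

namespace MRF

/-! ### Markov random fields on `{-1,1}^n` -/

/-- Points of `{-1,1}^n`. -/
abbrev Config (n : ℕ) : Type := Fin n → ℤˣ

/-- All subsets of `{-1,1}` are measurable. -/
instance : MeasurableSingletonClass ℤˣ where
  measurableSet_singleton a :=
    ⟨{(a : ℤ)}, MeasurableSet.singleton _, by
      ext b
      simp [Units.ext_iff]⟩

/-- The `i`-th coordinate of `z`, as a real number `±1`. -/
def spin {n : ℕ} (z : Config n) (i : Fin n) : ℝ := ((z i : ℤ) : ℝ)

/-- A multilinear polynomial in `n` variables, given by its coefficients `I ↦ p̂(I)`. -/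
abbrev MultilinearPoly (n : ℕ) : Type := Finset (Fin n) → ℝ

/-- The value `p(z) = ∑_I p̂(I) ∏_{i ∈ I} z_i`. -/
def MultilinearPoly.eval {n : ℕ} (p : MultilinearPoly n) (z : Config n) : ℝ :=
  ∑ I : Finset (Fin n), p I * ∏ i ∈ I, spin z i

/-- The partial derivative `∂_u p = ∑_{J ∌ u} p̂(J ∪ {u}) Z_J`. -/
def MultilinearPoly.partialDeriv {n : ℕ} (u : Fin n) (p : MultilinearPoly n) :
    MultilinearPoly n :=
  fun J => if u ∈ J then 0 else p (insert u J)

/-- The sum of the absolute values of the coefficients. -/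
def MultilinearPoly.norm1 {n : ℕ} (p : MultilinearPoly n) : ℝ :=
  ∑ I : Finset (Fin n), |p I|

/-- A maximal monomial of `p`: a monomial that occurs in `p` and is strictly contained in no other
monomial that occurs in `p`. -/
def IsMaximalMonomial {n : ℕ} (p : MultilinearPoly n) (J : Finset (Fin n)) : Prop :=
  p J ≠ 0 ∧ ∀ I : Finset (Fin n), J ⊂ I → p I = 0

/-- `G` and the factorization polynomial `p` define an `r`-wise Markov random field: the maximal
cliques of `G` have at most `r` vertices, and every monomial of `p` is a clique of `G` of size at
most `r`. -/
structure IsRWise {n : ℕ} (r : ℕ) (G : SimpleGraph (Fin n)) (p : MultilinearPoly n) : Prop where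
  card_le_of_maximal_clique : ∀ K : Finset (Fin n),
    Maximal (fun L : Finset (Fin n) => G.IsClique (L : Set (Fin n))) K → K.card ≤ r
  support : ∀ I : Finset (Fin n), p I ≠ 0 → G.IsClique (I : Set (Fin n)) ∧ I.card ≤ r

/-- `η`-identifiability: maximal monomials of `p` have coefficients of absolute value at least `η`,
and every edge of `G` is covered by a non-zero monomial of `p`. -/
structure IsIdentifiable {n : ℕ} (η : ℝ) (G : SimpleGraph (Fin n)) (p : MultilinearPoly n) :
    Prop where
  le_abs_coeff : ∀ J : Finset (Fin n), IsMaximalMonomial p J → η ≤ |p J|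
  edge_covered : ∀ u v : Fin n, G.Adj u v → ∃ I : Finset (Fin n), p I ≠ 0 ∧ u ∈ I ∧ v ∈ I

/-- The distribution of the field: the probability of `z` is proportional to `exp (p(z))`. -/
def gibbs {n : ℕ} (p : MultilinearPoly n) : PMF (Config n) :=
  PMF.normalize (fun z => ENNReal.ofReal (Real.exp (p.eval z)))
    (by
      intro h
      have h1 := (ENNReal.tsum_eq_zero.1 h) (fun _ => 1)
      exact absurd h1 (ENNReal.ofReal_pos.2 (Real.exp_pos _)).ne')
    (by
      rw [tsum_fintype]
      exact (ENNReal.sum_lt_top.2 fun _ _ => ENNReal.ofReal_lt_top).ne)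

/-! ### Step counting

Algorithms are written as real-RAM programs in a monad that counts elementary steps. The data are
real numbers, natural numbers, vertices, Booleans, immutable linked lists, and the samples (arrays
with random access). -/

/-- The result of a computation with the number of elementary steps it took. -/
structure Timed (α : Type) : Type where
  val : α
  time : ℕ

instance : Monad Timed where
  pure a := ⟨a, 0⟩
  bind x f := ⟨(f x.val).val, x.time + (f x.val).time⟩

/-- One elementary step with result `a`: an arithmetic operation on numbers (including `exp`, `log`,
`√`, real powers and the sigmoid function), a comparison, a Boolean operation, reading a coordinate
of a sample, or building or returning a list cell or a pair. -/
def op {α : Type} (a : α) : Timed α := ⟨a, 1⟩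

/-- Apply `f` to every entry of a list. -/
def mapT {α β : Type} (f : α → Timed β) : List α → Timed (List β)
  | [] => op []
  | a :: l => do
    let b ← f a
    let bs ← mapT f l
    op (b :: bs)

/-- Combine two lists entry by entry, up to the length of the shorter one. -/
def zipWithT {α β γ : Type} (f : α → β → Timed γ) : List α → List β → Timed (List γ)
  | a :: l, b :: m => do
    let c ← f a b
    let cs ← zipWithT f l m
    op (c :: cs)
  | _, _ => op []

/-- Run through a list, updating a state. -/
def foldT {σ α : Type} (f : σ → α → Timed σ) : σ → List α → Timed σ
  | s, [] => op s
  | s, a :: l => do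
    let s₁ ← f s a
    let s₂ ← op s₁
    foldT f s₂ l

/-- The entries of a list that pass the test `f`. -/
def filterT {α : Type} (f : α → Timed Bool) : List α → Timed (List α)
  | [] => op []
  | a :: l => do
    let b ← f a
    let m ← filterT f l
    if b then op (a :: m) else op m

/-- Does some entry of a list pass the test `f`? -/
def anyT {α : Type} (f : α → Timed Bool) (l : List α) : Timed Bool :=
  foldT (fun s a => do
    let b ← f a
    op (s || b)) false l

/-- Do all entries of a list pass the test `f`? -/
def allT {α : Type} (f : α → Timed Bool) (l : List α) : Timed Bool :=
  foldT (fun s a => do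
    let b ← f a
    op (s && b)) true l

/-- The length of a list. -/
def lengthT {α : Type} (l : List α) : Timed ℕ :=
  foldT (fun k _ => op (k + 1)) 0 l

/-- Concatenation of two lists. -/
def appendT {α : Type} : List α → List α → Timed (List α)
  | [], m => op m
  | a :: l, m => do
    let k ← appendT l m
    op (a :: k)

/-- Split a list after its first `k` entries. -/
def splitT {α : Type} : ℕ → List α → Timed (List α × List α)
  | 0, l => op ([], l)
  | _ + 1, [] => op ([], [])
  | k + 1, a :: l => do
    let s ← splitT k l
    op (a :: s.1, s.2)

/-- The sum of a list of real numbers. -/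
def sumT (l : List ℝ) : Timed ℝ := foldT (fun s a => op (s + a)) 0 l

/-- The inner product of two vectors. -/
def dotT (v x : List ℝ) : Timed ℝ := do
  let m ← zipWithT (fun a b => op (a * b)) v x
  sumT m

/-- The `1`-norm of a vector. -/
def norm1T (v : List ℝ) : Timed ℝ := do
  let m ← mapT (fun a => op |a|) v
  sumT m

/-- Is `v` an entry of the list? -/
def memT {n : ℕ} (v : Fin n) (S : List (Fin n)) : Timed Bool :=
  anyT (fun w => op (decide (v = w))) S

/-- `S ∪ I`, for lists of vertices. -/
def unionT {n : ℕ} (I S : List (Fin n)) : Timed (List (Fin n)) :=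
  foldT (fun S' v => do
    let b ← memT v S'
    if b then op S' else op (v :: S')) S I

/-- Is `I ⊆ A`, for lists of vertices? -/
def subsetT {n : ℕ} (I A : List (Fin n)) : Timed Bool := allT (fun v => memT v A) I

/-- Is `I ⊆ A` for some `A` in `J`? -/
def coveredT {n : ℕ} (J : List (List (Fin n))) (I : List (Fin n)) : Timed Bool :=
  anyT (fun A => subsetT I A) J

/-- All subsets of size at most `k` of (the set of entries of) a list. -/
def subsetsT {α : Type} : ℕ → List α → Timed (List (List α))
  | 0, _ => op [[]]
  | _ + 1, [] => op [[]]
  | k + 1, a :: l => do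
    let without ← subsetsT (k + 1) l
    let rest ← subsetsT k l
    let withA ← mapT (fun I => op (a :: I)) rest
    appendT withA without

/-- The first entry of a list at which `f` is smallest (`dflt` if the list is empty). -/
def argminT {α : Type} (f : α → Timed ℝ) (dflt : α) : List α → Timed α
  | [] => op dflt
  | a :: l => do
    let c ← f a
    let best ← foldT (fun s b => do
      let cb ← f b
      let lt ← op (decide (cb < s.2))
      if lt then op (b, cb) else op s) (a, c) l
    op best.1

/-! ### The Sparsitron -/

/-- The multiplicative weight updates. From the current weights `w` and the remaining examples
`(X, Y)`, list the vectors `lam • α`, with `α = w / ‖w‖₁` taken before each update; the update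
multiplies `w_i` by `β ^ l_i`, where `l_i = (1 + (σ(lam α ⬝ X) - Y) X_i) / 2`. -/
def hedgeT (lam β : ℝ) : List ℝ → List (List ℝ × ℝ) → Timed (List (List ℝ))
  | _, [] => op []
  | w, (x, y) :: s => do
    let c ← norm1T w
    let α ← mapT (fun a => op (a / c)) w
    let v ← mapT (fun a => op (lam * a)) α
    let h ← dotT v x
    let q ← op (Real.sigmoid h)
    let g ← op (q - y)
    let loss ← mapT (fun a => do
      let b ← op (g * a)
      let b' ← op (1 + b)
      op (b' / 2)) x
    let w' ← zipWithT (fun a b => do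
      let f ← op (β ^ b)
      op (a * f)) w loss
    let vs ← hedgeT lam β w' s
    op (v :: vs)

/-- The empirical risk `(1/M) ∑_m (σ(v ⬝ X^(m)) - Y^(m))²`. -/
def riskT (valid : List (List ℝ × ℝ)) (v : List ℝ) : Timed ℝ := do
  let errs ← mapT (fun e : List ℝ × ℝ => do
    let h ← dotT v e.1
    let q ← op (Real.sigmoid h)
    let g ← op (q - e.2)
    op (g * g)) valid
  let s ← sumT errs
  let m ← lengthT valid
  op (s / (m : ℝ))

/-- The average of a list of vectors, `w` being any vector of their common dimension. -/
def averageT (w : List ℝ) (vs : List (List ℝ)) : Timed (List ℝ) := do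
  let z ← mapT (fun _ => op (0 : ℝ)) w
  let s ← foldT (fun s v => zipWithT (fun a b => op (a + b)) s v) z vs
  let t ← lengthT vs
  mapT (fun a => op (a / (t : ℝ))) s

/-- How the Sparsitron turns its sequence of vectors into its output: by validation, which takes one
pass over the validation examples for each vector, or by averaging, which needs no validation. -/
inductive OutputRule : Type
  /-- A vector of the sequence with the least empirical risk on the validation examples. -/
  | validate
  /-- The average of the sequence. -/
  | average

/-- The Sparsitron in dimension `d`, with `1`-norm bound `lam`, training examples `train` and
validation examples `valid`. -/
def sparsitronT (rule : OutputRule) (d : ℕ) (lam : ℝ) (train valid : List (List ℝ × ℝ)) :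
    Timed (List ℝ) := do
  let t ← lengthT train
  let lg ← op (Real.logb 2 (d : ℝ))
  let quo ← op (lg / (t : ℝ))
  let rt ← op (Real.sqrt quo)
  let β ← op (1 - rt)
  let w ← mapT (fun _ => op (1 / (d : ℝ))) (List.range d)
  let vs ← hedgeT lam β w train
  match rule with
  | .validate => argminT (riskT valid) [] vs
  | .average => averageT w vs

/-! ### Iterative structure learning -/

/-- The value of the monomial `Z_I` at a sample. -/
def monomialT {n : ℕ} (z : Config n) (I : List (Fin n)) : Timed ℝ :=
  foldT (fun s i => do
    let a ← op (spin z i)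
    op (s * a)) 1 I

/-- The example `((X, -X, 0), Y)` made from a sample `z`, where `X` lists the monomials `Z_I`,
`I ∈ F`, and `Y = (1 - z_u) / 2`. -/
def exampleT {n : ℕ} (u : Fin n) (F : List (List (Fin n))) (z : Config n) :
    Timed (List ℝ × ℝ) := do
  let x ← mapT (monomialT z) F
  let negx ← mapT (fun a => op (-a)) x
  let tail ← appendT negx [0]
  let x' ← appendT x tail
  let zu ← op (spin z u)
  let num ← op (1 - zu)
  let y ← op (num / 2)
  op (x', y)

/-- The polynomial `q_l` found by the Sparsitron from the features `F`, as a list of pairs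
`(I, q̂_l(I))`. The Sparsitron returns `(q₁, q₂, q₃)`, and `q_l = q₁ - q₂`. -/
def regressT {n : ℕ} (rule : OutputRule) (lam : ℝ) (u : Fin n) (F : List (List (Fin n)))
    (train valid : List (Config n)) : Timed (List (List (Fin n) × ℝ)) := do
  let k ← lengthT F
  let d ← op (2 * k + 1)
  let tr ← mapT (exampleT u F) train
  let va ← mapT (exampleT u F) valid
  let v ← sparsitronT rule d (2 * lam) tr va
  let s₁ ← splitT k v
  let s₂ ← splitT k s₁.2
  let q ← zipWithT (fun a b => op (a - b)) s₁.1 s₂.1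
  zipWithT (fun I c => op (I, c)) F q

/-- The main loop at vertex `u`, at level `l`, with the maximal monomials `J` found so far and their
union `S`. At level `l + 1` the features are the subsets of `[n] ∖ {u}` of size at most `l + 1` and
the larger ones (of size at most `r - 1`) contained in a member of `J`; then the subsets `I` of size
`l + 1` contained in no member of `J` are added if `|q̂(I)| > η`. -/
def levelsT {n : ℕ} (rule : OutputRule) (r : ℕ) (lam η : ℝ) (u : Fin n)
    (train valid : List (Config n)) :
    ℕ → List (List (Fin n)) → List (Fin n) → Timed (List (Fin n))
  | 0, _, S => op S
  | l + 1, J, S => do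
    let s ← lengthT S
    let continue? ← op (decide (s < n - 1))
    if continue? then do
      let V ← filterT (fun v => op (decide (v ≠ u))) (List.finRange n)
      let subsets ← subsetsT (r - 1) V
      let F ← filterT (fun I => do
        let k ← lengthT I
        let small ← op (decide (k ≤ l + 1))
        if small then op true else coveredT J I) subsets
      let q ← regressT rule lam u F train valid
      let JS ← foldT (fun JS Ic => do
        let k ← lengthT Ic.1
        let level ← op (decide (k = l + 1))
        if level then do
          let cov ← coveredT J Ic.1
          let large ← op (decide (η < |Ic.2|))
          if !cov && large then do
            let S' ← unionT Ic.1 JS.2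
            op (Ic.1 :: JS.1, S')
          else op JS
        else op JS) (J, S) q
      levelsT rule r lam η u train valid l JS.1 JS.2
    else op S

/-- The iterative algorithm at vertex `u`; it returns a list of vertices, the neighbours of `u`. -/
def neighboursT {n : ℕ} (rule : OutputRule) (r : ℕ) (lam η : ℝ) (u : Fin n)
    (train valid : List (Config n)) : Timed (List (Fin n)) :=
  levelsT rule r lam η u train valid (r - 1) [] []

/-- The iterative algorithm at every vertex, with the first `T` samples used for training and the
other ones for validation; it returns the adjacency lists. -/
def learnGraphT {n : ℕ} (rule : OutputRule) (T r : ℕ) (lam η : ℝ) (samples : List (Config n)) :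
    Timed (List (Fin n × List (Fin n))) := do
  let parts ← splitT T samples
  mapT (fun u => do
    let S ← neighboursT rule r lam η u parts.1 parts.2
    op (u, S)) (List.finRange n)

/-- The adjacency lists `out` describe exactly the graph `G`. -/
def Describes {n : ℕ} (out : List (Fin n × List (Fin n))) (G : SimpleGraph (Fin n)) : Prop :=
  ∀ u v : Fin n, G.Adj u v ↔ ∃ S : List (Fin n), (u, S) ∈ out ∧ v ∈ S

/-- The probability of an event that depends on `N` independent samples of the field with
factorization polynomial `p`. -/
def sampleProb {n : ℕ} (p : MultilinearPoly n) (N : ℕ) (E : Set (Fin N → Config n)) : ℝ :=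
  (Measure.pi (fun _ : Fin N => (gibbs p).toMeasure)).real E

end MRF

end

namespace MRF

/-! ### Values of timed computations -/

/-! Flipping the spin at `u` changes `p` by `2 z_u ∂_u p(z)`, so given the other spins the label `(1
- Z_u)/2` has mean `σ(-2 ∂_u p(Z))` (`eval_sub_eval_flip`, `sum_gibbsWeight_label`). Hence each call
of the Sparsitron is a well-specified logistic regression: if the features contain the support of
`∂_u p`, the true vector `a` consists of the positive and negative parts of the coefficients of `-2
∂_u p`, padded to 1-norm exactly `Λ = 2λ` by the coordinate whose feature is 0
(`isLogisticModel_gibbs`).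

The Sparsitron is multiplicative weights applied to linearized losses. A potential argument bounds
its regret against `a` by `6Λ√(T log₂ d)` (`regret_sparsitron_le`), and an exponential-moment form
of Azuma's inequality turns this into a bound on the average expected excess of the vectors `v^(t)`
(`listProb_train_le`). The expected excess of `v` is the mean of `(σ(v·X) - σ(a·X))(v·X - a·X)`. It
dominates both the mean square of the difference of the sigmoids and, up to the factor `e^{-Λ}/4`,
that of the difference of the linear functions. Averaging then succeeds by convexity of the square;
validation succeeds by Hoeffding's inequality for each `v^(t)` and the Pythagorean identity
`risk_eq`. Either way the output is close to `a` in mean square (`listProb_not_succeeds_le`).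

Closeness in mean square controls the coefficients of maximal features. The half difference of
`f(z)` and `f(flip i z)` keeps exactly the monomials of `f` that contain `i`, and a flip changes
Gibbs weights by a factor of at most `e^{2λ}`. Iterating over `i ∈ I` isolates the coefficient of
`I` when `f` has no larger monomial above `I`, so `f(I)² ≤ e^{2λ|I|} E f²` (`sq_coeff_le`). Once the
right-hand side is below `η²`, the threshold `η` separates a zero coefficient from one of absolute
value at least `2η`.

The levels ensure that the tested features are maximal. If `J` consists of the maximal monomials of
`∂_u p` larger than the current level, then the features contain the support of `∂_u p`, and a set
of the current size covered by no member of `J` lies strictly below no feature (`Invariant.next`).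
In this situation the features depend on `p` alone, not on the samples (`Invariant.features_eq`). It
therefore suffices that the regressions with these ideal features are correct, and a union bound
over all vertices and levels permits the use of the same samples in all of them. If `η ≥ 2λ`, then
`p` has no nonconstant monomials and nothing can pass the threshold, so the estimates are needed
only for `η < 2λ`.

For the running time, every output of the Sparsitron has 1-norm at most `2λ` whatever the samples
are, so at most `2λ/η ≤ M` sets are selected per round and `J` stays small. A round costs `O(r³ K
B)` with `K` the number of subsets of size less than `r` of `n - 1` vertices, and `B = M` or `M²`.
There are fewer than `r` rounds, and `r⁴ K ≤ 200 n^{r-1}` because `(r-1)!` outgrows every power of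
`r` (`pow_four_mul_numSubsets_le`). -/

@[simp] theorem Timed.bind_val {α β : Type} (x : Timed α) (f : α → Timed β) :
    (x >>= f).val = (f x.val).val := rfl

@[simp] theorem Timed.bind_time {α β : Type} (x : Timed α) (f : α → Timed β) :
    (x >>= f).time = x.time + (f x.val).time := rfl

@[simp] theorem op_val {α : Type} (a : α) : (op a).val = a := rfl

@[simp] theorem op_time {α : Type} (a : α) : (op a).time = 1 := rfl

@[simp] theorem Timed.ite_val {α : Type} (c : Prop) [Decidable c] (x y : Timed α) :
    (if c then x else y).val = if c then x.val else y.val := by split_ifs <;> rfl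

@[simp] theorem mapT_val {α β : Type} (f : α → Timed β) (l : List α) :
    (mapT f l).val = l.map (fun a => (f a).val) := by
  induction l with
  | nil => rfl
  | cons a l ih => simp [mapT, ih]

@[simp] theorem zipWithT_val {α β γ : Type} (f : α → β → Timed γ) (l : List α) (m : List β) :
    (zipWithT f l m).val = List.zipWith (fun a b => (f a b).val) l m := by
  induction l generalizing m with
  | nil => simp [zipWithT]
  | cons a l ih => cases m <;> simp [zipWithT, ih]

@[simp] theorem foldT_val {σ α : Type} (f : σ → α → Timed σ) (s : σ) (l : List α) :
    (foldT f s l).val = l.foldl (fun s a => (f s a).val) s := by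
  induction l generalizing s with
  | nil => rfl
  | cons a l ih => simp [foldT, ih]

@[simp] theorem filterT_val {α : Type} (f : α → Timed Bool) (l : List α) :
    (filterT f l).val = l.filter (fun a => (f a).val) := by
  induction l with
  | nil => rfl
  | cons a l ih => simp only [filterT, Timed.bind_val, Timed.ite_val, op_val, ih, List.filter_cons]

@[simp] theorem anyT_val {α : Type} (f : α → Timed Bool) (l : List α) :
    (anyT f l).val = l.any (fun a => (f a).val) := by
  have h : ∀ (l : List α) (b : Bool),
      l.foldl (fun s a => s || (f a).val) b = (b || l.any (fun a => (f a).val)) := by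
    intro l
    induction l with
    | nil => simp
    | cons a l ih => intro b; simp [ih, Bool.or_assoc]
  simp [anyT, h]

@[simp] theorem allT_val {α : Type} (f : α → Timed Bool) (l : List α) :
    (allT f l).val = l.all (fun a => (f a).val) := by
  have h : ∀ (l : List α) (b : Bool),
      l.foldl (fun s a => s && (f a).val) b = (b && l.all (fun a => (f a).val)) := by
    intro l
    induction l with
    | nil => simp
    | cons a l ih => intro b; simp [ih, Bool.and_assoc]
  simp [allT, h]

@[simp] theorem lengthT_val {α : Type} (l : List α) : (lengthT l).val = l.length := by
  simp [lengthT]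

@[simp] theorem appendT_val {α : Type} (l m : List α) : (appendT l m).val = l ++ m := by
  induction l with
  | nil => rfl
  | cons a l ih => simp [appendT, ih]

@[simp] theorem splitT_val {α : Type} (k : ℕ) (l : List α) :
    (splitT k l).val = (l.take k, l.drop k) := by
  induction k generalizing l with
  | zero => simp [splitT]
  | succ k ih => cases l <;> simp [splitT, ih]

@[simp] theorem sumT_val (l : List ℝ) : (sumT l).val = l.sum := by
  simp [sumT, List.sum_eq_foldl]

@[simp] theorem dotT_val (v x : List ℝ) :
    (dotT v x).val = (List.zipWith (fun a b => a * b) v x).sum := by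
  simp [dotT]

@[simp] theorem norm1T_val (v : List ℝ) : (norm1T v).val = (v.map (fun a => |a|)).sum := by
  simp [norm1T]

@[simp] theorem memT_val {n : ℕ} (v : Fin n) (S : List (Fin n)) :
    (memT v S).val = decide (v ∈ S) := by
  rw [Bool.eq_iff_iff]; simp [memT]

@[simp] theorem subsetT_val {n : ℕ} (I A : List (Fin n)) :
    (subsetT I A).val = decide (I ⊆ A) := by
  rw [Bool.eq_iff_iff]; simp [subsetT, List.subset_def]

@[simp] theorem coveredT_val {n : ℕ} (J : List (List (Fin n))) (I : List (Fin n)) :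
    (coveredT J I).val = decide (∃ A ∈ J, I ⊆ A) := by
  rw [Bool.eq_iff_iff]; simp [coveredT]

theorem mem_unionT_val {n : ℕ} (I S : List (Fin n)) (v : Fin n) :
    v ∈ (unionT I S).val ↔ v ∈ I ∨ v ∈ S := by
  induction I generalizing S with
  | nil => simp [unionT]
  | cons a I ih =>
    simp only [unionT, foldT_val, Timed.bind_val, memT_val, Timed.ite_val, op_val,
      List.foldl_cons, decide_eq_true_eq] at ih ⊢
    rw [ih]
    by_cases h : a ∈ S
    · simp only [h, if_true, List.mem_cons]
      constructor
      · tauto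
      · rintro ((rfl | h') | h') <;> tauto
    · simp only [h, if_false, List.mem_cons]; tauto

/-- The loop compares the length of `S` with `n - 1`; the length counts vertices only if the list
has no repetitions. -/
theorem nodup_unionT_val {n : ℕ} (I S : List (Fin n)) (hS : S.Nodup) :
    (unionT I S).val.Nodup := by
  induction I generalizing S with
  | nil => simpa [unionT]
  | cons a I ih =>
    simp only [unionT, foldT_val, Timed.bind_val, memT_val, Timed.ite_val, op_val,
      List.foldl_cons, decide_eq_true_eq] at ih ⊢
    apply ih
    split_ifs with h
    · exact hS
    · exact List.nodup_cons.2 ⟨h, hS⟩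

theorem subsetsT_val_succ_cons {α : Type} (k : ℕ) (a : α) (l : List α) :
    (subsetsT (k + 1) (a :: l)).val =
      (subsetsT k l).val.map (fun I => a :: I) ++ (subsetsT (k + 1) l).val := by
  simp [subsetsT]

/-- Subsets are represented by sublists, hence in the order of `l`. For a list without repetitions
this gives one list per subset, which later identifies the lists of the algorithm with finite sets.
-/
theorem mem_subsetsT_val {α : Type} (k : ℕ) (l I : List α) :
    I ∈ (subsetsT k l).val ↔ I.Sublist l ∧ I.length ≤ k := by
  induction l generalizing k I with
  | nil => cases k <;> simp +contextual [subsetsT]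
  | cons a l ih =>
    cases k with
    | zero => simp +contextual [subsetsT]
    | succ k =>
      rw [subsetsT_val_succ_cons, List.mem_append, List.mem_map, ih, List.sublist_cons_iff]
      constructor
      · rintro (⟨I', h, rfl⟩ | h)
        · rw [ih] at h
          exact ⟨Or.inr ⟨I', rfl, h.1⟩, by simpa using h.2⟩
        · exact ⟨Or.inl h.1, h.2⟩
      · rintro ⟨h | ⟨I', rfl, h⟩, h2⟩
        · exact Or.inr ⟨h, h2⟩
        · exact Or.inl ⟨I', (ih _ _).2 ⟨h, by simpa using h2⟩, rfl⟩

theorem nodup_subsetsT_val {α : Type} (k : ℕ) (l : List α) (hl : l.Nodup) :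
    (subsetsT k l).val.Nodup := by
  induction l generalizing k with
  | nil => cases k <;> simp [subsetsT]
  | cons a l ih =>
    cases k with
    | zero => simp [subsetsT]
    | succ k =>
      rw [List.nodup_cons] at hl
      rw [subsetsT_val_succ_cons, List.nodup_append]
      refine ⟨(ih k hl.2).map (fun _ _ h => (List.cons.inj h).2), ih _ hl.2, ?_⟩
      rintro I hI I' hI' rfl
      rw [List.mem_map] at hI
      obtain ⟨I', -, rfl⟩ := hI
      exact hl.1 (((mem_subsetsT_val _ _ _).1 hI').1.subset List.mem_cons_self)

/-- The number of subsets of size at most `k` of a set with `m` elements. -/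
def numSubsets : ℕ → ℕ → ℕ
  | 0, _ => 1
  | _ + 1, 0 => 1
  | k + 1, m + 1 => numSubsets k m + numSubsets (k + 1) m

theorem length_subsetsT_val {α : Type} (k : ℕ) (l : List α) :
    (subsetsT k l).val.length = numSubsets k l.length := by
  induction l generalizing k with
  | nil => cases k <;> simp [subsetsT, numSubsets]
  | cons a l ih =>
    cases k with
    | zero => simp [subsetsT, numSubsets]
    | succ k => simp [subsetsT_val_succ_cons, ih, numSubsets]

theorem argminT_val_mem {α : Type} (f : α → Timed ℝ) (dflt : α) (l : List α) (hl : l ≠ []) :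
    (argminT f dflt l).val ∈ l ∧ ∀ a ∈ l, (f (argminT f dflt l).val).val ≤ (f a).val := by
  -- Loop invariant: the second component of the state is the value of `f` at the first, and it is a
  -- lower bound for all values seen so far.
  have key : ∀ (l : List α) (s : α × ℝ), s.2 = (f s.1).val →
      let b := l.foldl (fun s b => if (f b).val < s.2 then (b, (f b).val) else s) s
      b.2 = (f b.1).val ∧ b.2 ≤ s.2 ∧ (∀ a ∈ l, b.2 ≤ (f a).val) ∧ (b.1 = s.1 ∨ b.1 ∈ l) := by
    intro l
    induction l with
    | nil => intro s hs; simpa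
    | cons a l ih =>
      intro s hs
      simp only [List.foldl_cons]
      split_ifs with h
      · obtain ⟨h1, h2, h3, h4⟩ := ih (a, (f a).val) rfl
        refine ⟨h1, h2.trans h.le, ?_, ?_⟩
        · intro c hc
          rcases List.mem_cons.1 hc with rfl | hc
          · exact h2
          · exact h3 c hc
        · rcases h4 with h4 | h4
          · right; rw [h4]; exact List.mem_cons_self
          · right; exact List.mem_cons_of_mem _ h4
      · obtain ⟨h1, h2, h3, h4⟩ := ih s hs
        refine ⟨h1, h2, ?_, ?_⟩
        · intro c hc
          rcases List.mem_cons.1 hc with rfl | hc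
          · exact h2.trans (not_lt.1 h)
          · exact h3 c hc
        · rcases h4 with h4 | h4
          · left; exact h4
          · right; exact List.mem_cons_of_mem _ h4
  cases l with
  | nil => exact absurd rfl hl
  | cons a l =>
    have h := key l (a, (f a).val) rfl
    have hv : (argminT f dflt (a :: l)).val =
        (l.foldl (fun s b => if (f b).val < s.2 then (b, (f b).val) else s) (a, (f a).val)).1 := by
      simp [argminT]
    rw [hv]
    obtain ⟨h1, h2, h3, h4⟩ := h
    rw [← h1]
    refine ⟨?_, ?_⟩
    · rcases h4 with h4 | h4
      · rw [h4]; exact List.mem_cons_self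
      · exact List.mem_cons_of_mem _ h4
    · intro c hc
      rcases List.mem_cons.1 hc with rfl | hc
      · exact h2
      · exact h3 c hc

end MRF

namespace MRF

/-! ### The Sparsitron on functions -/

/-- All vectors of the program have the form `L.map v` with one fixed enumeration `L` of the
coordinates; this identity turns entrywise list operations into operations on functions. -/
theorem zipWith_map_map {ι α β γ : Type} (f : α → β → γ) (a : ι → α) (b : ι → β) (L : List ι) :
    List.zipWith f (L.map a) (L.map b) = L.map (fun i => f (a i) (b i)) := by
  rw [List.zipWith_map, List.zipWith_self]

theorem averageT_val {ι : Type} (L : List ι) (w : ι → ℝ) (vs : List (ι → ℝ)) :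
    (averageT (L.map w) (vs.map fun v => L.map v)).val =
      L.map (fun i => (vs.map fun v => v i).sum / (vs.length : ℝ)) := by
  have h : ∀ (vs : List (ι → ℝ)) (a : ι → ℝ),
      (vs.map fun v => L.map v).foldl
        (fun s v => List.zipWith (fun a b => a + b) s v) (L.map a) =
      L.map (fun i => a i + (vs.map fun v => v i).sum) := by
    intro vs
    induction vs with
    | nil => simp
    | cons v vs ih =>
      intro a
      simp only [List.map_cons, List.foldl_cons, zipWith_map_map, ih, List.sum_cons, add_assoc]
  have h' := h vs (fun _ => 0)
  simp only [averageT, Timed.bind_val, mapT_val, op_val, List.map_map, foldT_val, zipWithT_val,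
    lengthT_val, List.length_map, Function.comp_def, h', zero_add]

section Sparsitron

variable {Ω ι : Type} [Fintype ι]

/-- Scale a vector of weights to have `1`-norm `lam`. -/
noncomputable def scaled (lam : ℝ) (w : ι → ℝ) : ι → ℝ := fun i => lam * (w i / ∑ j, |w j|)

/-- The loss of each coordinate on the example `(x, y)`, for the prediction vector `v`. -/
noncomputable def loss (v x : ι → ℝ) (y : ℝ) : ι → ℝ :=
  fun i => (1 + (Real.sigmoid (∑ j, v j * x j) - y) * x i) / 2

/-- The prediction vectors of the multiplicative weight updates on a list of samples with features
`x` and labels `y`. -/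
noncomputable def hedgeSeq (x : Ω → ι → ℝ) (y : Ω → ℝ) (lam β : ℝ) :
    (ι → ℝ) → List Ω → List (ι → ℝ)
  | _, [] => []
  | w, z :: s => scaled lam w ::
      hedgeSeq x y lam β (fun i => w i * β ^ loss (scaled lam w) (x z) (y z) i) s

theorem length_hedgeSeq (x : Ω → ι → ℝ) (y : Ω → ℝ) (lam β : ℝ) (w : ι → ℝ) (s : List Ω) :
    (hedgeSeq x y lam β w s).length = s.length := by
  induction s generalizing w with
  | nil => rfl
  | cons z s ih => simp [hedgeSeq, ih]

theorem sum_abs_scaled_le {lam : ℝ} (hlam : 0 ≤ lam) (w : ι → ℝ) :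
    ∑ i, |scaled lam w i| ≤ lam := by
  have h0 : 0 ≤ ∑ j, |w j| := Finset.sum_nonneg fun _ _ => abs_nonneg _
  simp only [scaled, abs_mul, abs_div, abs_of_nonneg hlam, abs_of_nonneg h0]
  rw [← Finset.mul_sum, ← Finset.sum_div]
  exact mul_le_of_le_one_right hlam (div_self_le_one _)

theorem sum_abs_le_of_mem_hedgeSeq (x : Ω → ι → ℝ) (y : Ω → ℝ) {lam : ℝ} (hlam : 0 ≤ lam) (β : ℝ)
    (w : ι → ℝ) (s : List Ω) : ∀ v ∈ hedgeSeq x y lam β w s, ∑ i, |v i| ≤ lam := by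
  induction s generalizing w with
  | nil => simp [hedgeSeq]
  | cons z s ih =>
    intro v hv
    rcases List.mem_cons.1 hv with rfl | hv
    · exact sum_abs_scaled_le hlam w
    · exact ih _ v hv

/-- Norms and inner products see `L` only through sums along it, so `hL` is all that is needed to
replace lists by functions on `ι`. -/
theorem hedgeT_val {L : List ι} (hL : ∀ g : ι → ℝ, (L.map g).sum = ∑ i, g i)
    (x : Ω → ι → ℝ) (y : Ω → ℝ) (lam β : ℝ) (w : ι → ℝ) (s : List Ω) :
    (hedgeT lam β (L.map w) (s.map fun z => (L.map (x z), y z))).val =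
      (hedgeSeq x y lam β w s).map (fun v => L.map v) := by
  induction s generalizing w with
  | nil => rfl
  | cons z s ih =>
    rw [hedgeSeq, List.map_cons, List.map_cons, ← ih, hedgeT]
    simp only [Timed.bind_val, norm1T_val, mapT_val, op_val, List.map_map, dotT_val,
      zipWith_map_map, zipWithT_val, Function.comp_def, hL, scaled, loss]
    rfl

/-- The empirical squared error of `v` on a list of samples, without the normalization. -/
noncomputable def sqErr (x : Ω → ι → ℝ) (y : Ω → ℝ) (v : ι → ℝ) (s : List Ω) : ℝ :=
  (s.map fun z => (Real.sigmoid (∑ j, v j * x z j) - y z) ^ 2).sum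

theorem riskT_val {L : List ι} (hL : ∀ g : ι → ℝ, (L.map g).sum = ∑ i, g i)
    (x : Ω → ι → ℝ) (y : Ω → ℝ) (v : ι → ℝ) (s : List Ω) :
    (riskT (s.map fun z => (L.map (x z), y z)) (L.map v)).val =
      sqErr x y v s / (s.length : ℝ) := by
  simp only [riskT, Timed.bind_val, mapT_val, op_val, List.map_map, dotT_val, zipWith_map_map,
    Function.comp_def, hL, sumT_val, lengthT_val, List.length_map, sqErr, pow_two]

/-- The learning rate of the Sparsitron. -/
noncomputable def learningRate (d T : ℕ) : ℝ := Real.sqrt (Real.logb 2 (d : ℝ) / (T : ℝ))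

/-- The prediction vectors of the Sparsitron. -/
noncomputable def sparsitronSeq (x : Ω → ι → ℝ) (y : Ω → ℝ) (lam : ℝ) (train : List Ω) :
    List (ι → ℝ) :=
  hedgeSeq x y lam (1 - learningRate (Fintype.card ι) train.length)
    (fun _ => 1 / (Fintype.card ι : ℝ)) train

theorem length_eq_card {L : List ι} (hL : ∀ g : ι → ℝ, (L.map g).sum = ∑ i, g i) :
    L.length = Fintype.card ι := by
  have h := hL fun _ => 1
  simp only [List.map_const', List.sum_replicate, Finset.sum_const, Finset.card_univ,
    nsmul_eq_mul, mul_one] at h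
  exact_mod_cast h

theorem map_range_eq {L : List ι} (hL : ∀ g : ι → ℝ, (L.map g).sum = ∑ i, g i) (c : ℝ) :
    (List.range (Fintype.card ι)).map (fun _ => c) = L.map (fun _ => c) := by
  simp [List.map_const', length_eq_card hL]

theorem sparsitronT_average_val {L : List ι} (hL : ∀ g : ι → ℝ, (L.map g).sum = ∑ i, g i)
    (x : Ω → ι → ℝ) (y : Ω → ℝ) (lam : ℝ) (train valid : List Ω) :
    (sparsitronT .average (Fintype.card ι) lam (train.map fun z => (L.map (x z), y z))
      (valid.map fun z => (L.map (x z), y z))).val =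
    L.map (fun i => ((sparsitronSeq x y lam train).map fun v => v i).sum / (train.length : ℝ)) := by
  simp only [sparsitronT, Timed.bind_val, mapT_val, op_val, lengthT_val, List.length_map,
    map_range_eq hL, hedgeT_val hL, averageT_val, length_hedgeSeq, sparsitronSeq, learningRate]

/-- With at least one training example the sequence is nonempty, so the default value of the
minimization plays no role. -/
theorem sparsitronT_validate_val {L : List ι} (hL : ∀ g : ι → ℝ, (L.map g).sum = ∑ i, g i)
    (x : Ω → ι → ℝ) (y : Ω → ℝ) (lam : ℝ) (train valid : List Ω) (ht : train ≠ []) :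
    ∃ v ∈ sparsitronSeq x y lam train,
      (sparsitronT .validate (Fintype.card ι) lam (train.map fun z => (L.map (x z), y z))
        (valid.map fun z => (L.map (x z), y z))).val = L.map v ∧
      ∀ v' ∈ sparsitronSeq x y lam train,
        sqErr x y v valid / (valid.length : ℝ) ≤ sqErr x y v' valid / (valid.length : ℝ) := by
  have hv : (sparsitronT .validate (Fintype.card ι) lam (train.map fun z => (L.map (x z), y z))
        (valid.map fun z => (L.map (x z), y z))).val =
      (argminT (riskT (valid.map fun z => (L.map (x z), y z))) []
        ((sparsitronSeq x y lam train).map fun v => L.map v)).val := by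
    simp only [sparsitronT, Timed.bind_val, mapT_val, op_val, lengthT_val, List.length_map,
      map_range_eq hL, hedgeT_val hL, sparsitronSeq, learningRate]
  have hne : (sparsitronSeq x y lam train).map (fun v => L.map v) ≠ [] := by
    rw [Ne, ← List.length_eq_zero_iff, List.length_map, sparsitronSeq, length_hedgeSeq,
      List.length_eq_zero_iff]
    exact ht
  obtain ⟨h1, h2⟩ := argminT_val_mem (riskT (valid.map fun z => (L.map (x z), y z))) [] _ hne
  rw [← hv] at h1 h2
  obtain ⟨v, hvm, hve⟩ := List.mem_map.1 h1
  refine ⟨v, hvm, hve.symm, fun v' hv' => ?_⟩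
  have h3 := h2 _ (List.mem_map_of_mem hv')
  rwa [← hve, riskT_val hL, riskT_val hL] at h3

theorem sum_abs_le_of_mem_sparsitronSeq (x : Ω → ι → ℝ) (y : Ω → ℝ) {lam : ℝ} (hlam : 0 ≤ lam)
    (train : List Ω) : ∀ v ∈ sparsitronSeq x y lam train, ∑ i, |v i| ≤ lam :=
  sum_abs_le_of_mem_hedgeSeq x y hlam _ _ _

theorem length_sparsitronSeq (x : Ω → ι → ℝ) (y : Ω → ℝ) (lam : ℝ) (train : List Ω) :
    (sparsitronSeq x y lam train).length = train.length := length_hedgeSeq ..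

theorem sum_abs_average_le {lam : ℝ} (hlam : 0 ≤ lam) (vs : List (ι → ℝ))
    (h : ∀ v ∈ vs, ∑ i, |v i| ≤ lam) :
    ∑ i, |(vs.map fun v => v i).sum / (vs.length : ℝ)| ≤ lam := by
  have h1 : ∀ vs : List (ι → ℝ), (∀ v ∈ vs, ∑ i, |v i| ≤ lam) →
      ∑ i, |(vs.map fun v => v i).sum| ≤ vs.length * lam := by
    intro vs
    induction vs with
    | nil => simp
    | cons v vs ih =>
      intro h
      have h2 := ih fun v hv => h v (List.mem_cons_of_mem _ hv)
      have h3 := h v List.mem_cons_self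
      calc ∑ i, |((v :: vs).map fun v => v i).sum|
          ≤ ∑ i, (|v i| + |(vs.map fun v => v i).sum|) :=
            Finset.sum_le_sum fun i _ => by simpa using abs_add_le _ _
        _ ≤ _ := by rw [Finset.sum_add_distrib]; push_cast [List.length_cons]; linarith
  have h2 := h1 vs h
  simp only [abs_div, Nat.abs_cast]
  rw [← Finset.sum_div]
  -- This form of the division lemma also covers the empty list, where the quotient is 0 by
  -- convention.
  exact div_le_of_le_mul₀ (by positivity) hlam (by linarith)

/-- Each output of the Sparsitron is a vector of `1`-norm at most `lam`, or empty. -/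
theorem exists_sparsitronT_val {L : List ι} (hL : ∀ g : ι → ℝ, (L.map g).sum = ∑ i, g i)
    (rule : OutputRule) (x : Ω → ι → ℝ) (y : Ω → ℝ) {lam : ℝ} (hlam : 0 ≤ lam)
    (train valid : List Ω) :
    (sparsitronT rule (Fintype.card ι) lam (train.map fun z => (L.map (x z), y z))
        (valid.map fun z => (L.map (x z), y z))).val = [] ∨
    ∃ v : ι → ℝ, ∑ i, |v i| ≤ lam ∧
      (sparsitronT rule (Fintype.card ι) lam (train.map fun z => (L.map (x z), y z))
        (valid.map fun z => (L.map (x z), y z))).val = L.map v := by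
  cases rule with
  | average =>
    right
    refine ⟨_, ?_, sparsitronT_average_val hL x y lam train valid⟩
    rw [← length_sparsitronSeq x y lam train]
    exact sum_abs_average_le hlam _ (sum_abs_le_of_mem_sparsitronSeq x y hlam train)
  | validate =>
    by_cases ht : train = []
    -- Without training examples there is no vector to validate, and the minimization returns its
    -- default, the empty list.
    · left
      subst ht
      simp only [sparsitronT, Timed.bind_val, List.map_nil, hedgeT, op_val]
      rfl
    · obtain ⟨v, hv, he, -⟩ := sparsitronT_validate_val hL x y lam train valid ht
      exact Or.inr ⟨v, sum_abs_le_of_mem_sparsitronSeq x y hlam train v hv, he⟩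

end Sparsitron

end MRF

namespace MRF

/-! ### The regret bound for multiplicative weights -/

section Regret

variable {Ω ι : Type} [Fintype ι]

/-- The inner product of two vectors. -/
noncomputable def dot (v x : ι → ℝ) : ℝ := ∑ i, v i * x i

/-- The linearized excess loss of `v` over `a` on one sample. -/
noncomputable def excess (x : Ω → ι → ℝ) (y : Ω → ℝ) (a v : ι → ℝ) (z : Ω) : ℝ :=
  (Real.sigmoid (dot v (x z)) - y z) * (dot v (x z) - dot a (x z))

/-- The regret of the multiplicative weight updates against the comparator `a`. -/
noncomputable def regret (x : Ω → ι → ℝ) (y : Ω → ℝ) (lam β : ℝ) (a : ι → ℝ) :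
    (ι → ℝ) → List Ω → ℝ
  | _, [] => 0
  | w, z :: s => excess x y a (scaled lam w) z +
      regret x y lam β a (fun i => w i * β ^ loss (scaled lam w) (x z) (y z) i) s

theorem loss_mem_Icc {v x : ι → ℝ} {y : ℝ} (hx : ∀ i, |x i| ≤ 1) (hy0 : 0 ≤ y) (hy1 : y ≤ 1)
    (i : ι) : 0 ≤ loss v x y i ∧ loss v x y i ≤ 1 := by
  have h1 : |(Real.sigmoid (∑ j, v j * x j) - y) * x i| ≤ 1 := by
    rw [abs_mul]
    refine mul_le_one₀ ?_ (abs_nonneg _) (hx i)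
    rw [abs_le]
    have := Real.sigmoid_pos (∑ j, v j * x j)
    have := Real.sigmoid_lt_one (∑ j, v j * x j)
    constructor <;> linarith
  rw [abs_le] at h1
  unfold loss
  constructor <;> linarith

/-- Combines `log x ≥ 1 - 1/x` with `(1 - ε)(1 + ε + 2ε²) = 1 + ε²(1 - 2ε) ≥ 1`; the last inequality
is where `ε ≤ 1/2` enters. -/
theorem neg_log_one_sub_le {ε : ℝ} (h0 : 0 ≤ ε) (h1 : ε ≤ 1 / 2) :
    -Real.log (1 - ε) ≤ ε + 2 * ε ^ 2 := by
  have h2 := Real.one_sub_inv_le_log_of_pos (show 0 < 1 - ε by linarith)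
  have h3 : (1 - ε)⁻¹ ≤ 1 + ε + 2 * ε ^ 2 := by
    rw [inv_le_iff_one_le_mul₀ (by linarith)]
    nlinarith [mul_nonneg h0 h0, mul_nonneg (mul_nonneg h0 h0) (show 0 ≤ 1 - 2 * ε by linarith)]
  linarith

/-- The potential function of the multiplicative weight updates. -/
noncomputable def potential (α w : ι → ℝ) : ℝ := ∑ i, α i * Real.log (w i) - Real.log (∑ i, w i)

/-- No single weight exceeds the total weight, and `α` averages the logarithms. -/
theorem potential_nonpos {α w : ι → ℝ} (hα : ∀ i, 0 ≤ α i) (hα1 : ∑ i, α i = 1)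
    (hw : ∀ i, 0 < w i) : potential α w ≤ 0 := by
  have h : ∑ i, α i * Real.log (w i) ≤ ∑ i, α i * Real.log (∑ j, w j) :=
    Finset.sum_le_sum fun i _ => mul_le_mul_of_nonneg_left
      (Real.log_le_log (hw i)
        (Finset.single_le_sum (f := w) (fun j _ => (hw j).le) (Finset.mem_univ i))) (hα i)
  rw [← Finset.sum_mul, hα1, one_mul] at h
  unfold potential; linarith

/-- One update lowers the logarithm of the total weight by at least `ε` times the learner's mean
loss, and the `α`-average of the log weights by at most `ε + 2ε²` times the comparator's mean loss.
So the potential rises by at least `ε` times the difference of the mean losses, up to `2ε²`. That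
difference times `2 * lam` is exactly the excess, since the losses are affine in `(σ - y) x`. -/
theorem excess_scaled (x : Ω → ι → ℝ) (y : Ω → ℝ) {lam ε : ℝ} (hlam : 0 ≤ lam) (hε : 0 < ε)
    (hε2 : ε ≤ 1 / 2) {α w : ι → ℝ} (hα : ∀ i, 0 ≤ α i) (hα1 : ∑ i, α i = 1) (hw : ∀ i, 0 < w i)
    (z : Ω) (hx : ∀ i, |x z i| ≤ 1) (hy0 : 0 ≤ y z) (hy1 : y z ≤ 1) :
    ε * excess x y (fun i => lam * α i) (scaled lam w) z ≤
      2 * lam * (potential α (fun i => w i * (1 - ε) ^ loss (scaled lam w) (x z) (y z) i) -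
        potential α w + 2 * ε ^ 2) := by
  set ℓ := loss (scaled lam w) (x z) (y z) with hℓ
  have hne : Nonempty ι := by
    by_contra h
    rw [not_nonempty_iff] at h
    simp at hα1
  set W := ∑ i, w i with hW
  have hWpos : 0 < W := Finset.sum_pos (fun i _ => hw i) Finset.univ_nonempty
  have hWabs : ∑ i, |w i| = W := Finset.sum_congr rfl fun i _ => abs_of_pos (hw i)
  have hβ : (0:ℝ) < 1 - ε := by linarith
  set m := ∑ i, w i * ℓ i with hm
  -- the total weight decreases
  have h1 : ∑ i, w i * (1 - ε) ^ ℓ i ≤ W - ε * m := by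
    calc ∑ i, w i * (1 - ε) ^ ℓ i ≤ ∑ i, w i * (1 - ε * ℓ i) := by
          refine Finset.sum_le_sum fun i _ => mul_le_mul_of_nonneg_left ?_ (hw i).le
          obtain ⟨a, b⟩ := loss_mem_Icc (v := scaled lam w) hx hy0 hy1 i
          -- Bernoulli's inequality for exponents in `[0, 1]`: `(1 - ε)^ℓ ≤ 1 - ε ℓ`.
          have := rpow_one_add_le_one_add_mul_self (s := -ε) (by linarith) a b
          rw [← sub_eq_add_neg] at this
          linarith
      _ = W - ε * m := by
          rw [hW, hm, Finset.mul_sum, ← Finset.sum_sub_distrib]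
          exact Finset.sum_congr rfl fun i _ => by ring
  have hW' : 0 < ∑ i, w i * (1 - ε) ^ ℓ i :=
    Finset.sum_pos (fun i _ => mul_pos (hw i) (Real.rpow_pos_of_pos hβ _)) Finset.univ_nonempty
  have h2 : Real.log (∑ i, w i * (1 - ε) ^ ℓ i) ≤ Real.log W - ε * m / W := by
    have h3 : ∑ i, w i * (1 - ε) ^ ℓ i ≤ W * (1 - ε * m / W) := by
      have : W * (1 - ε * m / W) = W - ε * m := by field_simp
      rwa [this]
    -- Otherwise the new total weight, which is positive, would be bounded by a nonpositive number.
    have h4 : 0 < 1 - ε * m / W := by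
      by_contra hcon
      push Not at hcon
      nlinarith
    calc _ ≤ Real.log (W * (1 - ε * m / W)) := Real.log_le_log hW' h3
      _ = Real.log W + Real.log (1 - ε * m / W) := Real.log_mul hWpos.ne' h4.ne'
      _ ≤ _ := by linarith [Real.log_le_sub_one_of_pos h4]
  have h5 : ∑ i, α i * Real.log (w i * (1 - ε) ^ ℓ i) =
      ∑ i, α i * Real.log (w i) + (∑ i, α i * ℓ i) * Real.log (1 - ε) := by
    rw [Finset.sum_mul, ← Finset.sum_add_distrib]
    refine Finset.sum_congr rfl fun i _ => ?_
    rw [Real.log_mul (hw i).ne' (Real.rpow_pos_of_pos hβ _).ne', Real.log_rpow hβ]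
    ring
  have h6 : 0 ≤ ∑ i, α i * ℓ i := Finset.sum_nonneg fun i _ =>
    mul_nonneg (hα i) (loss_mem_Icc hx hy0 hy1 i).1
  have h7 : ∑ i, α i * ℓ i ≤ 1 := by
    rw [← hα1]
    exact Finset.sum_le_sum fun i _ =>
      mul_le_of_le_one_right (hα i) (loss_mem_Icc hx hy0 hy1 i).2
  have h8 := neg_log_one_sub_le hε.le hε2
  have h9 : ε * (m / W - ∑ i, α i * ℓ i) ≤
      potential α (fun i => w i * (1 - ε) ^ ℓ i) - potential α w + 2 * ε ^ 2 := by
    unfold potential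
    rw [h5]
    have : (∑ i, α i * ℓ i) * -Real.log (1 - ε) ≤ (∑ i, α i * ℓ i) * ε + 2 * ε ^ 2 := by
      nlinarith [mul_le_mul_of_nonneg_left h8 h6, sq_nonneg ε]
    have h10 : ε * (m / W) = ε * m / W := by ring
    rw [mul_sub, h10]
    nlinarith
  set g := Real.sigmoid (dot (scaled lam w) (x z)) - y z with hg
  have hℓi : ∀ i, ℓ i = (1 + g * x z i) / 2 := fun i => rfl
  -- The summand `lam` comes from the constant 1 in the losses. It appears in `h11` as well and
  -- cancels in the difference `h12`.
  have h10 : 2 * lam * (m / W) = lam + g * dot (scaled lam w) (x z) := by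
    have : dot (scaled lam w) (x z) = lam * (∑ i, w i * x z i) / W := by
      simp only [dot, scaled, hWabs]
      rw [Finset.mul_sum, Finset.sum_div]
      exact Finset.sum_congr rfl fun i _ => by ring
    rw [this]
    have : m = (W + g * ∑ i, w i * x z i) / 2 := by
      rw [hm, hW, Finset.mul_sum, ← Finset.sum_add_distrib, Finset.sum_div]
      exact Finset.sum_congr rfl fun i _ => by rw [hℓi]; ring
    rw [this]; field_simp
  have h11 : 2 * lam * ∑ i, α i * ℓ i = lam + g * dot (fun i => lam * α i) (x z) := by
    have : ∑ i, α i * ℓ i = (1 + g * ∑ i, α i * x z i) / 2 := by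
      rw [← hα1, Finset.mul_sum, ← Finset.sum_add_distrib, Finset.sum_div]
      exact Finset.sum_congr rfl fun i _ => by rw [hℓi]; ring
    rw [this]
    have : dot (fun i => lam * α i) (x z) = lam * ∑ i, α i * x z i := by
      rw [dot, Finset.mul_sum]
      exact Finset.sum_congr rfl fun i _ => by ring
    rw [this]; ring
  have h12 : excess x y (fun i => lam * α i) (scaled lam w) z =
      2 * lam * (m / W - ∑ i, α i * ℓ i) := by
    rw [mul_sub, h10, h11, excess]; ring
  rw [h12]
  nlinarith [mul_le_mul_of_nonneg_left h9 (show 0 ≤ 2 * lam by linarith)]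

/-- The one-step inequalities telescope, and the final potential is at most 0. -/
theorem regret_le_potential (x : Ω → ι → ℝ) (y : Ω → ℝ) {lam ε : ℝ} (hlam : 0 ≤ lam) (hε : 0 < ε)
    (hε2 : ε ≤ 1 / 2) {α : ι → ℝ} (hα : ∀ i, 0 ≤ α i) (hα1 : ∑ i, α i = 1)
    (hx : ∀ z i, |x z i| ≤ 1) (hy0 : ∀ z, 0 ≤ y z) (hy1 : ∀ z, y z ≤ 1) (w : ι → ℝ)
    (hw : ∀ i, 0 < w i) (s : List Ω) :
    ε * regret x y lam (1 - ε) (fun i => lam * α i) w s ≤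
      2 * lam * (-potential α w + 2 * ε ^ 2 * s.length) := by
  induction s generalizing w with
  | nil =>
    have := potential_nonpos hα hα1 hw
    simp only [regret, List.length_nil, Nat.cast_zero, mul_zero, add_zero]
    nlinarith
  | cons z s ih =>
    have h1 := ih (fun i => w i * (1 - ε) ^ loss (scaled lam w) (x z) (y z) i)
      (fun i => mul_pos (hw i) (Real.rpow_pos_of_pos (by linarith) _))
    have h2 := excess_scaled x y hlam hε hε2 hα hα1 hw z (hx z) (hy0 z) (hy1 z)
    simp only [regret, List.length_cons, Nat.cast_add, Nat.cast_one]
    linarith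

theorem potential_uniform [Nonempty ι] {α : ι → ℝ} (hα1 : ∑ i, α i = 1) :
    potential α (fun _ => 1 / (Fintype.card ι : ℝ)) = -Real.log (Fintype.card ι) := by
  have : (Fintype.card ι : ℝ) ≠ 0 := by simp
  simp only [potential, ← Finset.sum_mul, hα1, Finset.sum_const, Finset.card_univ, nsmul_eq_mul,
    one_mul]
  rw [mul_one_div_cancel this]
  simp

/-- The learning rate satisfies `ε² T = log₂ d`, so the initial potential contributes `log d ≤ ε² T`
and the second-order terms contribute `2ε² T`. Together these give `2 * lam * 3ε² T`, which is then
divided by `ε`. -/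
theorem regret_sparsitron_le [Nonempty ι] (x : Ω → ι → ℝ) (y : Ω → ℝ) {lam : ℝ} (hlam : 0 ≤ lam)
    {α : ι → ℝ} (hα : ∀ i, 0 ≤ α i) (hα1 : ∑ i, α i = 1)
    (hx : ∀ z i, |x z i| ≤ 1) (hy0 : ∀ z, 0 ≤ y z) (hy1 : ∀ z, y z ≤ 1) (s : List Ω)
    (hd : 2 ≤ Fintype.card ι) (hs : s ≠ [])
    (hε2 : learningRate (Fintype.card ι) s.length ≤ 1 / 2) :
    regret x y lam (1 - learningRate (Fintype.card ι) s.length) (fun i => lam * α i)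
      (fun _ => 1 / (Fintype.card ι : ℝ)) s ≤
      6 * lam * learningRate (Fintype.card ι) s.length * s.length := by
  set ε := learningRate (Fintype.card ι) s.length with hεdef
  have hT : (0:ℝ) < s.length := by
    rw [Nat.cast_pos]; exact List.length_pos_iff.2 hs
  have hd' : (2:ℝ) ≤ Fintype.card ι := by exact_mod_cast hd
  have hlog : 0 < Real.log (Fintype.card ι) := Real.log_pos (by linarith)
  have hlog2 : Real.log (Fintype.card ι) ≤ Real.logb 2 (Fintype.card ι) := by
    rw [Real.logb, le_div_iff₀ (Real.log_pos (by norm_num))]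
    nlinarith [Real.log_two_lt_d9]
  have hq : 0 < Real.logb 2 (Fintype.card ι) / s.length := div_pos (by linarith) hT
  have hε : 0 < ε := Real.sqrt_pos.2 hq
  have hε3 : ε ^ 2 * s.length = Real.logb 2 (Fintype.card ι) := by
    rw [hεdef, learningRate, Real.sq_sqrt hq.le]; field_simp
  have h := regret_le_potential x y hlam hε hε2 hα hα1 hx hy0 hy1
    (fun _ => 1 / (Fintype.card ι : ℝ)) (fun _ => by positivity) s
  rw [potential_uniform hα1, neg_neg] at h
  refine le_of_mul_le_mul_left ?_ hε
  nlinarith [mul_le_mul_of_nonneg_left hlog2 hlam]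

end Regret

end MRF

namespace MRF

/-! ### Expectations over lists of independent samples; Hoeffding's inequality -/

section Expectation

variable {Ω : Type} [Fintype Ω]

/-- The expectation of a function of a list of `N` independent samples from the weights `μ`. -/
def listExp (μ : Ω → ℝ) : ℕ → (List Ω → ℝ) → ℝ
  | 0, f => f []
  | N + 1, f => ∑ z, μ z * listExp μ N (fun s => f (z :: s))

variable {μ : Ω → ℝ}

theorem listExp_mono (h0 : ∀ z, 0 ≤ μ z) (N : ℕ) {f g : List Ω → ℝ}
    (h : ∀ s, s.length = N → f s ≤ g s) : listExp μ N f ≤ listExp μ N g := by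
  induction N generalizing f g with
  | zero => exact h [] rfl
  | succ N ih =>
    exact Finset.sum_le_sum fun z _ => mul_le_mul_of_nonneg_left
      (ih fun s hs => h _ (by simp [hs])) (h0 z)

theorem listExp_congr (N : ℕ) {f g : List Ω → ℝ}
    (h : ∀ s, s.length = N → f s = g s) : listExp μ N f = listExp μ N g := by
  induction N generalizing f g with
  | zero => exact h [] rfl
  | succ N ih =>
    exact Finset.sum_congr rfl fun z _ => by rw [ih fun s hs => h _ (by simp [hs])]

theorem listExp_const (h1 : ∑ z, μ z = 1) (N : ℕ) (c : ℝ) : listExp μ N (fun _ => c) = c := by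
  induction N with
  | zero => rfl
  | succ N ih => simp [listExp, ih, ← Finset.sum_mul, h1]

theorem listExp_const_mul (N : ℕ) (c : ℝ) (f : List Ω → ℝ) :
    listExp μ N (fun s => c * f s) = c * listExp μ N f := by
  induction N generalizing f with
  | zero => rfl
  | succ N ih =>
    simp only [listExp, ih, Finset.mul_sum]
    exact Finset.sum_congr rfl fun z _ => by ring

theorem listExp_add (N : ℕ) (f g : List Ω → ℝ) :
    listExp μ N (fun s => f s + g s) = listExp μ N f + listExp μ N g := by
  induction N generalizing f g with
  | zero => rfl
  | succ N ih => simp only [listExp, ih, mul_add, Finset.sum_add_distrib]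

theorem listExp_sum (h1 : ∑ z, μ z = 1) (N : ℕ) {κ : Type} (A : Finset κ) (f : κ → List Ω → ℝ) :
    listExp μ N (fun s => ∑ k ∈ A, f k s) = ∑ k ∈ A, listExp μ N (f k) := by
  classical
  induction A using Finset.induction_on with
  | empty => simpa using listExp_const h1 N 0
  | insert a A ha ih => simp only [Finset.sum_insert ha, listExp_add, ih]

/-- Fubini for the first `a` and the last `b` samples. It is what makes the training samples fixed
while the validation samples are random. -/
theorem listExp_append (a b : ℕ) (f : List Ω → ℝ) :
    listExp μ (a + b) f = listExp μ a (fun s => listExp μ b (fun t => f (s ++ t))) := by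
  induction a generalizing f with
  | zero => simp [listExp]
  | succ a ih =>
    rw [Nat.succ_add]
    simp only [listExp, ih, List.cons_append]

open Classical in
/-- The probability of an event that depends on a list of `N` independent samples. -/
noncomputable def listProb (μ : Ω → ℝ) (N : ℕ) (E : List Ω → Prop) : ℝ :=
  listExp μ N (fun s => if E s then 1 else 0)

theorem listProb_mono (h0 : ∀ z, 0 ≤ μ z) (N : ℕ) {E F : List Ω → Prop}
    (h : ∀ s, s.length = N → E s → F s) : listProb μ N E ≤ listProb μ N F := by
  refine listExp_mono h0 N fun s hs => ?_
  have := h s hs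
  split_ifs <;> simp_all

theorem listProb_or_le (h0 : ∀ z, 0 ≤ μ z) (N : ℕ) (E F : List Ω → Prop) :
    listProb μ N (fun s => E s ∨ F s) ≤ listProb μ N E + listProb μ N F := by
  rw [listProb, listProb, listProb, ← listExp_add]
  refine listExp_mono h0 N fun s _ => ?_
  split_ifs <;> simp_all

theorem listProb_exists_le (h0 : ∀ z, 0 ≤ μ z) (h1 : ∑ z, μ z = 1) (N : ℕ) {κ : Type}
    (A : Finset κ) (E : κ → List Ω → Prop) :
    listProb μ N (fun s => ∃ k ∈ A, E k s) ≤ ∑ k ∈ A, listProb μ N (E k) := by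
  classical
  simp only [listProb]
  rw [← listExp_sum h1]
  refine listExp_mono h0 N fun s _ => ?_
  split_ifs with h
  · obtain ⟨k, hk, hE⟩ := h
    have := Finset.single_le_sum (f := fun k => if E k s then (1:ℝ) else 0)
      (fun k _ => by split_ifs <;> norm_num) hk
    simpa [hE] using this
  · exact Finset.sum_nonneg fun k _ => by split_ifs <;> norm_num

theorem listProb_list_le (h0 : ∀ z, 0 ≤ μ z) (h1 : ∑ z, μ z = 1) (N : ℕ) {κ : Type}
    (A : List κ) (E : κ → List Ω → Prop) {c : ℝ} (h : ∀ k ∈ A, listProb μ N (E k) ≤ c) :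
    listProb μ N (fun s => ∃ k ∈ A, E k s) ≤ A.length * c := by
  induction A with
  | nil =>
    have := listExp_const h1 N 0
    simp [listProb, this]
  | cons a A ih =>
    have h2 := ih fun k hk => h k (List.mem_cons_of_mem _ hk)
    have h3 := h a List.mem_cons_self
    have h4 : listProb μ N (fun s => ∃ k ∈ a :: A, E k s) ≤
        listProb μ N (E a) + listProb μ N (fun s => ∃ k ∈ A, E k s) := by
      refine le_trans (listProb_mono h0 N ?_) (listProb_or_le h0 N _ _)
      rintro s - ⟨k, hk, hE⟩
      rcases List.mem_cons.1 hk with rfl | hk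
      · exact Or.inl hE
      · exact Or.inr ⟨k, hk, hE⟩
    push_cast [List.length_cons]
    linarith

theorem listProb_not (h1 : ∑ z, μ z = 1) (N : ℕ) (E : List Ω → Prop) :
    listProb μ N (fun s => ¬ E s) = 1 - listProb μ N E := by
  have h : listProb μ N (fun s => ¬ E s) + listProb μ N E = 1 := by
    rw [listProb, listProb, ← listExp_add]
    refine (listExp_congr N fun s _ => ?_).trans (listExp_const h1 N 1)
    split_ifs <;> simp_all
  linarith

/-- An event about the first `a` of `a + b` samples. -/
theorem listProb_take (h1 : ∑ z, μ z = 1) (a b : ℕ) (E : List Ω → Prop) :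
    listProb μ (a + b) (fun s => E (s.take a)) = listProb μ a E := by
  rw [listProb, listExp_append, listProb]
  refine listExp_congr a fun s hs => ?_
  refine (listExp_congr b fun t _ => ?_).trans (listExp_const h1 b _)
  rw [List.take_left' hs]

/-- An event whose conditional probability given the first `a` samples is always at most `c`. -/
theorem listProb_take_drop_le (h0 : ∀ z, 0 ≤ μ z) (h1 : ∑ z, μ z = 1) (a b : ℕ)
    (E : List Ω → List Ω → Prop) {c : ℝ}
    (h : ∀ s, s.length = a → listProb μ b (E s) ≤ c) :
    listProb μ (a + b) (fun s => E (s.take a) (s.drop a)) ≤ c := by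
  rw [listProb, listExp_append, ← listExp_const h1 a c]
  refine listExp_mono h0 a fun s hs => le_trans (le_of_eq ?_) (h s hs)
  refine listExp_congr b fun t _ => ?_
  rw [List.take_left' hs, List.drop_left' hs]

/-- Markov's inequality for `exp (f s)`. -/
theorem listProb_le_of_exp (h0 : ∀ z, 0 ≤ μ z) (N : ℕ) (f : List Ω → ℝ) {a B : ℝ}
    (h : listExp μ N (fun s => Real.exp (f s)) ≤ B) :
    listProb μ N (fun s => a ≤ f s) ≤ Real.exp (-a) * B := by
  refine le_trans ?_ (mul_le_mul_of_nonneg_left h (Real.exp_pos _).le)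
  rw [← listExp_const_mul]
  refine listExp_mono h0 N fun s _ => ?_
  rw [← Real.exp_add]
  split_ifs with hs
  · rw [Real.one_le_exp_iff]; linarith
  · positivity

/-- By convexity, `exp` lies below its chord over `[-B, B]`. -/
theorem exp_le_cosh_add {x B : ℝ} (hB : 0 < B) (hx : |x| ≤ B) :
    Real.exp x ≤ Real.cosh B + x / B * Real.sinh B := by
  rw [abs_le] at hx
  have h := convexOn_exp.2 (Set.mem_univ B) (Set.mem_univ (-B))
    (show 0 ≤ (B + x) / (2 * B) from div_nonneg (by linarith) (by linarith))
    (show 0 ≤ (B - x) / (2 * B) from div_nonneg (by linarith) (by linarith))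
    (by field_simp; ring)
  have hx' : ((B + x) / (2 * B)) • B + ((B - x) / (2 * B)) • (-B) = x := by
    simp only [smul_eq_mul]; field_simp; ring
  rw [hx'] at h
  refine h.trans (le_of_eq ?_)
  simp only [smul_eq_mul, Real.cosh_eq, Real.sinh_eq]
  field_simp; ring

/-- Hoeffding's lemma. -/
theorem sum_mul_exp_le (h0 : ∀ z, 0 ≤ μ z) (h1 : ∑ z, μ z = 1) (f : Ω → ℝ) {B : ℝ}
    (hf : ∑ z, μ z * f z = 0) (hB : ∀ z, |f z| ≤ B) :
    ∑ z, μ z * Real.exp (f z) ≤ Real.exp (B ^ 2 / 2) := by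
  have hne : Nonempty Ω := by
    by_contra h
    rw [not_nonempty_iff] at h
    simp at h1
  have hB0 : 0 ≤ B := (abs_nonneg _).trans (hB hne.some)
  -- The chord degenerates for `B = 0`; in that case `f` vanishes identically.
  rcases hB0.eq_or_lt with rfl | hBpos
  · have : ∀ z, f z = 0 := fun z => abs_nonpos_iff.1 (hB z)
    simp [this, h1]
  calc ∑ z, μ z * Real.exp (f z)
      ≤ ∑ z, μ z * (Real.cosh B + f z / B * Real.sinh B) :=
        Finset.sum_le_sum fun z _ => mul_le_mul_of_nonneg_left (exp_le_cosh_add hBpos (hB z)) (h0 z)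
    _ = (∑ z, μ z) * Real.cosh B + (∑ z, μ z * f z) * (Real.sinh B / B) := by
        rw [Finset.sum_mul, Finset.sum_mul, ← Finset.sum_add_distrib]
        exact Finset.sum_congr rfl fun z _ => by ring
    _ = Real.cosh B := by rw [h1, hf]; ring
    _ ≤ _ := Real.cosh_le_exp_half_sq B

theorem sum_mul_sub_mean (h1 : ∑ z, μ z = 1) (g : Ω → ℝ) :
    ∑ z, μ z * (g z - ∑ z', μ z' * g z') = 0 := by
  simp only [mul_sub, Finset.sum_sub_distrib, ← Finset.sum_mul, h1]
  ring

theorem abs_mean_le (h0 : ∀ z, 0 ≤ μ z) (h1 : ∑ z, μ z = 1) (g : Ω → ℝ) {B : ℝ}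
    (hB : ∀ z, |g z| ≤ B) : |∑ z, μ z * g z| ≤ B := by
  calc |∑ z, μ z * g z| ≤ ∑ z, |μ z * g z| := Finset.abs_sum_le_sum_abs _ _
    _ ≤ ∑ z, μ z * B := Finset.sum_le_sum fun z _ => by
        rw [abs_mul, abs_of_nonneg (h0 z)]
        exact mul_le_mul_of_nonneg_left (hB z) (h0 z)
    _ = B := by rw [← Finset.sum_mul, h1, one_mul]

/-- By independence the exponential moment of a sum factors, one application of Hoeffding's lemma
per sample. -/
theorem listExp_exp_sum_le (h0 : ∀ z, 0 ≤ μ z) (h1 : ∑ z, μ z = 1) (f : Ω → ℝ) {B : ℝ}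
    (hf : ∑ z, μ z * f z = 0) (hB : ∀ z, |f z| ≤ B) (N : ℕ) :
    listExp μ N (fun s => Real.exp ((s.map f).sum)) ≤ Real.exp (N * (B ^ 2 / 2)) := by
  induction N with
  | zero => simp [listExp]
  | succ N ih =>
    simp only [listExp, List.map_cons, List.sum_cons, Real.exp_add, listExp_const_mul]
    calc _ = (∑ z, μ z * Real.exp (f z)) * listExp μ N (fun s => Real.exp ((s.map f).sum)) := by
          rw [Finset.sum_mul]
          exact Finset.sum_congr rfl fun z _ => by ring
      _ ≤ Real.exp (B ^ 2 / 2) * Real.exp (N * (B ^ 2 / 2)) := by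
          refine mul_le_mul (sum_mul_exp_le h0 h1 f hf hB) ih ?_ (Real.exp_pos _).le
          rw [← listExp_const h1 N 0]
          exact listExp_mono h0 N fun s _ => (Real.exp_pos _).le
      _ = _ := by rw [← Real.exp_add]; push_cast; congr 1; ring

/-- Hoeffding's inequality. -/
theorem listProb_sum_ge_le (h0 : ∀ z, 0 ≤ μ z) (h1 : ∑ z, μ z = 1) (f : Ω → ℝ)
    (hf : ∑ z, μ z * f z = 0) (hB : ∀ z, |f z| ≤ 1) (N : ℕ) {γ : ℝ} (hγ : 0 < γ) :
    listProb μ N (fun s => N * γ ≤ (s.map f).sum) ≤ Real.exp (-(N * γ ^ 2 / 2)) := by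
  -- The exponential parameter is `γ` itself, which minimizes `-N t γ + N t²/2` over `t`.
  have h := listExp_exp_sum_le h0 h1 (fun z => γ * f z) (B := γ)
    (by simp only [mul_left_comm _ γ, ← Finset.mul_sum, hf, mul_zero])
    (fun z => by rw [abs_mul, abs_of_pos hγ]; exact mul_le_of_le_one_right hγ.le (hB z)) N
  have h2 := listProb_le_of_exp h0 N (fun s => (s.map fun z => γ * f z).sum)
    (a := N * γ ^ 2) h
  rw [← Real.exp_add] at h2
  refine le_trans (listProb_mono h0 N ?_) (h2.trans (le_of_eq (by congr 1; ring)))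
  intro s _ hs
  rw [List.sum_map_mul_left]
  nlinarith

end Expectation

end MRF

namespace MRF

/-! ### The guarantee of the Sparsitron -/

theorem sigmoid_sub_le {s t : ℝ} (h : t ≤ s) : Real.sigmoid s - Real.sigmoid t ≤ s - t := by
  have := image_sub_le_mul_sub_of_deriv_le differentiable_sigmoid (C := 1) (fun x => by
    rw [Real.deriv_sigmoid]
    have h1 := Real.sigmoid_pos x
    have h2 := Real.sigmoid_lt_one x
    nlinarith) h
  linarith

/-- The product `σ(x) σ(-x)` is even, so `x ≥ 0` may be assumed. Then it equals `σ(x)² e^{-x}` with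
`σ(x) ≥ 1/2`. -/
theorem exp_neg_le_sigmoid_mul {x lam : ℝ} (hx : |x| ≤ lam) :
    Real.exp (-lam) / 4 ≤ Real.sigmoid x * (1 - Real.sigmoid x) := by
  rw [← Real.sigmoid_neg]
  wlog h : 0 ≤ x generalizing x
  · have := this (x := -x) (by rwa [abs_neg]) (by linarith)
    rw [neg_neg] at this
    linarith [mul_comm (Real.sigmoid x) (Real.sigmoid (-x))]
  rw [abs_of_nonneg h] at hx
  rw [← Real.sigmoid_mul_rexp_neg]
  have h1 : (1:ℝ) / 2 ≤ Real.sigmoid x := by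
    have := Real.sigmoid_le h
    rw [Real.sigmoid_zero] at this
    linarith
  have h2 : Real.exp (-lam) ≤ Real.exp (-x) := Real.exp_le_exp.2 (by linarith)
  have h3 := Real.exp_pos (-x)
  nlinarith [mul_self_nonneg (Real.sigmoid x - 1/2), mul_nonneg h3.le (show 0 ≤ Real.sigmoid x * Real.sigmoid x - 1/4 by nlinarith)]

theorem le_sigmoid_sub {s t lam : ℝ} (h : t ≤ s) (hs : |s| ≤ lam) (ht : |t| ≤ lam) :
    Real.exp (-lam) / 4 * (s - t) ≤ Real.sigmoid s - Real.sigmoid t := by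
  rw [abs_le] at hs ht
  refine (convex_Icc (-lam) lam).mul_sub_le_image_sub_of_le_deriv
    differentiable_sigmoid.continuous.continuousOn
    differentiable_sigmoid.differentiableOn (fun x hx => ?_) t ht s hs h
  rw [Real.deriv_sigmoid]
  have hx' : x ∈ Set.Icc (-lam) lam := interior_subset hx
  exact exp_neg_le_sigmoid_mul (abs_le.2 hx')

/-- The sigmoid is increasing and 1-Lipschitz, so both differences have the same sign and the first
is the smaller one in absolute value. -/
theorem sq_sigmoid_sub_le (s t : ℝ) :
    (Real.sigmoid s - Real.sigmoid t) ^ 2 ≤ (Real.sigmoid s - Real.sigmoid t) * (s - t) := by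
  rcases le_total t s with h | h
  · have h1 := sigmoid_sub_le h
    have h2 := Real.sigmoid_le h
    nlinarith
  · have h1 := sigmoid_sub_le h
    have h2 := Real.sigmoid_le h
    nlinarith

theorem mul_sq_le_sigmoid_sub {s t lam : ℝ} (hs : |s| ≤ lam) (ht : |t| ≤ lam) :
    Real.exp (-lam) / 4 * (s - t) ^ 2 ≤ (Real.sigmoid s - Real.sigmoid t) * (s - t) := by
  rcases le_total t s with h | h
  · have h1 := le_sigmoid_sub h hs ht
    nlinarith
  · have h1 := le_sigmoid_sub h ht hs
    nlinarith

theorem mul_sq_le_sq_sigmoid_sub {s t lam : ℝ} (hs : |s| ≤ lam) (ht : |t| ≤ lam) :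
    (Real.exp (-lam) / 4) ^ 2 * (s - t) ^ 2 ≤ (Real.sigmoid s - Real.sigmoid t) ^ 2 := by
  have h0 := (Real.exp_pos (-lam)).le
  rw [← mul_pow]
  rcases le_total t s with h | h
  · exact pow_le_pow_left₀ (mul_nonneg (by linarith) (by linarith)) (le_sigmoid_sub h hs ht) 2
  · have := pow_le_pow_left₀ (mul_nonneg (by linarith) (by linarith)) (le_sigmoid_sub h ht hs) 2
    nlinarith

/-- Expanded form of `∑ (f v - m)² ≥ 0`. With `m` the mean of `f` it becomes Jensen's inequality for
the square, without a division by the length. -/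
theorem sq_sum_le {κ : Type} (l : List κ) (f : κ → ℝ) (m : ℝ) :
    2 * m * (l.map f).sum - l.length * m ^ 2 ≤ (l.map fun v => f v ^ 2).sum := by
  induction l with
  | nil => simp
  | cons v l ih =>
    simp only [List.map_cons, List.sum_cons, List.length_cons, Nat.cast_add, Nat.cast_one]
    nlinarith [sq_nonneg (f v - m)]

section Guarantee

variable {Ω ι : Type} [Fintype Ω] [Fintype ι]

theorem abs_dot_le {v x : ι → ℝ} {lam : ℝ} (hv : ∑ i, |v i| ≤ lam) (hx : ∀ i, |x i| ≤ 1) :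
    |dot v x| ≤ lam :=
  calc |dot v x| ≤ ∑ i, |v i * x i| := Finset.abs_sum_le_sum_abs _ _
    _ ≤ ∑ i, |v i| := Finset.sum_le_sum fun i _ => by
        rw [abs_mul]; exact mul_le_of_le_one_right (abs_nonneg _) (hx i)
    _ ≤ lam := hv

/-- Samples with weights `μ` whose label `y` has conditional mean `σ(a ⬝ x)` given the features
`x`, where `a / lam` is a probability vector. -/
structure IsLogisticModel (μ : Ω → ℝ) (x : Ω → ι → ℝ) (y : Ω → ℝ) (lam : ℝ) (a : ι → ℝ) :
    Prop where
  weight_nonneg : ∀ z, 0 ≤ μ z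
  sum_weight : ∑ z, μ z = 1
  abs_feature_le : ∀ z i, |x z i| ≤ 1
  label_nonneg : ∀ z, 0 ≤ y z
  label_le_one : ∀ z, y z ≤ 1
  coeff_nonneg : ∀ i, 0 ≤ a i
  sum_coeff : ∑ i, a i = lam
  mean_label : ∀ h : (ι → ℝ) → ℝ, ∑ z, μ z * ((y z - Real.sigmoid (dot a (x z))) * h (x z)) = 0

/-- The expectation of `excess`. -/
noncomputable def meanExcess (μ : Ω → ℝ) (x : Ω → ι → ℝ) (y : Ω → ℝ) (a v : ι → ℝ) : ℝ :=
  ∑ z, μ z * excess x y a v z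

/-- The mean squared difference of the linear functions `v` and `a`. -/
noncomputable def sqDist (μ : Ω → ℝ) (x : Ω → ι → ℝ) (a v : ι → ℝ) : ℝ :=
  ∑ z, μ z * (dot v (x z) - dot a (x z)) ^ 2

/-- The mean squared difference of the sigmoid predictions of `v` and `a`. -/
noncomputable def sigmoidDist (μ : Ω → ℝ) (x : Ω → ι → ℝ) (a v : ι → ℝ) : ℝ :=
  ∑ z, μ z * (Real.sigmoid (dot v (x z)) - Real.sigmoid (dot a (x z))) ^ 2

/-- The risk of the vector `v`. -/
noncomputable def risk (μ : Ω → ℝ) (x : Ω → ι → ℝ) (y : Ω → ℝ) (v : ι → ℝ) : ℝ :=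
  ∑ z, μ z * (Real.sigmoid (dot v (x z)) - y z) ^ 2

namespace IsLogisticModel

variable {μ : Ω → ℝ} {x : Ω → ι → ℝ} {y : Ω → ℝ} {lam : ℝ} {a : ι → ℝ}

theorem sum_abs_coeff (h : IsLogisticModel μ x y lam a) : ∑ i, |a i| ≤ lam := by
  rw [← h.sum_coeff]
  exact (Finset.sum_congr rfl fun i _ => abs_of_nonneg (h.coeff_nonneg i)).le

theorem meanExcess_eq (h : IsLogisticModel μ x y lam a) (v : ι → ℝ) :
    meanExcess μ x y a v = ∑ z, μ z * ((Real.sigmoid (dot v (x z)) - Real.sigmoid (dot a (x z))) *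
      (dot v (x z) - dot a (x z))) := by
  have h1 := h.mean_label fun t => dot v t - dot a t
  rw [← sub_zero (∑ z, _), ← h1, meanExcess, eq_sub_iff_add_eq, ← Finset.sum_add_distrib]
  exact Finset.sum_congr rfl fun z _ => by rw [excess]; ring

theorem sigmoidDist_le_meanExcess (h : IsLogisticModel μ x y lam a) (v : ι → ℝ) :
    sigmoidDist μ x a v ≤ meanExcess μ x y a v := by
  rw [h.meanExcess_eq]
  exact Finset.sum_le_sum fun z _ => mul_le_mul_of_nonneg_left (sq_sigmoid_sub_le _ _)
    (h.weight_nonneg z)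

theorem sqDist_le_meanExcess (h : IsLogisticModel μ x y lam a) {v : ι → ℝ}
    (hv : ∑ i, |v i| ≤ lam) :
    Real.exp (-lam) / 4 * sqDist μ x a v ≤ meanExcess μ x y a v := by
  rw [h.meanExcess_eq, sqDist, Finset.mul_sum]
  refine Finset.sum_le_sum fun z _ => ?_
  rw [mul_left_comm]
  exact mul_le_mul_of_nonneg_left (mul_sq_le_sigmoid_sub (abs_dot_le hv (h.abs_feature_le z))
    (abs_dot_le h.sum_abs_coeff (h.abs_feature_le z))) (h.weight_nonneg z)

theorem sqDist_le_sigmoidDist (h : IsLogisticModel μ x y lam a) {v : ι → ℝ}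
    (hv : ∑ i, |v i| ≤ lam) :
    (Real.exp (-lam) / 4) ^ 2 * sqDist μ x a v ≤ sigmoidDist μ x a v := by
  rw [sigmoidDist, sqDist, Finset.mul_sum]
  refine Finset.sum_le_sum fun z _ => ?_
  rw [mul_left_comm]
  exact mul_le_mul_of_nonneg_left (mul_sq_le_sq_sigmoid_sub (abs_dot_le hv (h.abs_feature_le z))
    (abs_dot_le h.sum_abs_coeff (h.abs_feature_le z))) (h.weight_nonneg z)

/-- Pythagoras: the label noise is orthogonal to every function of the features, so the cross term
vanishes. Hence empirical risks can rank the vectors by their sigmoid distance to `a`. -/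
theorem risk_eq (h : IsLogisticModel μ x y lam a) (v : ι → ℝ) :
    risk μ x y v = sigmoidDist μ x a v + risk μ x y a := by
  have h1 := h.mean_label fun t => 2 * (Real.sigmoid (dot v t) - Real.sigmoid (dot a t))
  rw [← sub_zero (sigmoidDist μ x a v), ← h1, sub_add_eq_add_sub, eq_sub_iff_add_eq, risk,
    sigmoidDist, risk, ← Finset.sum_add_distrib, ← Finset.sum_add_distrib]
  exact Finset.sum_congr rfl fun z _ => by ring

theorem abs_excess_le (h : IsLogisticModel μ x y lam a) {v : ι → ℝ}
    (hv : ∑ i, |v i| ≤ lam) (z : Ω) : |excess x y a v z| ≤ 2 * lam := by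
  have h1 := abs_dot_le hv (h.abs_feature_le z)
  have h2 := abs_dot_le h.sum_abs_coeff (h.abs_feature_le z)
  have h3 : |Real.sigmoid (dot v (x z)) - y z| ≤ 1 := by
    have := Real.sigmoid_pos (dot v (x z))
    have := Real.sigmoid_lt_one (dot v (x z))
    have := h.label_nonneg z
    have := h.label_le_one z
    rw [abs_le]; constructor <;> linarith
  have h4 : |dot v (x z) - dot a (x z)| ≤ 2 * lam := by
    rw [abs_le] at *; constructor <;> linarith
  rw [excess, abs_mul]
  exact (mul_le_of_le_one_left (abs_nonneg _) h3).trans h4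

/-- Azuma's inequality for the multiplicative weight updates, in exponential form. -/
theorem listExp_exp_regret_le (h : IsLogisticModel μ x y lam a) (hlam : 0 ≤ lam) (β c : ℝ)
    (w : ι → ℝ) (N : ℕ) :
    listExp μ N (fun s => Real.exp (c * (((hedgeSeq x y lam β w s).map
      (meanExcess μ x y a)).sum - regret x y lam β a w s))) ≤
      Real.exp (N * ((c * (4 * lam)) ^ 2 / 2)) := by
  induction N generalizing w with
  | zero => simp [listExp, hedgeSeq, regret]
  | succ N ih =>
    set v := scaled lam w with hv
    have hv1 := sum_abs_scaled_le hlam w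
    have h3 : ∑ z, μ z * (c * (meanExcess μ x y a v - excess x y a v z)) = 0 := by
      have := sum_mul_sub_mean h.sum_weight (excess x y a v)
      rw [← mul_zero (-c), ← this, Finset.mul_sum]
      exact Finset.sum_congr rfl fun z _ => by rw [meanExcess]; ring
    -- The excess and its mean are each at most `2 * lam` in absolute value.
    have h4 : ∀ z, |c * (meanExcess μ x y a v - excess x y a v z)| ≤ |c| * (4 * lam) := by
      intro z
      rw [abs_mul]
      refine mul_le_mul_of_nonneg_left ?_ (abs_nonneg c)
      have h5 := h.abs_excess_le hv1 z
      have h6 := abs_mean_le h.weight_nonneg h.sum_weight (excess x y a v)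
        (fun z => h.abs_excess_le hv1 z)
      rw [← meanExcess] at h6
      rw [abs_le] at *; constructor <;> linarith
    have h5 := sum_mul_exp_le h.weight_nonneg h.sum_weight _ h3 h4
    rw [mul_pow, sq_abs, ← mul_pow] at h5
    calc _ = ∑ z, μ z * (Real.exp (c * (meanExcess μ x y a v - excess x y a v z)) *
          listExp μ N (fun s => Real.exp (c * (((hedgeSeq x y lam β
            (fun i => w i * β ^ loss v (x z) (y z) i) s).map (meanExcess μ x y a)).sum -
            regret x y lam β a (fun i => w i * β ^ loss v (x z) (y z) i) s)))) := by
          rw [listExp]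
          refine Finset.sum_congr rfl fun z _ => ?_
          congr 1
          rw [← listExp_const_mul]
          refine listExp_congr N fun s _ => ?_
          rw [← Real.exp_add, hedgeSeq, regret, List.map_cons, List.sum_cons]
          congr 1
          ring
      -- The weights after the first update depend on the sample `z`, but the induction hypothesis
      -- holds for all initial weights with the same bound.
      _ ≤ ∑ z, μ z * (Real.exp (c * (meanExcess μ x y a v - excess x y a v z)) *
          Real.exp (N * ((c * (4 * lam)) ^ 2 / 2))) :=
          Finset.sum_le_sum fun z _ => mul_le_mul_of_nonneg_left
            (mul_le_mul_of_nonneg_left (ih _) (Real.exp_pos _).le) (h.weight_nonneg z)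
      _ = (∑ z, μ z * Real.exp (c * (meanExcess μ x y a v - excess x y a v z))) *
          Real.exp (N * ((c * (4 * lam)) ^ 2 / 2)) := by
          rw [Finset.sum_mul]
          exact Finset.sum_congr rfl fun z _ => by ring
      _ ≤ Real.exp ((c * (4 * lam)) ^ 2 / 2) * Real.exp (N * ((c * (4 * lam)) ^ 2 / 2)) :=
          mul_le_mul_of_nonneg_right h5 (Real.exp_pos _).le
      _ = _ := by rw [← Real.exp_add]; push_cast; congr 1; ring

/-- With high probability the prediction vectors of the Sparsitron are good on average. -/
theorem listProb_train_le (h : IsLogisticModel μ x y lam a) (hlam : 0 < lam)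
    (hd : 2 ≤ Fintype.card ι) {T : ℕ} (hT : 0 < T) {θ : ℝ} (hθ : 0 < θ)
    (hr : learningRate (Fintype.card ι) T ≤ 1 / 2)
    (hrθ : 6 * lam * learningRate (Fintype.card ι) T ≤ θ) :
    listProb μ T (fun s => 2 * θ * T ≤ ((sparsitronSeq x y lam s).map
      (meanExcess μ x y a)).sum) ≤ Real.exp (-(T * θ ^ 2 / (32 * lam ^ 2))) := by
  have hne : Nonempty ι := Fintype.card_pos_iff.1 (show 0 < Fintype.card ι by omega)
  set ε := learningRate (Fintype.card ι) T with hε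
  -- This `c` minimizes `-c θ T + T (4 lam c)² / 2`; the minimum is `-T θ² / (32 lam²)`.
  set c := θ / (4 * lam) ^ 2 with hc
  have hc0 : 0 < c := by positivity
  have hx := h.listExp_exp_regret_le hlam.le (1 - ε) c (fun _ : ι => 1 / (Fintype.card ι : ℝ)) T
  have h2 := listProb_le_of_exp h.weight_nonneg T _ (a := c * (θ * T)) hx
  rw [← Real.exp_add] at h2
  refine le_trans (listProb_mono h.weight_nonneg T ?_) (h2.trans (le_of_eq ?_))
  · intro s hs hsum
    have hTR : (0:ℝ) < T := by exact_mod_cast hT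
    rw [sparsitronSeq, hs, ← hε] at hsum
    refine mul_le_mul_of_nonneg_left ?_ hc0.le
    -- The regret accounts for one `θ T` by `hrθ`. Hence a sum of at least `2 θ T` forces the
    -- martingale deviation to be at least the other `θ T`.
    have hreg := regret_sparsitron_le (α := fun i => a i / lam) x y hlam.le
      (fun i => div_nonneg (h.coeff_nonneg i) hlam.le)
      (by rw [← Finset.sum_div, h.sum_coeff, div_self hlam.ne'])
      h.abs_feature_le h.label_nonneg h.label_le_one s hd
      (by rintro rfl; simp at hs; omega) (by rw [hs]; exact hr)
    rw [hs, ← hε] at hreg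
    have ha : (fun i => lam * (a i / lam)) = a := by
      funext i; field_simp
    rw [ha] at hreg
    nlinarith
  · congr 1
    rw [hc]
    field_simp
    ring

/-- Squared errors and the risk lie in `[0, 1]`, so the centred errors have absolute value at most
1. Hoeffding's inequality is applied to both signs. -/
theorem listProb_valid_le (h : IsLogisticModel μ x y lam a) (v : ι → ℝ) (M : ℕ) {θ : ℝ}
    (hθ : 0 < θ) :
    listProb μ M (fun s => M * θ ≤ |sqErr x y v s - M * risk μ x y v|) ≤
      2 * Real.exp (-(M * θ ^ 2 / 2)) := by
  set f : Ω → ℝ := fun z => (Real.sigmoid (dot v (x z)) - y z) ^ 2 with hf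
  have hf0 : ∀ z, 0 ≤ f z := fun z => sq_nonneg _
  have hf1 : ∀ z, f z ≤ 1 := fun z => by
    have := Real.sigmoid_pos (dot v (x z))
    have := Real.sigmoid_lt_one (dot v (x z))
    have := h.label_nonneg z
    have := h.label_le_one z
    simp only [hf]
    rw [sq_le_one_iff_abs_le_one, abs_le]; constructor <;> linarith
  have hr0 : 0 ≤ risk μ x y v :=
    Finset.sum_nonneg fun z _ => mul_nonneg (h.weight_nonneg z) (hf0 z)
  have hr1 : risk μ x y v ≤ 1 := by
    rw [← h.sum_weight]
    exact Finset.sum_le_sum fun z _ => mul_le_of_le_one_right (h.weight_nonneg z) (hf1 z)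
  have hm : ∑ z, μ z * (f z - risk μ x y v) = 0 := sum_mul_sub_mean h.sum_weight f
  have hb : ∀ z, |f z - risk μ x y v| ≤ 1 := fun z => by
    have := hf0 z
    have := hf1 z
    rw [abs_le]; constructor <;> linarith
  have h1 := listProb_sum_ge_le h.weight_nonneg h.sum_weight _ hm hb M hθ
  have h2 := listProb_sum_ge_le h.weight_nonneg h.sum_weight (fun z => -(f z - risk μ x y v))
    (by simp only [mul_neg, Finset.sum_neg_distrib, hm, neg_zero])
    (fun z => by rw [abs_neg]; exact hb z) M hθ
  have h3 : ∀ s : List Ω, (s.map fun z => f z - risk μ x y v).sum =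
      sqErr x y v s - s.length * risk μ x y v := by
    intro s
    induction s with
    | nil => simp [sqErr]
    | cons z s ih =>
      simp only [sqErr, List.map_cons, List.sum_cons, List.length_cons, Nat.cast_add,
        Nat.cast_one] at ih ⊢
      rw [ih]
      simp only [hf, dot]
      ring
  have h4 : ∀ s : List Ω, (s.map fun z => -(f z - risk μ x y v)).sum =
      -(sqErr x y v s - s.length * risk μ x y v) := by
    intro s
    rw [← h3]
    induction s with
    | nil => simp
    | cons z s ih => simp only [List.map_cons, List.sum_cons, ih, neg_add]
  have h5 := add_le_add h1 h2
  rw [← two_mul] at h5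
  refine le_trans (le_trans (listProb_mono h.weight_nonneg M ?_)
    (listProb_or_le h.weight_nonneg M _ _)) h5
  intro s hs hE
  rw [h3, h4, hs]
  exact le_abs.1 hE

/-- Convexity of the square, applied pointwise at each sample `z`: the inner product with the
average vector is the average of the inner products. -/
theorem sqDist_average_le (h0 : ∀ z, 0 ≤ μ z) (vs : List (ι → ℝ)) (hvs : vs ≠ []) :
    vs.length * sqDist μ x a (fun i => (vs.map fun v => v i).sum / (vs.length : ℝ)) ≤
      (vs.map (sqDist μ x a)).sum := by
  have hT : (0:ℝ) < vs.length := by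
    rw [Nat.cast_pos]; exact List.length_pos_iff.2 hvs
  have hsum : ∀ l : List (ι → ℝ), (l.map (sqDist μ x a)).sum =
      ∑ z, μ z * (l.map fun v => (dot v (x z) - dot a (x z)) ^ 2).sum := by
    intro l
    induction l with
    | nil => simp
    | cons v l ih =>
      simp only [List.map_cons, List.sum_cons, ih, mul_add, Finset.sum_add_distrib, sqDist]
  have hdot : ∀ (l : List (ι → ℝ)) (t : ι → ℝ),
      ∑ i, (l.map fun v => v i).sum * t i = (l.map fun v => dot v t).sum := by
    intro l t
    induction l with
    | nil => simp
    | cons v l ih => simp only [List.map_cons, List.sum_cons, add_mul, Finset.sum_add_distrib, ih,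
        dot]
  have hsub : ∀ (l : List (ι → ℝ)) (t : ι → ℝ), (l.map fun v => dot v t - dot a t).sum =
      (l.map fun v => dot v t).sum - l.length * dot a t := by
    intro l t
    induction l with
    | nil => simp
    | cons v l ih =>
      simp only [List.map_cons, List.sum_cons, List.length_cons, ih]; push_cast; ring
  rw [hsum, sqDist, Finset.mul_sum]
  refine Finset.sum_le_sum fun z _ => ?_
  rw [mul_left_comm]
  refine mul_le_mul_of_nonneg_left ?_ (h0 z)
  set m := dot (fun i => (vs.map fun v => v i).sum / (vs.length : ℝ)) (x z) - dot a (x z) with hm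
  have h1 := sq_sum_le vs (fun v => dot v (x z) - dot a (x z)) m
  have h2 : (vs.map fun v => dot v (x z) - dot a (x z)).sum = vs.length * m := by
    rw [hsub, hm, mul_sub, ← hdot]
    congr 1
    rw [dot, Finset.mul_sum]
    exact Finset.sum_congr rfl fun i _ => by field_simp
  rw [h2] at h1
  nlinarith

/-- The Sparsitron succeeds: it returns a vector close to `a` in mean square. -/
def Succeeds (rule : OutputRule) (L : List ι) (μ : Ω → ℝ) (x : Ω → ι → ℝ) (y : Ω → ℝ) (lam : ℝ)
    (a : ι → ℝ) (D : ℝ) (train valid : List Ω) : Prop :=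
  ∃ v : ι → ℝ, ∑ i, |v i| ≤ lam ∧ sqDist μ x a v ≤ D ∧
    (sparsitronT rule (Fintype.card ι) lam (train.map fun z => (L.map (x z), y z))
      (valid.map fun z => (L.map (x z), y z))).val = L.map v

/-- Outside the two bad events the average mean excess is below `2θ`, and every empirical risk is
within `θ` of the true one. Averaging then yields the distance `8 e^{lam} θ`. Validation picks a
vector whose sigmoid distance is at most `2θ + 2θ`, and the factor `(e^{-lam}/4)²` turns this into
`64 e^{2 lam} θ`, which serves as the common bound. -/
theorem listProb_not_succeeds_le (h : IsLogisticModel μ x y lam a) (hlam : 0 < lam)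
    {L : List ι} (hL : ∀ g : ι → ℝ, (L.map g).sum = ∑ i, g i) (rule : OutputRule)
    (hd : 2 ≤ Fintype.card ι) {T M : ℕ} (hT : 0 < T) (hM : 0 < M) {θ : ℝ} (hθ : 0 < θ)
    (hr : learningRate (Fintype.card ι) T ≤ 1 / 2)
    (hrθ : 6 * lam * learningRate (Fintype.card ι) T ≤ θ) :
    listProb μ (T + M) (fun s => ¬ Succeeds rule L μ x y lam a
      (64 * Real.exp (2 * lam) * θ) (s.take T) (s.drop T)) ≤
      Real.exp (-(T * θ ^ 2 / (32 * lam ^ 2))) + T * (2 * Real.exp (-(M * θ ^ 2 / 2))) := by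
  have hTR : (0:ℝ) < T := by exact_mod_cast hT
  have hMR : (0:ℝ) < M := by exact_mod_cast hM
  have hκ : Real.exp (2 * lam) * Real.exp (-lam) ^ 2 = 1 := by
    rw [← Real.exp_nat_mul, ← Real.exp_add]; simp
  have hκ' : Real.exp (-lam) ≤ 1 := Real.exp_le_one_iff.2 (by linarith)
  have hκ0 := Real.exp_pos (-lam)
  have he0 := Real.exp_pos (2 * lam)
  have h1 := h.listProb_train_le hlam hd hT hθ hr hrθ
  rw [← listProb_take h.sum_weight T M] at h1
  -- Given the training samples, the candidates are `T` fixed vectors, and the validation samples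
  -- are independent of them. This permits a union bound over the candidates.
  have h2 : listProb μ (T + M) (fun s => ∃ v ∈ sparsitronSeq x y lam (s.take T),
      M * θ ≤ |sqErr x y v (s.drop T) - M * risk μ x y v|) ≤
      T * (2 * Real.exp (-(M * θ ^ 2 / 2))) := by
    refine listProb_take_drop_le h.weight_nonneg h.sum_weight T M
      (fun s t => ∃ v ∈ sparsitronSeq x y lam s,
        M * θ ≤ |sqErr x y v t - M * risk μ x y v|) fun s hs => ?_
    have := listProb_list_le h.weight_nonneg h.sum_weight M (sparsitronSeq x y lam s)
      (fun v t => M * θ ≤ |sqErr x y v t - M * risk μ x y v|)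
      (fun v _ => h.listProb_valid_le v M hθ)
    rwa [length_sparsitronSeq, hs] at this
  refine le_trans (le_trans (listProb_mono h.weight_nonneg _ ?_)
    (listProb_or_le h.weight_nonneg _ _ _)) (add_le_add h1 h2)
  intro s hs hbad
  by_contra hcon
  push Not at hcon
  obtain ⟨hgood, hval⟩ := hcon
  apply hbad
  have hlt : (s.take T).length = T := by rw [List.length_take]; omega
  have hlv : (s.drop T).length = M := by rw [List.length_drop]; omega
  set train := s.take T
  set valid := s.drop T
  have hne : train ≠ [] := by
    intro h0; rw [h0] at hlt; simp at hlt; omega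
  have hlen := length_sparsitronSeq x y lam train
  rw [hlt] at hlen
  have hsne : sparsitronSeq x y lam train ≠ [] := by
    intro h0; rw [h0] at hlen; simp at hlen; omega
  have hnorm := sum_abs_le_of_mem_sparsitronSeq x y hlam.le train
  cases rule with
  | average =>
    refine ⟨_, ?_, ?_, sparsitronT_average_val hL x y lam train valid⟩
    · rw [← length_sparsitronSeq x y lam train]
      exact sum_abs_average_le hlam.le _ hnorm
    · have h3 := sqDist_average_le (x := x) (a := a) h.weight_nonneg _ hsne
      rw [length_sparsitronSeq] at h3
      have h4 : Real.exp (-lam) / 4 * ((sparsitronSeq x y lam train).map (sqDist μ x a)).sum ≤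
          ((sparsitronSeq x y lam train).map (meanExcess μ x y a)).sum := by
        rw [← List.sum_map_mul_left]
        exact List.sum_le_sum fun v hv => h.sqDist_le_meanExcess (hnorm v hv)
      set D := sqDist μ x a
        fun i => ((sparsitronSeq x y lam train).map fun v => v i).sum / (train.length : ℝ)
      rw [hlt] at h3
      have h5 : Real.exp (-lam) / 4 * (T * D) ≤ 2 * θ * T :=
        ((mul_le_mul_of_nonneg_left h3 (by positivity)).trans h4).trans hgood.le
      have h6 : Real.exp (-lam) * D ≤ 8 * θ := by
        refine le_of_mul_le_mul_left ?_ hTR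
        nlinarith
      have h7 : D = Real.exp (2 * lam) * (Real.exp (-lam) * (Real.exp (-lam) * D)) := by
        linear_combination (-D) * hκ
      rw [h7]
      have h8 : Real.exp (-lam) * (Real.exp (-lam) * D) ≤ 64 * θ := by nlinarith
      nlinarith
  | validate =>
    obtain ⟨v, hv, hve, hmin⟩ := sparsitronT_validate_val hL x y lam train valid hne
    refine ⟨v, hnorm v hv, ?_, hve⟩
    -- Some vector is at least as good as the average of the sequence.
    obtain ⟨v', hv', hv'e⟩ : ∃ v' ∈ sparsitronSeq x y lam train,
        meanExcess μ x y a v' ≤ 2 * θ := by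
      by_contra hno
      push Not at hno
      have h3 := List.card_nsmul_le_sum ((sparsitronSeq x y lam train).map (meanExcess μ x y a))
        (2 * θ) (by
          intro t ht
          obtain ⟨v', hv', rfl⟩ := List.mem_map.1 ht
          exact (hno v' hv').le)
      rw [List.length_map, hlen, nsmul_eq_mul] at h3
      linarith
    have h3 := h.sigmoidDist_le_meanExcess v'
    have h4 := hmin v' hv'
    rw [hlv, div_le_div_iff_of_pos_right hMR] at h4
    have h5 := (abs_lt.1 (hval v hv)).1
    have h6 := (abs_lt.1 (hval v' hv')).2
    have h7 := h.risk_eq v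
    have h8 := h.risk_eq v'
    have h9 : risk μ x y v ≤ risk μ x y v' + 2 * θ := by
      refine le_of_mul_le_mul_left ?_ hMR
      nlinarith
    have h10 := h.sqDist_le_sigmoidDist (hnorm v hv)
    have h11 : Real.exp (-lam) ^ 2 * sqDist μ x a v ≤ 64 * θ := by nlinarith
    have h12 : sqDist μ x a v = Real.exp (2 * lam) * (Real.exp (-lam) ^ 2 * sqDist μ x a v) := by
      linear_combination (-(sqDist μ x a v)) * hκ
    rw [h12]
    nlinarith

end IsLogisticModel

end Guarantee

end MRF

namespace MRF

/-! ### Gibbs weights and multilinear polynomials -/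

section Gibbs

variable {n : ℕ}

/-- Change the sign of the coordinate `i`. -/
def flip (i : Fin n) (z : Config n) : Config n := Function.update z i (-(z i))

theorem flip_flip (i : Fin n) (z : Config n) : flip i (flip i z) = z := by
  simp [flip]

theorem sum_flip (i : Fin n) (f : Config n → ℝ) : ∑ z, f (flip i z) = ∑ z, f z :=
  Equiv.sum_comp (Function.Involutive.toPerm (flip i) (flip_flip i)) f

theorem spin_flip_self (i : Fin n) (z : Config n) : spin (flip i z) i = -spin z i := by
  simp [spin, flip]

theorem spin_flip_of_ne {i j : Fin n} (h : j ≠ i) (z : Config n) :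
    spin (flip i z) j = spin z j := by
  simp [spin, flip, h]

theorem spin_eq (z : Config n) (i : Fin n) : spin z i = 1 ∨ spin z i = -1 := by
  unfold spin
  rcases Int.units_eq_one_or (z i) with h | h <;> simp [h]

theorem prod_spin_eq (I : Finset (Fin n)) (z : Config n) :
    ∏ i ∈ I, spin z i = 1 ∨ ∏ i ∈ I, spin z i = -1 := by
  induction I using Finset.induction_on with
  | empty => simp
  | insert a I ha ih =>
    rw [Finset.prod_insert ha]
    rcases ih with h | h <;> rcases spin_eq z a with h' | h' <;> simp [h, h']

theorem abs_prod_spin (I : Finset (Fin n)) (z : Config n) : |∏ i ∈ I, spin z i| = 1 := by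
  rcases prod_spin_eq I z with h | h <;> simp [h]

theorem prod_spin_flip_of_notMem {i : Fin n} {I : Finset (Fin n)} (h : i ∉ I) (z : Config n) :
    ∏ j ∈ I, spin (flip i z) j = ∏ j ∈ I, spin z j :=
  Finset.prod_congr rfl fun j hj => spin_flip_of_ne (by rintro rfl; exact h hj) z

theorem prod_spin_flip_of_mem {i : Fin n} {I : Finset (Fin n)} (h : i ∈ I) (z : Config n) :
    ∏ j ∈ I, spin (flip i z) j = -∏ j ∈ I, spin z j := by
  rw [← Finset.mul_prod_erase I _ h, ← Finset.mul_prod_erase I (spin z) h, spin_flip_self,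
    prod_spin_flip_of_notMem (Finset.notMem_erase i I)]
  ring

theorem MultilinearPoly.abs_eval_le (p : MultilinearPoly n) (z : Config n) :
    |p.eval z| ≤ p.norm1 := by
  refine (Finset.abs_sum_le_sum_abs _ _).trans (Finset.sum_le_sum fun I _ => ?_)
  rw [abs_mul, abs_prod_spin, mul_one]

theorem partialDeriv_eval_flip (u : Fin n) (p : MultilinearPoly n) (z : Config n) :
    (p.partialDeriv u).eval (flip u z) = (p.partialDeriv u).eval z := by
  refine Finset.sum_congr rfl fun J _ => ?_
  unfold MultilinearPoly.partialDeriv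
  split_ifs with h
  · simp
  · rw [prod_spin_flip_of_notMem h]

/-- The index sets split into pairs `J`, `J ∪ {u}` with `u ∉ J`. Monomials without `u` cancel and
those with `u` change sign. -/
theorem eval_sub_eval_flip (u : Fin n) (p : MultilinearPoly n) (z : Config n) :
    p.eval z - p.eval (flip u z) = 2 * spin z u * (p.partialDeriv u).eval z := by
  have hu : u ∉ Finset.univ.erase u := Finset.notMem_erase _ _
  have h1 : (Finset.univ : Finset (Finset (Fin n))) =
      (insert u (Finset.univ.erase u)).powerset := by
    rw [Finset.insert_erase (Finset.mem_univ u), Finset.powerset_univ]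
  have h2 : ∀ J ∈ (Finset.univ.erase u).powerset, u ∉ J := fun J hJ hmem =>
    hu (Finset.mem_powerset.1 hJ hmem)
  unfold MultilinearPoly.eval
  rw [← Finset.sum_sub_distrib, h1, Finset.sum_powerset_insert hu, Finset.sum_powerset_insert hu]
  have h3 : ∑ J ∈ (Finset.univ.erase u).powerset, (p J * ∏ i ∈ J, spin z i -
      p J * ∏ i ∈ J, spin (flip u z) i) = 0 :=
    Finset.sum_eq_zero fun J hJ => by rw [prod_spin_flip_of_notMem (h2 J hJ), sub_self]
  have h4 : ∑ J ∈ (Finset.univ.erase u).powerset, (p.partialDeriv u) (insert u J) *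
      ∏ i ∈ insert u J, spin z i = 0 :=
    Finset.sum_eq_zero fun J _ => by simp [MultilinearPoly.partialDeriv]
  rw [h3, h4, zero_add, add_zero, Finset.mul_sum]
  refine Finset.sum_congr rfl fun J hJ => ?_
  rw [prod_spin_flip_of_mem (Finset.mem_insert_self u J), Finset.prod_insert (h2 J hJ),
    MultilinearPoly.partialDeriv, if_neg (h2 J hJ)]
  ring

/-- The probability of a configuration. -/
noncomputable def gibbsWeight (p : MultilinearPoly n) (z : Config n) : ℝ :=
  Real.exp (p.eval z) / ∑ z', Real.exp (p.eval z')

theorem sum_exp_eval_pos (p : MultilinearPoly n) : 0 < ∑ z : Config n, Real.exp (p.eval z) :=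
  Finset.sum_pos (fun _ _ => Real.exp_pos _) Finset.univ_nonempty

theorem gibbsWeight_nonneg (p : MultilinearPoly n) (z : Config n) : 0 ≤ gibbsWeight p z :=
  div_nonneg (Real.exp_pos _).le (sum_exp_eval_pos p).le

theorem sum_gibbsWeight (p : MultilinearPoly n) : ∑ z, gibbsWeight p z = 1 := by
  simp only [gibbsWeight]
  rw [← Finset.sum_div, div_self (sum_exp_eval_pos p).ne']

theorem gibbsWeight_flip (u : Fin n) (p : MultilinearPoly n) (z : Config n) :
    gibbsWeight p (flip u z) =
      gibbsWeight p z * Real.exp (-(2 * spin z u * (p.partialDeriv u).eval z)) := by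
  rw [← eval_sub_eval_flip, gibbsWeight, gibbsWeight, div_mul_eq_mul_div, ← Real.exp_add]
  congr 2
  ring

/-- A flip changes the exponent by at most `2 |∂_u p| ≤ 2 * lam`. This bounded change of measure
replaces any independence between the coordinates. -/
theorem gibbsWeight_flip_le {u : Fin n} {p : MultilinearPoly n} {lam : ℝ}
    (h : (p.partialDeriv u).norm1 ≤ lam) (z : Config n) :
    gibbsWeight p (flip u z) ≤ Real.exp (2 * lam) * gibbsWeight p z := by
  rw [gibbsWeight_flip, mul_comm]
  refine mul_le_mul_of_nonneg_right (Real.exp_le_exp.2 ?_) (gibbsWeight_nonneg p z)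
  have h1 := abs_le.1 (((p.partialDeriv u).abs_eval_le z).trans h)
  rcases spin_eq z u with h2 | h2 <;> rw [h2] <;> linarith [h1.1, h1.2]

/-- The conditional distribution of a vertex given the others is logistic. -/
theorem sum_gibbsWeight_label (u : Fin n) (p : MultilinearPoly n) (H : Config n → ℝ)
    (hH : ∀ z, H (flip u z) = H z) :
    ∑ z, gibbsWeight p z * (((1 - spin z u) / 2 -
      Real.sigmoid (-2 * (p.partialDeriv u).eval z)) * H z) = 0 := by
  set f : Config n → ℝ := fun z => gibbsWeight p z * (((1 - spin z u) / 2 -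
      Real.sigmoid (-2 * (p.partialDeriv u).eval z)) * H z) with hf
  -- The two configurations that differ only at `u` cancel each other. This is the conditional
  -- expectation given the other spins, without dividing by its normalization.
  have h1 : ∀ z, f z + f (flip u z) = 0 := by
    intro z
    simp only [hf, gibbsWeight_flip, hH, spin_flip_self, partialDeriv_eval_flip]
    set P := (p.partialDeriv u).eval z
    have h2 := Real.sigmoid_mul_rexp_neg (2 * P)
    have h3 := Real.sigmoid_mul_rexp_neg (-(2 * P))
    have h4 := Real.sigmoid_neg (2 * P)
    rw [neg_neg] at h3
    have h5 : -2 * P = -(2 * P) := by ring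
    rw [h5]
    rcases spin_eq z u with h | h <;> rw [h]
    · rw [show -(2 * 1 * P) = -(2 * P) by ring]
      have : (1 - -(1:ℝ)) / 2 - Real.sigmoid (-(2 * P)) = Real.sigmoid (2 * P) := by
        rw [h4]; ring
      rw [this]
      linear_combination gibbsWeight p z * H z * h2
    · rw [show -(2 * -1 * P) = 2 * P by ring]
      have : (1 - -(1:ℝ)) / 2 - Real.sigmoid (-(2 * P)) = Real.sigmoid (2 * P) := by
        rw [h4]; ring
      rw [this]
      linear_combination -(gibbsWeight p z * H z * h3)
  have h2 : ∑ z, (f z + f (flip u z)) = 0 := Finset.sum_eq_zero fun z _ => h1 z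
  rw [Finset.sum_add_distrib, sum_flip] at h2
  linarith

/-- The monomials of `f` that contain `I`. -/
def aboveMonomials (I : Finset (Fin n)) (f : MultilinearPoly n) : MultilinearPoly n :=
  fun K => if I ⊆ K then f K else 0

/-- A discrete derivative in direction `i`: monomials containing `i` change sign under the flip and
survive, the others cancel. -/
theorem aboveMonomials_insert_eval (i : Fin n) (I : Finset (Fin n)) (f : MultilinearPoly n)
    (z : Config n) : (aboveMonomials (insert i I) f).eval z =
      ((aboveMonomials I f).eval z - (aboveMonomials I f).eval (flip i z)) / 2 := by
  unfold MultilinearPoly.eval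
  rw [← Finset.sum_sub_distrib, Finset.sum_div]
  refine Finset.sum_congr rfl fun K _ => ?_
  by_cases hi : i ∈ K
  · rw [prod_spin_flip_of_mem hi]
    have : aboveMonomials (insert i I) f K = aboveMonomials I f K := by
      simp [aboveMonomials, Finset.insert_subset_iff, hi]
    rw [this]; ring
  · rw [prod_spin_flip_of_notMem hi]
    have : aboveMonomials (insert i I) f K = 0 := by
      simp [aboveMonomials, Finset.insert_subset_iff, hi]
    rw [this]; ring

/-- Each derivative costs one factor `e^{2 lam}`: since `((a - b)/2)² ≤ (a² + b²)/2`, the second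
moment is at most the mean of the moments of `g` and of its flip. The latter costs one change of
measure. -/
theorem sum_aboveMonomials_le {p : MultilinearPoly n} {lam : ℝ} (hlam : 0 ≤ lam)
    (h : ∀ i, (p.partialDeriv i).norm1 ≤ lam) (f : MultilinearPoly n) (I : Finset (Fin n)) :
    ∑ z, gibbsWeight p z * (aboveMonomials I f).eval z ^ 2 ≤
      Real.exp (2 * lam) ^ I.card * ∑ z, gibbsWeight p z * f.eval z ^ 2 := by
  induction I using Finset.induction_on with
  | empty =>
    have : aboveMonomials ∅ f = f := by funext K; simp [aboveMonomials]
    simp [this]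
  | insert i I hi ih =>
    rw [Finset.card_insert_of_notMem hi, pow_succ', mul_assoc]
    refine le_trans ?_ (mul_le_mul_of_nonneg_left ih (Real.exp_pos _).le)
    set g := aboveMonomials I f
    have h1 : ∑ z, gibbsWeight p z * g.eval (flip i z) ^ 2 ≤
        Real.exp (2 * lam) * ∑ z, gibbsWeight p z * g.eval z ^ 2 := by
      rw [← sum_flip i, Finset.mul_sum]
      refine Finset.sum_le_sum fun z _ => ?_
      rw [flip_flip, ← mul_assoc]
      exact mul_le_mul_of_nonneg_right (gibbsWeight_flip_le (h i) z) (sq_nonneg _)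
    have h2 : ∑ z, gibbsWeight p z * (aboveMonomials (insert i I) f).eval z ^ 2 ≤
        (∑ z, gibbsWeight p z * g.eval z ^ 2 +
          ∑ z, gibbsWeight p z * g.eval (flip i z) ^ 2) / 2 := by
      rw [← Finset.sum_add_distrib, Finset.sum_div]
      refine Finset.sum_le_sum fun z _ => ?_
      rw [aboveMonomials_insert_eval]
      have := mul_nonneg (gibbsWeight_nonneg p z) (sq_nonneg (g.eval z + g.eval (flip i z)))
      nlinarith
    have h3 : 1 ≤ Real.exp (2 * lam) := Real.one_le_exp (by linarith)
    have h4 : 0 ≤ ∑ z, gibbsWeight p z * g.eval z ^ 2 :=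
      Finset.sum_nonneg fun z _ => mul_nonneg (gibbsWeight_nonneg p z) (sq_nonneg _)
    nlinarith

/-- The coefficient of a maximal monomial is controlled by the second moment. -/
theorem sq_coeff_le {p : MultilinearPoly n} {lam : ℝ} (hlam : 0 ≤ lam)
    (h : ∀ i, (p.partialDeriv i).norm1 ≤ lam) (f : MultilinearPoly n) (I : Finset (Fin n))
    (hI : ∀ K, I ⊂ K → f K = 0) :
    f I ^ 2 ≤ Real.exp (2 * lam) ^ I.card * ∑ z, gibbsWeight p z * f.eval z ^ 2 := by
  refine le_trans (le_of_eq ?_) (sum_aboveMonomials_le hlam h f I)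
  have h1 : ∀ z, (aboveMonomials I f).eval z = f I * ∏ i ∈ I, spin z i := by
    intro z
    unfold MultilinearPoly.eval
    rw [Finset.sum_eq_single I]
    · simp [aboveMonomials]
    · intro K _ hK
      unfold aboveMonomials
      split_ifs with hs
      · rw [hI K (Finset.ssubset_iff_subset_ne.2 ⟨hs, hK.symm⟩), zero_mul]
      · rw [zero_mul]
    · simp
  have h2 : ∀ z : Config n, (f I * ∏ i ∈ I, spin z i) ^ 2 = f I ^ 2 := by
    intro z
    rcases prod_spin_eq I z with h | h <;> simp [h]
  simp only [h1, h2]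
  rw [← Finset.sum_mul, sum_gibbsWeight, one_mul]

end Gibbs

/-! ### The regression problems of the algorithm -/

section Regression

variable {n : ℕ}

/-- Indices of the coordinates of the examples made from `k` features. -/
abbrev CoordIndex (k : ℕ) : Type := Fin k ⊕ (Fin k ⊕ Unit)

/-- The coordinates in the order of the algorithm. -/
def coordList (k : ℕ) : List (CoordIndex k) :=
  (List.finRange k).map Sum.inl ++
    ((List.finRange k).map (fun j => Sum.inr (Sum.inl j)) ++ [Sum.inr (Sum.inr ())])

theorem sum_map_finRange {k : ℕ} (g : Fin k → ℝ) : ((List.finRange k).map g).sum = ∑ j, g j := by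
  rw [← List.ofFn_eq_map, List.sum_ofFn]

theorem sum_map_coordList (k : ℕ) (g : CoordIndex k → ℝ) :
    ((coordList k).map g).sum = ∑ i, g i := by
  simp [coordList, Function.comp_def, sum_map_finRange]

/-- The feature vector `((Z_I), (-Z_I), 0)` of a sample. -/
noncomputable def featureVec (F : List (List (Fin n))) (z : Config n) :
    CoordIndex F.length → ℝ :=
  Sum.elim (fun j => (monomialT z (F.get j)).val)
    (Sum.elim (fun j => -(monomialT z (F.get j)).val) fun _ => 0)

/-- The label of a sample at the vertex `u`. -/
noncomputable def label (u : Fin n) (z : Config n) : ℝ := (1 - spin z u) / 2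

theorem map_get_finRange {α β : Type} (l : List α) (f : α → β) :
    (List.finRange l.length).map (fun j => f (l.get j)) = l.map f := by
  conv_rhs => rw [← List.map_get_finRange l, List.map_map]
  rfl

theorem exampleT_val (u : Fin n) (F : List (List (Fin n))) (z : Config n) :
    (exampleT u F z).val = ((coordList F.length).map (featureVec F z), label u z) := by
  simp only [exampleT, Timed.bind_val, mapT_val, op_val, appendT_val, List.map_map, coordList,
    List.map_append, label, featureVec, Function.comp_def, Sum.elim_inl, Sum.elim_inr,
    List.map_cons, List.map_nil]
  rw [← map_get_finRange F (fun I => (monomialT z I).val),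
    ← map_get_finRange F (fun I => -(monomialT z I).val)]

theorem monomialT_val {I : List (Fin n)} (hI : I.Nodup) (z : Config n) :
    (monomialT z I).val = ∏ i ∈ I.toFinset, spin z i := by
  rw [List.prod_toFinset _ hI, List.prod_eq_foldl, List.foldl_map]
  simp [monomialT]

/-- The pairs of features and coefficients that belong to an output `v` of the Sparsitron. -/
noncomputable def coeffList (F : List (List (Fin n))) (v : CoordIndex F.length → ℝ) :
    List (List (Fin n) × ℝ) :=
  (List.finRange F.length).map fun j => (F.get j, v (Sum.inl j) - v (Sum.inr (Sum.inl j)))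

theorem card_coordIndex (k : ℕ) : Fintype.card (CoordIndex k) = 2 * k + 1 := by
  simp; ring

theorem regressT_val (rule : OutputRule) (lam : ℝ) (u : Fin n) (F : List (List (Fin n)))
    (train valid : List (Config n)) :
    (regressT rule lam u F train valid).val =
      List.zipWith (fun I c => (I, c)) F (List.zipWith (fun a b => a - b)
        ((sparsitronT rule (Fintype.card (CoordIndex F.length)) (2 * lam)
          (train.map fun z => ((coordList F.length).map (featureVec F z), label u z))
          (valid.map fun z => ((coordList F.length).map (featureVec F z), label u z))).val.take
          F.length)
        (((sparsitronT rule (Fintype.card (CoordIndex F.length)) (2 * lam)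
          (train.map fun z => ((coordList F.length).map (featureVec F z), label u z))
          (valid.map fun z => ((coordList F.length).map (featureVec F z), label u z))).val.drop
          F.length).take F.length)) := by
  simp only [regressT, Timed.bind_val, mapT_val, op_val, lengthT_val, splitT_val, zipWithT_val,
    exampleT_val, card_coordIndex]

theorem regressT_val_of_nil {rule : OutputRule} {lam : ℝ} {u : Fin n} {F : List (List (Fin n))}
    {train valid : List (Config n)}
    (h : (sparsitronT rule (Fintype.card (CoordIndex F.length)) (2 * lam)
      (train.map fun z => ((coordList F.length).map (featureVec F z), label u z))
      (valid.map fun z => ((coordList F.length).map (featureVec F z), label u z))).val = []) :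
    (regressT rule lam u F train valid).val = [] := by
  rw [regressT_val, h]; simp

theorem regressT_val_of_eq {rule : OutputRule} {lam : ℝ} {u : Fin n} {F : List (List (Fin n))}
    {train valid : List (Config n)} {v : CoordIndex F.length → ℝ}
    (h : (sparsitronT rule (Fintype.card (CoordIndex F.length)) (2 * lam)
      (train.map fun z => ((coordList F.length).map (featureVec F z), label u z))
      (valid.map fun z => ((coordList F.length).map (featureVec F z), label u z))).val =
      (coordList F.length).map v) :
    (regressT rule lam u F train valid).val = coeffList F v := by
  rw [regressT_val, h, coordList, List.map_append, List.map_append, List.map_map, List.map_map,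
    List.take_left' (by simp), List.drop_left' (by simp), List.take_left' (by simp),
    zipWith_map_map]
  conv_lhs => enter [2]; rw [← List.map_get_finRange F]
  rw [zipWith_map_map]
  rfl

/-- The absolute values of the regression coefficients have sum at most `2 * lam`. -/
theorem sum_abs_regressT_le (rule : OutputRule) {lam : ℝ} (hlam : 0 ≤ lam) (u : Fin n)
    (F : List (List (Fin n))) (train valid : List (Config n)) :
    ((regressT rule lam u F train valid).val.map fun Ic => |Ic.2|).sum ≤ 2 * lam := by
  rcases exists_sparsitronT_val (sum_map_coordList F.length) rule (featureVec F) (label u)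
    (show 0 ≤ 2 * lam by linarith) train valid with h | ⟨v, hv, h⟩
  · rw [regressT_val_of_nil h]; simpa
  · rw [regressT_val_of_eq h, coeffList, List.map_map, Function.comp_def, sum_map_finRange]
    refine le_trans (Finset.sum_le_sum fun j _ => abs_sub _ _) ?_
    rw [Fintype.sum_sum_type, Fintype.sum_sum_type] at hv
    rw [Finset.sum_add_distrib]
    have : 0 ≤ ∑ i : Unit, |v (Sum.inr (Sum.inr i))| := Finset.sum_nonneg fun _ _ => abs_nonneg _
    linarith

/-- The empty alternative accounts for a Sparsitron that returned the empty list; in all other cases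
each feature occurs with exactly its position in `F`. -/
theorem map_fst_regressT_sublist (rule : OutputRule) (lam : ℝ) (hlam : 0 ≤ lam) (u : Fin n)
    (F : List (List (Fin n))) (train valid : List (Config n)) :
    (regressT rule lam u F train valid).val = [] ∨
      (regressT rule lam u F train valid).val.map Prod.fst = F := by
  rcases exists_sparsitronT_val (sum_map_coordList F.length) rule (featureVec F) (label u)
    (show 0 ≤ 2 * lam by linarith) train valid with h | ⟨v, hv, h⟩
  · left; exact regressT_val_of_nil h
  · right
    rw [regressT_val_of_eq h, coeffList, List.map_map, Function.comp_def, List.map_get_finRange]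

/-- The multilinear polynomial with the coefficients of `v`. -/
noncomputable def coeffPoly (F : List (List (Fin n))) (v : CoordIndex F.length → ℝ) :
    MultilinearPoly n :=
  fun I => ∑ j : Fin F.length,
    if (F.get j).toFinset = I then v (Sum.inl j) - v (Sum.inr (Sum.inl j)) else 0

theorem coeffPoly_eval {F : List (List (Fin n))} (hF : ∀ I ∈ F, I.Nodup)
    (v : CoordIndex F.length → ℝ) (z : Config n) :
    (coeffPoly F v).eval z = dot v (featureVec F z) := by
  unfold MultilinearPoly.eval coeffPoly dot
  simp only [Finset.sum_mul]
  rw [Finset.sum_comm, Fintype.sum_sum_type, Fintype.sum_sum_type]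
  simp only [featureVec, Sum.elim_inl, Sum.elim_inr, mul_zero, Finset.sum_const_zero, add_zero]
  rw [← Finset.sum_add_distrib]
  refine Finset.sum_congr rfl fun j _ => ?_
  rw [Finset.sum_eq_single (F.get j).toFinset]
  · rw [if_pos rfl, monomialT_val (hF _ (List.get_mem F j))]; ring
  · intro I _ hI; rw [if_neg (Ne.symm hI), zero_mul]
  · simp

theorem get_toFinset_inj {F : List (List (Fin n))} (hF : (F.map List.toFinset).Nodup)
    {i j : Fin F.length} (h : (F.get i).toFinset = (F.get j).toFinset) : i = j := by
  rw [List.Nodup, List.pairwise_map] at hF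
  by_contra hne
  rcases lt_or_gt_of_ne hne with hlt | hlt
  · exact (List.pairwise_iff_get.1 hF i j hlt) h
  · exact (List.pairwise_iff_get.1 hF j i hlt) h.symm

theorem coeffPoly_get {F : List (List (Fin n))} (hF : (F.map List.toFinset).Nodup)
    (v : CoordIndex F.length → ℝ) (j : Fin F.length) :
    coeffPoly F v (F.get j).toFinset = v (Sum.inl j) - v (Sum.inr (Sum.inl j)) := by
  unfold coeffPoly
  rw [Finset.sum_eq_single j]
  · rw [if_pos rfl]
  · intro i _ hi; rw [if_neg fun h => hi (get_toFinset_inj hF h)]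
  · simp

theorem coeffPoly_eq_zero {F : List (List (Fin n))} (v : CoordIndex F.length → ℝ)
    {I : Finset (Fin n)} (h : ∀ A ∈ F, A.toFinset ≠ I) : coeffPoly F v I = 0 :=
  Finset.sum_eq_zero fun j _ => if_neg (h _ (List.get_mem F j))

/-- The nonnegative vector of `1`-norm `lam` that represents the polynomial `q`. -/
noncomputable def comparator (F : List (List (Fin n))) (q : MultilinearPoly n) (lam : ℝ) :
    CoordIndex F.length → ℝ :=
  Sum.elim (fun j => max (q (F.get j).toFinset) 0)
    (Sum.elim (fun j => max (-q (F.get j).toFinset) 0)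
      fun _ => lam - ∑ j : Fin F.length, |q (F.get j).toFinset|)

theorem max_sub_max_neg (t : ℝ) : max t 0 - max (-t) 0 = t := by
  rcases le_total 0 t with h | h
  · rw [max_eq_left h, max_eq_right (by linarith)]; ring
  · rw [max_eq_right h, max_eq_left (by linarith)]; ring

theorem max_add_max_neg (t : ℝ) : max t 0 + max (-t) 0 = |t| := by
  rcases le_total 0 t with h | h
  · rw [max_eq_left h, max_eq_right (by linarith), abs_of_nonneg h]; ring
  · rw [max_eq_right h, max_eq_left (by linarith), abs_of_nonpos h]; ring

theorem coeffPoly_comparator {F : List (List (Fin n))} (hF : (F.map List.toFinset).Nodup)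
    {q : MultilinearPoly n} (hq : ∀ I, q I ≠ 0 → ∃ A ∈ F, A.toFinset = I) (lam : ℝ) :
    coeffPoly F (comparator F q lam) = q := by
  funext I
  by_cases h : ∃ A ∈ F, A.toFinset = I
  · obtain ⟨A, hA, rfl⟩ := h
    obtain ⟨j, rfl⟩ := List.mem_iff_get.1 hA
    rw [coeffPoly_get hF]
    exact max_sub_max_neg _
  · have h0 : q I = 0 := by
      by_contra hne; exact h (hq I hne)
    push Not at h
    rw [coeffPoly_eq_zero _ h, h0]

theorem sum_abs_get_le {F : List (List (Fin n))} (hF : (F.map List.toFinset).Nodup)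
    (q : MultilinearPoly n) : ∑ j : Fin F.length, |q (F.get j).toFinset| ≤ q.norm1 := by
  unfold MultilinearPoly.norm1
  rw [← Finset.sum_image (f := fun I => |q I|) (g := fun j : Fin F.length => (F.get j).toFinset)
    (fun i _ j _ h => get_toFinset_inj hF h)]
  exact Finset.sum_le_univ_sum_of_nonneg fun _ => abs_nonneg _

/-- The regression problem of the algorithm at the vertex `u` is a logistic model. -/
theorem isLogisticModel_gibbs {p : MultilinearPoly n} {u : Fin n} {lam : ℝ}
    (hlam : (p.partialDeriv u).norm1 ≤ lam) {F : List (List (Fin n))} (hF1 : ∀ I ∈ F, I.Nodup)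
    (hF2 : (F.map List.toFinset).Nodup) (hF3 : ∀ I ∈ F, u ∉ I)
    (hF4 : ∀ I, p.partialDeriv u I ≠ 0 → ∃ A ∈ F, A.toFinset = I) :
    IsLogisticModel (gibbsWeight p) (featureVec F) (label u) (2 * lam)
      (comparator F (fun I => -2 * p.partialDeriv u I) (2 * lam)) := by
  set q : MultilinearPoly n := fun I => -2 * p.partialDeriv u I with hq
  have hq1 : ∀ I, q I ≠ 0 → ∃ A ∈ F, A.toFinset = I := fun I h =>
    hF4 I (by rintro h0; apply h; simp [hq, h0])
  have hq2 : ∀ z, q.eval z = -2 * (p.partialDeriv u).eval z := by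
    intro z
    unfold MultilinearPoly.eval
    rw [Finset.mul_sum]
    exact Finset.sum_congr rfl fun I _ => by simp only [hq]; ring
  have hq3 : q.norm1 ≤ 2 * lam := by
    have : q.norm1 = 2 * (p.partialDeriv u).norm1 := by
      unfold MultilinearPoly.norm1
      rw [Finset.mul_sum]
      exact Finset.sum_congr rfl fun I _ => by simp only [hq, abs_mul]; norm_num
    linarith
  have hq4 := sum_abs_get_le hF2 q
  refine ⟨gibbsWeight_nonneg p, sum_gibbsWeight p, ?_, ?_, ?_, ?_, ?_, ?_⟩
  · rintro z (j | j | j)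
    · simp only [featureVec, Sum.elim_inl]
      rw [monomialT_val (hF1 _ (List.get_mem F j)), abs_prod_spin]
    · simp only [featureVec, Sum.elim_inl, Sum.elim_inr]
      rw [abs_neg, monomialT_val (hF1 _ (List.get_mem F j)), abs_prod_spin]
    · simp [featureVec]
  · intro z
    rcases spin_eq z u with h | h <;> rw [label, h] <;> norm_num
  · intro z
    rcases spin_eq z u with h | h <;> rw [label, h] <;> norm_num
  · rintro (j | j | j)
    · exact le_max_right _ _
    · exact le_max_right _ _
    -- The coordinate with feature 0 absorbs the slack in the 1-norm. It is nonnegative because the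
    -- 1-norm of `q` is at most `2 * lam`.
    · simp only [comparator, Sum.elim_inr]; linarith
  · rw [Fintype.sum_sum_type, Fintype.sum_sum_type]
    simp only [comparator, Sum.elim_inl, Sum.elim_inr, Finset.univ_unique, Finset.sum_singleton]
    rw [← add_assoc, ← Finset.sum_add_distrib]
    simp only [max_add_max_neg]
    ring
  · intro H
    -- No feature contains `u`, so functions of the feature vector are invariant under the flip at
    -- `u`.
    have h1 := sum_gibbsWeight_label u p (fun z => H (featureVec F z)) (fun z => by
      congr 1
      have h2 : ∀ j : Fin F.length,
          (monomialT (flip u z) (F.get j)).val = (monomialT z (F.get j)).val := by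
        intro j
        rw [monomialT_val (hF1 _ (List.get_mem F j)), monomialT_val (hF1 _ (List.get_mem F j)),
          prod_spin_flip_of_notMem]
        rw [List.mem_toFinset]
        exact hF3 _ (List.get_mem F j)
      simp only [featureVec, h2])
    rw [← h1]
    refine Finset.sum_congr rfl fun z _ => ?_
    rw [← coeffPoly_eval hF1, coeffPoly_comparator hF2 hq1, hq2, label]

/-- If the Sparsitron succeeds, then the coefficients of maximal features are almost correct. -/
theorem abs_coeff_sub_lt {p : MultilinearPoly n} {u : Fin n} {lam η D : ℝ} (hlam0 : 0 ≤ lam)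
    (hlam : ∀ i, (p.partialDeriv i).norm1 ≤ lam) {F : List (List (Fin n))}
    (hF1 : ∀ I ∈ F, I.Nodup) (hF2 : (F.map List.toFinset).Nodup)
    (hF4 : ∀ I, p.partialDeriv u I ≠ 0 → ∃ A ∈ F, A.toFinset = I)
    (v : CoordIndex F.length → ℝ)
    (hv : sqDist (gibbsWeight p) (featureVec F)
      (comparator F (fun I => -2 * p.partialDeriv u I) (2 * lam)) v ≤ D) (j : Fin F.length)
    (hη : 0 < η) (hD : Real.exp (2 * lam) ^ (F.get j).length * D < η ^ 2)
    (hj : ∀ A ∈ F, ¬ (F.get j).toFinset ⊂ A.toFinset) :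
    |v (Sum.inl j) - v (Sum.inr (Sum.inl j)) + 2 * p.partialDeriv u (F.get j).toFinset| < η := by
  set q : MultilinearPoly n := fun I => -2 * p.partialDeriv u I with hq
  have hq1 : ∀ I, q I ≠ 0 → ∃ A ∈ F, A.toFinset = I := fun I h =>
    hF4 I (by rintro h0; apply h; simp [hq, h0])
  -- The error polynomial: its second moment is the mean squared distance, and all its monomials are
  -- features, so it has none strictly above `I`.
  set f : MultilinearPoly n := fun I => coeffPoly F v I - q I with hf
  set I := (F.get j).toFinset with hI
  have h1 : ∀ K, I ⊂ K → f K = 0 := by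
    intro K hK
    have h2 : ∀ A ∈ F, A.toFinset ≠ K := by rintro A hA rfl; exact hj A hA hK
    have h3 : q K = 0 := by
      by_contra h0
      obtain ⟨A, hA, he⟩ := hq1 K h0
      exact h2 A hA he
    simp only [hf, coeffPoly_eq_zero v h2, h3, sub_zero]
  have h2 := sq_coeff_le hlam0 hlam f I h1
  have h3 : ∑ z, gibbsWeight p z * f.eval z ^ 2 =
      sqDist (gibbsWeight p) (featureVec F) (comparator F q (2 * lam)) v := by
    refine Finset.sum_congr rfl fun z _ => ?_
    rw [← coeffPoly_eval hF1, ← coeffPoly_eval hF1, coeffPoly_comparator hF2 hq1]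
    congr 2
    unfold MultilinearPoly.eval
    rw [← Finset.sum_sub_distrib]
    exact Finset.sum_congr rfl fun I _ => by simp only [hf]; ring
  rw [h3] at h2
  have h4 : I.card = (F.get j).length := List.toFinset_card_of_nodup (hF1 _ (List.get_mem F j))
  have h5 : f I = v (Sum.inl j) - v (Sum.inr (Sum.inl j)) + 2 * p.partialDeriv u I := by
    simp only [hf]
    rw [hI, coeffPoly_get hF2]
    simp only [hq]; ring
  rw [← h5]
  refine abs_lt_of_sq_lt_sq ?_ hη.le
  rw [h4] at h2
  exact (h2.trans (mul_le_mul_of_nonneg_left hv (by positivity))).trans_lt hD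

end Regression

end MRF

namespace MRF

/-! ### Correctness of the main loop -/

section Levels

variable {n : ℕ}

/-- The subsets of `[n] ∖ {u}` of size less than `r`. -/
def vertexSubsets (r : ℕ) (u : Fin n) : List (List (Fin n)) :=
  (subsetsT (r - 1) ((List.finRange n).filter fun v => decide (v ≠ u))).val

/-- The update of `(J, S)` with one feature and its coefficient. -/
noncomputable def updateT (η : ℝ) (l : ℕ) (J : List (List (Fin n)))
    (JS : List (List (Fin n)) × List (Fin n)) (Ic : List (Fin n) × ℝ) :
    Timed (List (List (Fin n)) × List (Fin n)) := do
  let k ← lengthT Ic.1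
  let level ← op (decide (k = l))
  if level then do
    let cov ← coveredT J Ic.1
    let large ← op (decide (η < |Ic.2|))
    if !cov && large then do
      let S' ← unionT Ic.1 JS.2
      op (Ic.1 :: JS.1, S')
    else op JS
  else op JS

/-- The test whether a subset is a feature at level `l`. -/
def isFeatureT (l : ℕ) (J : List (List (Fin n))) (I : List (Fin n)) : Timed Bool := do
  let k ← lengthT I
  let small ← op (decide (k ≤ l))
  if small then op true else coveredT J I

/-- The features at level `l`. -/
def features (r : ℕ) (u : Fin n) (l : ℕ) (J : List (List (Fin n))) : List (List (Fin n)) :=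
  (vertexSubsets r u).filter fun I => decide (I.length ≤ l ∨ ∃ A ∈ J, I ⊆ A)

theorem isFeatureT_val (l : ℕ) (J : List (List (Fin n))) (I : List (Fin n)) :
    (isFeatureT l J I).val = decide (I.length ≤ l ∨ ∃ A ∈ J, I ⊆ A) := by
  simp only [isFeatureT, Timed.bind_val, lengthT_val, op_val, Timed.ite_val, coveredT_val,
    decide_eq_true_eq]
  by_cases h : I.length ≤ l <;> simp [h]

/-- Gives names to the two local programs of a round, so that their values and their costs can be
analysed separately. -/
theorem levelsT_succ (rule : OutputRule) (r : ℕ) (lam η : ℝ) (u : Fin n)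
    (train valid : List (Config n)) (l : ℕ) (J : List (List (Fin n))) (S : List (Fin n)) :
    levelsT rule r lam η u train valid (l + 1) J S = (do
      let s ← lengthT S
      let continue? ← op (decide (s < n - 1))
      if continue? then do
        let V ← filterT (fun v => op (decide (v ≠ u))) (List.finRange n)
        let subsets ← subsetsT (r - 1) V
        let F ← filterT (isFeatureT (l + 1) J) subsets
        let q ← regressT rule lam u F train valid
        let JS ← foldT (updateT η (l + 1) J) (J, S) q
        levelsT rule r lam η u train valid l JS.1 JS.2
      else op S) := rfl

/-- The state of the main loop after level `l`. -/
noncomputable def nextState (rule : OutputRule) (r : ℕ) (lam η : ℝ) (u : Fin n)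
    (train valid : List (Config n)) (l : ℕ) (J : List (List (Fin n))) (S : List (Fin n)) :
    List (List (Fin n)) × List (Fin n) :=
  (regressT rule lam u (features r u l J) train valid).val.foldl
    (fun JS Ic => (updateT η l J JS Ic).val) (J, S)

theorem levelsT_val_succ (rule : OutputRule) (r : ℕ) (lam η : ℝ) (u : Fin n)
    (train valid : List (Config n)) (l : ℕ) (J : List (List (Fin n))) (S : List (Fin n)) :
    (levelsT rule r lam η u train valid (l + 1) J S).val =
      if S.length < n - 1 then
        (levelsT rule r lam η u train valid l
          (nextState rule r lam η u train valid (l + 1) J S).1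
          (nextState rule r lam η u train valid (l + 1) J S).2).val
      else S := by
  rw [levelsT_succ]
  simp only [Timed.bind_val, lengthT_val, op_val, Timed.ite_val, decide_eq_true_eq, filterT_val,
    isFeatureT_val, foldT_val]
  rfl

theorem nodup_of_mem_vertexSubsets {r : ℕ} {u : Fin n} {I : List (Fin n)}
    (h : I ∈ vertexSubsets r u) : I.Nodup :=
  ((mem_subsetsT_val _ _ _).1 h).1.nodup ((List.nodup_finRange n).filter _)

theorem notMem_of_mem_vertexSubsets {r : ℕ} {u : Fin n} {I : List (Fin n)}
    (h : I ∈ vertexSubsets r u) : u ∉ I := by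
  intro hu
  have := ((mem_subsetsT_val _ _ _).1 h).1.subset hu
  simp at this

theorem length_le_of_mem_vertexSubsets {r : ℕ} {u : Fin n} {I : List (Fin n)}
    (h : I ∈ vertexSubsets r u) : I.length ≤ r - 1 :=
  ((mem_subsetsT_val _ _ _).1 h).2

theorem exists_mem_vertexSubsets {r : ℕ} {u : Fin n} {B : Finset (Fin n)} (hu : u ∉ B)
    (hB : B.card ≤ r - 1) : ∃ I ∈ vertexSubsets r u, I.toFinset = B := by
  have h : (((List.finRange n).filter fun v => decide (v ≠ u)).filter
      fun v => decide (v ∈ B)).toFinset = B := by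
    ext v
    simp only [List.mem_toFinset, List.mem_filter, List.mem_finRange, true_and, decide_eq_true_eq]
    exact ⟨fun h => h.2, fun h => ⟨by rintro rfl; exact hu h, h⟩⟩
  refine ⟨_, (mem_subsetsT_val _ _ _).2 ⟨List.filter_sublist, ?_⟩, h⟩
  rw [← List.toFinset_card_of_nodup (((List.nodup_finRange n).filter _).filter _), h]
  exact hB

/-- Both lists are sublists of a strictly increasing list, hence sorted, and a sorted list without
repetitions is determined by its set of entries. -/
theorem eq_of_toFinset_eq_of_mem_vertexSubsets {r : ℕ} {u : Fin n} {I J : List (Fin n)}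
    (hI : I ∈ vertexSubsets r u) (hJ : J ∈ vertexSubsets r u) (h : I.toFinset = J.toFinset) :
    I = J := by
  have hs : ((List.finRange n).filter fun v => decide (v ≠ u)).Pairwise (· < ·) :=
    (List.pairwise_lt_finRange n).filter _
  have hI' := hs.sublist ((mem_subsetsT_val _ _ _).1 hI).1
  have hJ' := hs.sublist ((mem_subsetsT_val _ _ _).1 hJ).1
  have hp : I.Perm J := by
    rw [List.perm_ext_iff_of_nodup (nodup_of_mem_vertexSubsets hI) (nodup_of_mem_vertexSubsets hJ)]
    intro v
    rw [← List.mem_toFinset, h, List.mem_toFinset]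
  exact hp.eq_of_pairwise (fun a b _ _ h1 h2 => absurd h1 (lt_asymm h2)) hI' hJ'

theorem nodup_map_toFinset_filter {r : ℕ} {u : Fin n} (f : List (Fin n) → Bool) :
    (((vertexSubsets r u).filter f).map List.toFinset).Nodup := by
  refine List.Nodup.map_on ?_ ((nodup_subsetsT_val _ _ ((List.nodup_finRange n).filter _)).filter _)
  intro I hI J hJ h
  exact eq_of_toFinset_eq_of_mem_vertexSubsets (List.mem_of_mem_filter hI)
    (List.mem_of_mem_filter hJ) h

/-- The condition under which a feature is added to `J`. -/
def Selected (η : ℝ) (l : ℕ) (J : List (List (Fin n))) (Ic : List (Fin n) × ℝ) : Prop :=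
  Ic.1.length = l ∧ (¬ ∃ A ∈ J, Ic.1 ⊆ A) ∧ η < |Ic.2|

open Classical in
theorem updateT_val (η : ℝ) (l : ℕ) (J : List (List (Fin n)))
    (JS : List (List (Fin n)) × List (Fin n)) (Ic : List (Fin n) × ℝ) :
    (updateT η l J JS Ic).val =
      if Selected η l J Ic then (Ic.1 :: JS.1, (unionT Ic.1 JS.2).val) else JS := by
  simp only [updateT, Timed.bind_val, lengthT_val, op_val, Timed.ite_val, coveredT_val,
    decide_eq_true_eq, Bool.and_eq_true, Bool.not_eq_true', decide_eq_false_iff_not]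
  by_cases h1 : Ic.1.length = l
  · by_cases h2 : (¬ ∃ A ∈ J, Ic.1 ⊆ A) ∧ η < |Ic.2|
    · rw [if_pos h1, if_pos h2, if_pos ⟨h1, h2⟩]
    · rw [if_pos h1, if_neg h2, if_neg fun h => h2 h.2]
  · rw [if_neg h1, if_neg fun h => h1 h.1]

/-- Coverage is tested against the `J` from the beginning of the round, not against the growing
state. So the decisions about different features do not influence each other, and the fold simply
collects the selected ones. -/
theorem foldl_updateT (η : ℝ) (l : ℕ) (J : List (List (Fin n)))
    (q : List (List (Fin n) × ℝ)) (JS : List (List (Fin n)) × List (Fin n)) (hS : JS.2.Nodup) :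
    let R := q.foldl (fun JS Ic => (updateT η l J JS Ic).val) JS
    (∀ A, A ∈ R.1 ↔ A ∈ JS.1 ∨ ∃ Ic ∈ q, Selected η l J Ic ∧ Ic.1 = A) ∧
    (∀ v, v ∈ R.2 ↔ v ∈ JS.2 ∨ ∃ Ic ∈ q, Selected η l J Ic ∧ v ∈ Ic.1) ∧ R.2.Nodup := by
  induction q generalizing JS with
  | nil => simpa using hS
  | cons Ic q ih =>
    simp only [List.foldl_cons, updateT_val] at ih ⊢
    by_cases h : Selected η l J Ic
    · rw [if_pos h]
      obtain ⟨h1, h2, h3⟩ := ih (Ic.1 :: JS.1, (unionT Ic.1 JS.2).val) (nodup_unionT_val _ _ hS)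
      refine ⟨fun A => ?_, fun v => ?_, h3⟩
      · rw [h1, List.exists_mem_cons_iff, List.mem_cons]
        simp only [h, true_and, eq_comm (a := A)]
        tauto
      · rw [h2, List.exists_mem_cons_iff]
        simp only [h, true_and, mem_unionT_val]
        tauto
    · rw [if_neg h]
      obtain ⟨h1, h2, h3⟩ := ih JS hS
      refine ⟨fun A => ?_, fun v => ?_, h3⟩
      · rw [h1, List.exists_mem_cons_iff]; simp only [h, false_and, false_or]
      · rw [h2, List.exists_mem_cons_iff]; simp only [h, false_and, false_or]

theorem exists_maximalMonomial {P : MultilinearPoly n} {K : Finset (Fin n)} (hK : P K ≠ 0) :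
    ∃ B, K ⊆ B ∧ IsMaximalMonomial P B := by
  obtain ⟨B, hKB, hB⟩ := (Set.toFinite {K | P K ≠ 0}).exists_le_maximal hK
  refine ⟨B, hKB, hB.prop, fun I hI => ?_⟩
  by_contra h
  exact hI.2 (hB.le_of_ge h hI.1)

/-- The invariant of the main loop: `J` lists the maximal monomials of `P` of size more than `l`,
and `S` is their union. -/
structure Invariant (r : ℕ) (u : Fin n) (P : MultilinearPoly n) (l : ℕ)
    (J : List (List (Fin n))) (S : List (Fin n)) : Prop where
  mem_vertexSubsets : ∀ A ∈ J, A ∈ vertexSubsets r u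
  isMaximal : ∀ A ∈ J, IsMaximalMonomial P A.toFinset ∧ l < A.length
  exists_mem : ∀ B, IsMaximalMonomial P B → l < B.card → ∃ A ∈ J, A.toFinset = B
  mem_iff : ∀ v, v ∈ S ↔ ∃ A ∈ J, v ∈ A
  nodup : S.Nodup

open Classical in
/-- The features at level `l` when `J` is as in the invariant. -/
noncomputable def idealFeatures (r : ℕ) (u : Fin n) (P : MultilinearPoly n) (l : ℕ) :
    List (List (Fin n)) :=
  (vertexSubsets r u).filter fun I =>
    decide (I.length ≤ l ∨ ∃ B, IsMaximalMonomial P B ∧ l < B.card ∧ I.toFinset ⊆ B)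

theorem mem_idealFeatures {r : ℕ} {u : Fin n} {P : MultilinearPoly n} {l : ℕ}
    {I : List (Fin n)} : I ∈ idealFeatures r u P l ↔ I ∈ vertexSubsets r u ∧
      (I.length ≤ l ∨ ∃ B, IsMaximalMonomial P B ∧ l < B.card ∧ I.toFinset ⊆ B) := by
  simp [idealFeatures]

/-- As long as the invariant holds, the features are determined by `P` and `l`, although `J` was
computed from the samples. This makes the regressions deterministic problems to which the
probability bounds apply. -/
theorem Invariant.features_eq {r : ℕ} {u : Fin n} {P : MultilinearPoly n} {l : ℕ}
    {J : List (List (Fin n))} {S : List (Fin n)} (h : Invariant r u P l J S) :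
    features r u l J = idealFeatures r u P l := by
  refine List.filter_congr fun I hI => ?_
  rw [decide_eq_decide]
  refine or_congr Iff.rfl ⟨?_, ?_⟩
  · rintro ⟨A, hA, hIA⟩
    have h1 := h.isMaximal A hA
    refine ⟨A.toFinset, h1.1, ?_, fun w hw => List.mem_toFinset.2 (hIA (List.mem_toFinset.1 hw))⟩
    rw [List.toFinset_card_of_nodup (nodup_of_mem_vertexSubsets (h.mem_vertexSubsets A hA))]
    exact h1.2
  · rintro ⟨B, hB, hlB, hIB⟩
    obtain ⟨A, hA, rfl⟩ := h.exists_mem B hB hlB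
    exact ⟨A, hA, fun v hv => List.mem_toFinset.1 (hIB (List.mem_toFinset.2 hv))⟩

/-- The regression at level `l` with the ideal features decides correctly which maximal features
are monomials of `P`. -/
def RegressionCorrect (rule : OutputRule) (r : ℕ) (lam η : ℝ) (u : Fin n) (P : MultilinearPoly n)
    (l : ℕ) (train valid : List (Config n)) : Prop :=
  ∀ I ∈ idealFeatures r u P l,
    (∀ A ∈ idealFeatures r u P l, ¬ I.toFinset ⊂ A.toFinset) →
    (P I.toFinset ≠ 0 →
      ∃ c, (I, c) ∈ (regressT rule lam u (idealFeatures r u P l) train valid).val ∧ η < |c|) ∧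
    (P I.toFinset = 0 →
      ∀ c, (I, c) ∈ (regressT rule lam u (idealFeatures r u P l) train valid).val → |c| ≤ η)

/-- A strict superset of an uncovered set of size `l + 1` can be neither a small feature nor part of
a maximal monomial of size above `l + 1`, as such a monomial would cover the set. So the tested sets
are maximal among the features, and the correct decision `P I ≠ 0` says exactly that `I` is a
maximal monomial. -/
theorem Invariant.next {rule : OutputRule} {r : ℕ} {lam η : ℝ} (hlam : 0 ≤ lam) {u : Fin n}
    {P : MultilinearPoly n} (hP : ∀ B, P B ≠ 0 → u ∉ B ∧ B.card ≤ r - 1)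
    {train valid : List (Config n)} {l : ℕ} {J : List (List (Fin n))} {S : List (Fin n)}
    (h : Invariant r u P (l + 1) J S)
    (hgood : RegressionCorrect rule r lam η u P (l + 1) train valid) :
    Invariant r u P l (nextState rule r lam η u train valid (l + 1) J S).1
      (nextState rule r lam η u train valid (l + 1) J S).2 := by
  rw [nextState, h.features_eq]
  set q := (regressT rule lam u (idealFeatures r u P (l + 1)) train valid).val with hq
  obtain ⟨h1, h2, h3⟩ := foldl_updateT η (l + 1) J q (J, S) h.nodup
  set R := q.foldl (fun JS Ic => (updateT η (l + 1) J JS Ic).val) (J, S)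
  have hqF : ∀ Ic ∈ q, Ic.1 ∈ idealFeatures r u P (l + 1) := by
    intro Ic hIc
    rcases map_fst_regressT_sublist rule lam hlam u (idealFeatures r u P (l + 1)) train valid
      with h0 | h0
    · rw [hq, h0] at hIc; simp at hIc
    · rw [← h0]; exact List.mem_map_of_mem hIc
  -- uncovered features of size `l + 1` are maximal
  have hmax : ∀ I ∈ vertexSubsets r u, I.length = l + 1 → (¬ ∃ A ∈ J, I ⊆ A) →
      (∀ B, IsMaximalMonomial P B → ¬ I.toFinset ⊂ B) := by
    intro I hI hIl hcov B hB hIB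
    have hlt := Finset.card_lt_card hIB
    rw [List.toFinset_card_of_nodup (nodup_of_mem_vertexSubsets hI), hIl] at hlt
    obtain ⟨A, hA, rfl⟩ := h.exists_mem B hB hlt
    exact hcov ⟨A, hA, fun v hv => List.mem_toFinset.1 (hIB.1 (List.mem_toFinset.2 hv))⟩
  have hmaxF : ∀ I ∈ vertexSubsets r u, I.length = l + 1 → (¬ ∃ A ∈ J, I ⊆ A) →
      ∀ A ∈ idealFeatures r u P (l + 1), ¬ I.toFinset ⊂ A.toFinset := by
    intro I hI hIl hcov A hA hIA
    rw [mem_idealFeatures] at hA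
    have hlt := Finset.card_lt_card hIA
    rw [List.toFinset_card_of_nodup (nodup_of_mem_vertexSubsets hI),
      List.toFinset_card_of_nodup (nodup_of_mem_vertexSubsets hA.1), hIl] at hlt
    rcases hA.2 with h0 | ⟨B, hB, -, hAB⟩
    · omega
    · exact hmax I hI hIl hcov B hB (hIA.trans_subset hAB)
  have hsel : ∀ Ic ∈ q, Selected η (l + 1) J Ic →
      Ic.1 ∈ vertexSubsets r u ∧ IsMaximalMonomial P Ic.1.toFinset := by
    rintro ⟨I, c⟩ hIc ⟨hl, hcov, hlarge⟩
    have hIF := hqF _ hIc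
    have hIV := (mem_idealFeatures.1 hIF).1
    refine ⟨hIV, ?_, ?_⟩
    · intro h0
      exact absurd ((hgood I hIF (hmaxF I hIV hl hcov)).2 h0 c hIc) (not_le.2 hlarge)
    · intro K hK
      by_contra h0
      obtain ⟨B, hKB, hB⟩ := exists_maximalMonomial h0
      exact hmax I hIV hl hcov B hB (hK.trans_subset hKB)
  refine ⟨?_, ?_, ?_, ?_, h3⟩
  · intro A hA
    rcases (h1 A).1 hA with hA | ⟨Ic, hIc, hs, rfl⟩
    · exact h.mem_vertexSubsets A hA
    · exact (hsel Ic hIc hs).1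
  · intro A hA
    rcases (h1 A).1 hA with hA | ⟨Ic, hIc, hs, rfl⟩
    · have := h.isMaximal A hA
      exact ⟨this.1, by omega⟩
    · exact ⟨(hsel Ic hIc hs).2, by rw [hs.1]; omega⟩
  · intro B hB hlB
    by_cases hlt : l + 1 < B.card
    · obtain ⟨A, hA, hAB⟩ := h.exists_mem B hB hlt
      exact ⟨A, (h1 A).2 (Or.inl hA), hAB⟩
    · have hBl : B.card = l + 1 := by omega
      obtain ⟨I, hI, rfl⟩ := exists_mem_vertexSubsets (hP B hB.1).1 (hP B hB.1).2
      rw [List.toFinset_card_of_nodup (nodup_of_mem_vertexSubsets hI)] at hBl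
      -- A maximal monomial is not strictly contained in another monomial, and it cannot equal a
      -- member of `J` because those are larger than `l + 1`.
      have hcov : ¬ ∃ A ∈ J, I ⊆ A := by
        rintro ⟨A, hA, hIA⟩
        have h4 := h.isMaximal A hA
        refine h4.1.1 (hB.2 _ (Finset.ssubset_iff_subset_ne.2
          ⟨fun w hw => List.mem_toFinset.2 (hIA (List.mem_toFinset.1 hw)), fun he => ?_⟩))
        have h5 := congrArg Finset.card he
        rw [List.toFinset_card_of_nodup (nodup_of_mem_vertexSubsets hI),
          List.toFinset_card_of_nodup (nodup_of_mem_vertexSubsets (h.mem_vertexSubsets A hA))] at h5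
        omega
      have hIF : I ∈ idealFeatures r u P (l + 1) := mem_idealFeatures.2 ⟨hI, Or.inl hBl.le⟩
      obtain ⟨c, hc, hlarge⟩ := (hgood I hIF (hmaxF I hI hBl hcov)).1 hB.1
      exact ⟨I, (h1 I).2 (Or.inr ⟨(I, c), hc, ⟨hBl, hcov, hlarge⟩, rfl⟩), rfl⟩
  · intro v
    rw [h2, h.mem_iff]
    constructor
    · rintro (⟨A, hA, hv⟩ | ⟨Ic, hIc, hs, hv⟩)
      · exact ⟨A, (h1 A).2 (Or.inl hA), hv⟩
      · exact ⟨Ic.1, (h1 _).2 (Or.inr ⟨Ic, hIc, hs, rfl⟩), hv⟩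
    · rintro ⟨A, hA, hv⟩
      rcases (h1 A).1 hA with hA | ⟨Ic, hIc, hs, rfl⟩
      · exact Or.inl ⟨A, hA, hv⟩
      · exact Or.inr ⟨Ic, hIc, hs, hv⟩

/-- Two ways to stop. At level 0, `J` holds all nonempty maximal monomials, and every vertex of a
monomial lies in one of these. If the loop stops early, `S` already consists of all vertices other
than `u`, each of them found in a true monomial. -/
theorem Invariant.mem_levelsT_val {rule : OutputRule} {r : ℕ} {lam η : ℝ} (hlam : 0 ≤ lam)
    {u : Fin n} {P : MultilinearPoly n} (hP : ∀ B, P B ≠ 0 → u ∉ B ∧ B.card ≤ r - 1)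
    {train valid : List (Config n)} {l : ℕ} {J : List (List (Fin n))} {S : List (Fin n)}
    (h : Invariant r u P l J S)
    (hgood : ∀ k, 1 ≤ k → k ≤ l → RegressionCorrect rule r lam η u P k train valid) (v : Fin n) :
    v ∈ (levelsT rule r lam η u train valid l J S).val ↔ ∃ B, P B ≠ 0 ∧ v ∈ B := by
  induction l generalizing J S with
  | zero =>
    change v ∈ S ↔ _
    rw [h.mem_iff]
    constructor
    · rintro ⟨A, hA, hv⟩
      exact ⟨A.toFinset, (h.isMaximal A hA).1.1, List.mem_toFinset.2 hv⟩
    · rintro ⟨B, hB, hv⟩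
      obtain ⟨B', hBB', hB'⟩ := exists_maximalMonomial hB
      obtain ⟨A, hA, rfl⟩ := h.exists_mem B' hB' (Finset.card_pos.2 ⟨v, hBB' hv⟩)
      exact ⟨A, hA, List.mem_toFinset.1 (hBB' hv)⟩
  | succ l ih =>
    rw [levelsT_val_succ]
    split_ifs with hS
    · exact ih (h.next hlam hP (hgood (l + 1) (by omega) le_rfl))
        (fun k h1 h2 => hgood k h1 (by omega))
    · constructor
      · intro hv
        obtain ⟨A, hA, hv⟩ := (h.mem_iff v).1 hv
        exact ⟨A.toFinset, (h.isMaximal A hA).1.1, List.mem_toFinset.2 hv⟩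
      · rintro ⟨B, hB, hv⟩
        have hvu : v ≠ u := by rintro rfl; exact (hP B hB).1 hv
        have hsub : S.toFinset ⊆ Finset.univ.erase u := by
          intro w hw
          obtain ⟨A, hA, hwA⟩ := (h.mem_iff w).1 (List.mem_toFinset.1 hw)
          refine Finset.mem_erase.2 ⟨?_, Finset.mem_univ _⟩
          rintro rfl
          exact notMem_of_mem_vertexSubsets (h.mem_vertexSubsets A hA) hwA
        have heq := Finset.eq_of_subset_of_card_le hsub (by
          rw [Finset.card_erase_of_mem (Finset.mem_univ u), Finset.card_univ, Fintype.card_fin,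
            List.toFinset_card_of_nodup h.nodup]
          omega)
        rw [← List.mem_toFinset, heq]
        exact Finset.mem_erase.2 ⟨hvu, Finset.mem_univ _⟩

theorem invariant_nil {r : ℕ} {u : Fin n} {P : MultilinearPoly n}
    (hP : ∀ B, P B ≠ 0 → u ∉ B ∧ B.card ≤ r - 1) : Invariant r u P (r - 1) [] [] where
  mem_vertexSubsets := by simp
  isMaximal := by simp
  exists_mem B hB hlt := by have := (hP B hB.1).2; omega
  mem_iff := by simp
  nodup := List.nodup_nil

theorem partialDeriv_support {r : ℕ} {G : SimpleGraph (Fin n)} {p : MultilinearPoly n}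
    (h : IsRWise r G p) (u : Fin n) (B : Finset (Fin n)) (hB : p.partialDeriv u B ≠ 0) :
    u ∉ B ∧ B.card ≤ r - 1 := by
  unfold MultilinearPoly.partialDeriv at hB
  split_ifs at hB with hu
  · exact absurd rfl hB
  · refine ⟨hu, ?_⟩
    have := (h.support _ hB).2
    rw [Finset.card_insert_of_notMem hu] at this
    omega

/-- Identifiability places every edge in a monomial, and monomials are cliques. -/
theorem adj_iff_partialDeriv {r : ℕ} {η : ℝ} {G : SimpleGraph (Fin n)} {p : MultilinearPoly n}
    (h : IsRWise r G p) (h' : IsIdentifiable η G p) (u v : Fin n) :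
    G.Adj u v ↔ ∃ B, p.partialDeriv u B ≠ 0 ∧ v ∈ B := by
  constructor
  · intro huv
    obtain ⟨I, hI, hu, hv⟩ := h'.edge_covered u v huv
    refine ⟨I.erase u, ?_, Finset.mem_erase.2 ⟨huv.ne', hv⟩⟩
    rw [MultilinearPoly.partialDeriv, if_neg (Finset.notMem_erase u I), Finset.insert_erase hu]
    exact hI
  · rintro ⟨B, hB, hv⟩
    have hu := (partialDeriv_support h u B hB).1
    rw [MultilinearPoly.partialDeriv, if_neg hu] at hB
    exact (h.support _ hB).1 (Finset.mem_insert_self u B) (Finset.mem_insert_of_mem hv)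
      (by rintro rfl; exact hu hv)

/-- If all regressions are correct, then the algorithm returns the graph. -/
theorem describes_of_regressionCorrect {rule : OutputRule} {r T : ℕ} {lam η : ℝ}
    (hlam : 0 ≤ lam) {G : SimpleGraph (Fin n)} {p : MultilinearPoly n} (h : IsRWise r G p)
    (h' : IsIdentifiable η G p) (s : List (Config n))
    (hgood : ∀ u : Fin n, ∀ k, 1 ≤ k → k ≤ r - 1 →
      RegressionCorrect rule r lam η u (p.partialDeriv u) k (s.take T) (s.drop T)) :
    Describes (learnGraphT rule T r lam η s).val G := by
  intro u v
  rw [adj_iff_partialDeriv h h' u v, ← (invariant_nil (partialDeriv_support h u)).mem_levelsT_val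
    hlam (partialDeriv_support h u) (hgood u) v]
  simp only [learnGraphT, Timed.bind_val, splitT_val, mapT_val, op_val, List.mem_map,
    List.mem_finRange, true_and, Prod.mk.injEq, neighboursT]
  constructor
  · exact fun hv => ⟨_, ⟨u, rfl, rfl⟩, hv⟩
  · rintro ⟨S, ⟨w, rfl, rfl⟩, hv⟩
    exact hv

end Levels

end MRF

namespace MRF

/-! ### Probability of success -/

section Success

variable {n : ℕ}

/-- Removing `u` maps the strict supersets of `insert u B` to strict supersets of `B`. Thus the
lower bound `η` passes from `p` to the maximal monomials of its derivatives. -/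
theorem partialDeriv_isMaximal {p : MultilinearPoly n} {u : Fin n} {B : Finset (Fin n)}
    (hB : IsMaximalMonomial (p.partialDeriv u) B) : IsMaximalMonomial p (insert u B) := by
  have hne := hB.1
  unfold MultilinearPoly.partialDeriv at hne
  split_ifs at hne with hu
  · exact absurd rfl hne
  refine ⟨hne, fun K hK => ?_⟩
  have huK : u ∈ K := hK.1 (Finset.mem_insert_self u B)
  have h1 : B ⊂ K.erase u := by
    refine Finset.ssubset_iff_subset_ne.2 ⟨fun v hv => Finset.mem_erase.2
      ⟨by rintro rfl; exact hu hv, hK.1 (Finset.mem_insert_of_mem hv)⟩, ?_⟩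
    rintro rfl
    rw [Finset.insert_erase huK] at hK
    exact hK.2 (Finset.Subset.refl _)
  have h2 := hB.2 _ h1
  rwa [MultilinearPoly.partialDeriv, if_neg (Finset.notMem_erase u K), Finset.insert_erase huK]
    at h2

theorem le_abs_partialDeriv {η : ℝ} {G : SimpleGraph (Fin n)} {p : MultilinearPoly n}
    (h : IsIdentifiable η G p) {u : Fin n} {B : Finset (Fin n)}
    (hB : IsMaximalMonomial (p.partialDeriv u) B) : η ≤ |p.partialDeriv u B| := by
  have h1 := h.le_abs_coeff _ (partialDeriv_isMaximal hB)
  have hne := hB.1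
  unfold MultilinearPoly.partialDeriv at hne ⊢
  split_ifs at hne ⊢ with hu
  · exact absurd rfl hne
  · exact h1

/-- A monomial larger than `l` lies in a maximal one, which is then also larger than `l`. So no
monomial is missing from the features, and the regression is well specified. -/
theorem exists_mem_idealFeatures {r : ℕ} {u : Fin n} {P : MultilinearPoly n}
    (hP : ∀ B, P B ≠ 0 → u ∉ B ∧ B.card ≤ r - 1) (l : ℕ) (B : Finset (Fin n)) (hB : P B ≠ 0) :
    ∃ A ∈ idealFeatures r u P l, A.toFinset = B := by
  obtain ⟨I, hI, rfl⟩ := exists_mem_vertexSubsets (hP B hB).1 (hP B hB).2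
  refine ⟨I, mem_idealFeatures.2 ⟨hI, ?_⟩, rfl⟩
  by_cases hl : I.length ≤ l
  · exact Or.inl hl
  · right
    obtain ⟨B, hIB, hB⟩ := exists_maximalMonomial hB
    refine ⟨B, hB, ?_, hIB⟩
    have := Finset.card_le_card hIB
    rw [List.toFinset_card_of_nodup (nodup_of_mem_vertexSubsets hI)] at this
    omega

theorem mem_coeffList {F : List (List (Fin n))} {v : CoordIndex F.length → ℝ}
    {Ic : List (Fin n) × ℝ} : Ic ∈ coeffList F v ↔
      ∃ j, (F.get j, v (Sum.inl j) - v (Sum.inr (Sum.inl j))) = Ic := by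
  simp [coeffList]

/-- The coefficient found is within less than `η` of `-2 P(I)`. If `P(I) ≠ 0`, then `I` is a maximal
monomial and the target has absolute value at least `2η`, otherwise it is 0; the threshold `η` lies
in between. -/
theorem regressionCorrect_of_succeeds {rule : OutputRule} {r : ℕ} {lam η D : ℝ} (hlam0 : 0 ≤ lam)
    (hη : 0 < η) {G : SimpleGraph (Fin n)} {p : MultilinearPoly n} (h : IsRWise r G p)
    (h' : IsIdentifiable η G p) (hlam : ∀ i, (p.partialDeriv i).norm1 ≤ lam) {u : Fin n} {k : ℕ}
    {train valid : List (Config n)} (hD0 : 0 ≤ D)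
    (hD : Real.exp (2 * lam) ^ (r - 1) * D < η ^ 2)
    (hs : IsLogisticModel.Succeeds rule (coordList (idealFeatures r u (p.partialDeriv u) k).length)
      (gibbsWeight p) (featureVec (idealFeatures r u (p.partialDeriv u) k)) (label u) (2 * lam)
      (comparator (idealFeatures r u (p.partialDeriv u) k) (fun I => -2 * p.partialDeriv u I)
        (2 * lam)) D train valid) :
    RegressionCorrect rule r lam η u (p.partialDeriv u) k train valid := by
  set F := idealFeatures r u (p.partialDeriv u) k with hF
  have hF0 : ∀ I ∈ F, I ∈ vertexSubsets r u := fun I hI => (mem_idealFeatures.1 hI).1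
  have hF1 : ∀ I ∈ F, I.Nodup := fun I hI => nodup_of_mem_vertexSubsets (hF0 I hI)
  have hF2 : (F.map List.toFinset).Nodup := nodup_map_toFinset_filter _
  have hF4 := exists_mem_idealFeatures (partialDeriv_support h u) k
  obtain ⟨v, -, hv, hval⟩ := hs
  have hreg := regressT_val_of_eq hval
  intro I hI hmax
  obtain ⟨j, rfl⟩ := List.mem_iff_get.1 hI
  have hlen := length_le_of_mem_vertexSubsets (hF0 _ hI)
  have h1 := abs_coeff_sub_lt hlam0 hlam hF1 hF2 hF4 v hv j hη (by
    refine lt_of_le_of_lt ?_ hD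
    exact mul_le_mul_of_nonneg_right
      (pow_le_pow_right₀ (Real.one_le_exp (by linarith)) hlen) hD0) hmax
  constructor
  · intro hne
    refine ⟨v (Sum.inl j) - v (Sum.inr (Sum.inl j)), ?_, ?_⟩
    · rw [hreg]; exact mem_coeffList.2 ⟨j, rfl⟩
    · have h2 : IsMaximalMonomial (p.partialDeriv u) (F.get j).toFinset := by
        refine ⟨hne, fun K hK => ?_⟩
        by_contra h0
        obtain ⟨A, hA, rfl⟩ := hF4 K h0
        exact hmax A hA hK
      have h3 := le_abs_partialDeriv h' h2
      rw [abs_lt] at h1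
      rcases le_total 0 (p.partialDeriv u (F.get j).toFinset) with h4 | h4
      · rw [abs_of_nonneg h4] at h3
        rw [lt_abs]; right; linarith
      · rw [abs_of_nonpos h4] at h3
        rw [lt_abs]; left; linarith
  · intro h0 c hc
    rw [hreg, mem_coeffList] at hc
    obtain ⟨i, hi⟩ := hc
    have h2 := congrArg Prod.fst hi
    have h3 : v (Sum.inl i) - v (Sum.inr (Sum.inl i)) = c := congrArg Prod.snd hi
    have h4 : i = j := get_toFinset_inj hF2 (congrArg List.toFinset h2)
    subst h4
    rw [h0, mul_zero, add_zero] at h1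
    rw [← h3]
    exact h1.le

theorem learningRate_mono {d d' T : ℕ} (hd : 1 ≤ d) (h : d ≤ d') :
    learningRate d T ≤ learningRate d' T := by
  refine Real.sqrt_le_sqrt (div_le_div_of_nonneg_right ?_ (Nat.cast_nonneg _))
  exact Real.logb_le_logb_of_le (by norm_num) (by exact_mod_cast hd) (by exact_mod_cast h)

theorem numSubsets_le_pow (k m : ℕ) : numSubsets k m ≤ (m + 1) ^ k := by
  induction m generalizing k with
  | zero => cases k <;> simp [numSubsets]
  | succ m ih =>
    cases k with
    | zero => simp [numSubsets]
    | succ k =>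
      have h1 := ih k
      have h2 := ih (k + 1)
      have h3 : (m + 1) ^ k ≤ (m + 2) ^ k := Nat.pow_le_pow_left (by omega) k
      rw [pow_succ] at h2 ⊢
      simp only [numSubsets]
      calc _ ≤ (m + 1) ^ k + (m + 1) ^ k * (m + 1) := add_le_add h1 h2
        _ = (m + 1) ^ k * (m + 2) := by ring
        _ ≤ _ := Nat.mul_le_mul_right _ h3

theorem length_filter_ne (u : Fin n) :
    ((List.finRange n).filter fun v => decide (v ≠ u)).length = n - 1 := by
  rw [← List.toFinset_card_of_nodup ((List.nodup_finRange n).filter _)]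
  have : ((List.finRange n).filter fun v => decide (v ≠ u)).toFinset = Finset.univ.erase u := by
    ext v; simp
  rw [this, Finset.card_erase_of_mem (Finset.mem_univ u), Finset.card_univ, Fintype.card_fin]

theorem length_vertexSubsets (r : ℕ) (u : Fin n) :
    (vertexSubsets r u).length = numSubsets (r - 1) (n - 1) := by
  rw [vertexSubsets, length_subsetsT_val, length_filter_ne]

/-- The dimension depends on the level, but it is at most `2 n^{r-1} + 1`, and the learning rate
increases with the dimension. So the conditions need only be stated for this largest dimension. -/
theorem listProb_not_regressionCorrect_le {rule : OutputRule} {r : ℕ} {lam η : ℝ} (hlam0 : 0 < lam)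
    (hη : 0 < η) {G : SimpleGraph (Fin n)} {p : MultilinearPoly n} (h : IsRWise r G p)
    (h' : IsIdentifiable η G p) (hlam : ∀ i, (p.partialDeriv i).norm1 ≤ lam) (u : Fin n) {k : ℕ}
    {T M : ℕ} (hT : 0 < T) (hM : 0 < M) {θ : ℝ} (hθ : 0 < θ)
    (hr : learningRate (2 * n ^ (r - 1) + 1) T ≤ 1 / 2)
    (hrθ : 6 * (2 * lam) * learningRate (2 * n ^ (r - 1) + 1) T ≤ θ)
    (hD : Real.exp (2 * lam) ^ (r - 1) * (64 * Real.exp (2 * (2 * lam)) * θ) < η ^ 2) :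
    listProb (gibbsWeight p) (T + M) (fun s => ¬ RegressionCorrect rule r lam η u
      (p.partialDeriv u) k (s.take T) (s.drop T)) ≤
      Real.exp (-(T * θ ^ 2 / (32 * (2 * lam) ^ 2))) + T * (2 * Real.exp (-(M * θ ^ 2 / 2))) := by
  set F := idealFeatures r u (p.partialDeriv u) k with hF
  have hF0 : ∀ I ∈ F, I ∈ vertexSubsets r u := fun I hI => (mem_idealFeatures.1 hI).1
  have hF1 : ∀ I ∈ F, I.Nodup := fun I hI => nodup_of_mem_vertexSubsets (hF0 I hI)
  have hF2 : (F.map List.toFinset).Nodup := nodup_map_toFinset_filter _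
  have hF3 : ∀ I ∈ F, u ∉ I := fun I hI => notMem_of_mem_vertexSubsets (hF0 I hI)
  have hF4 := exists_mem_idealFeatures (partialDeriv_support h u) k
  have hmodel := isLogisticModel_gibbs (hlam u) hF1 hF2 hF3 hF4
  have hn : n - 1 + 1 = n := by have := u.pos; omega
  have hlen : F.length ≤ n ^ (r - 1) := by
    have h1 : F.length ≤ (vertexSubsets r u).length := List.length_filter_le _ _
    rw [length_vertexSubsets] at h1
    have h2 := numSubsets_le_pow (r - 1) (n - 1)
    rw [hn] at h2
    exact h1.trans h2
  -- The empty set is always a feature, so the dimension is at least 3.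
  have hpos : 1 ≤ F.length := by
    have h1 : [] ∈ F := mem_idealFeatures.2
      ⟨(mem_subsetsT_val _ _ _).2 ⟨List.nil_sublist _, by simp⟩, Or.inl (by simp)⟩
    exact List.length_pos_of_mem h1
  have hrate : learningRate (Fintype.card (CoordIndex F.length)) T ≤
      learningRate (2 * n ^ (r - 1) + 1) T := by
    rw [card_coordIndex]
    exact learningRate_mono (by omega) (by omega)
  have h1 := hmodel.listProb_not_succeeds_le (by linarith) (sum_map_coordList F.length) rule
    (by rw [card_coordIndex]; omega) hT hM hθ (hrate.trans hr)
    ((mul_le_mul_of_nonneg_left hrate (by linarith)).trans hrθ)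
  refine le_trans (listProb_mono (gibbsWeight_nonneg p) _ ?_) h1
  intro s _ hs hsucc
  exact hs (regressionCorrect_of_succeeds hlam0.le hη h h' hlam (by positivity) hD hsucc)

/-- Union bound over the `n (r - 1)` regressions with ideal features. On the remaining event the
whole run follows them. -/
theorem listProb_describes_ge {rule : OutputRule} {r : ℕ} {lam η ρ : ℝ} (hlam0 : 0 < lam)
    (hη : 0 < η) {G : SimpleGraph (Fin n)} {p : MultilinearPoly n} (h : IsRWise r G p)
    (h' : IsIdentifiable η G p) (hlam : ∀ i, (p.partialDeriv i).norm1 ≤ lam)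
    {T M : ℕ} (hT : 0 < T) (hM : 0 < M) {θ : ℝ} (hθ : 0 < θ)
    (hr : learningRate (2 * n ^ (r - 1) + 1) T ≤ 1 / 2)
    (hrθ : 6 * (2 * lam) * learningRate (2 * n ^ (r - 1) + 1) T ≤ θ)
    (hD : Real.exp (2 * lam) ^ (r - 1) * (64 * Real.exp (2 * (2 * lam)) * θ) < η ^ 2)
    (hρ : n * r * (Real.exp (-(T * θ ^ 2 / (32 * (2 * lam) ^ 2))) +
      T * (2 * Real.exp (-(M * θ ^ 2 / 2)))) ≤ ρ) :
    1 - ρ ≤ listProb (gibbsWeight p) (T + M)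
      (fun s => Describes (learnGraphT rule T r lam η s).val G) := by
  have h0 := gibbsWeight_nonneg p
  have h1 := sum_gibbsWeight p
  set δ := Real.exp (-(T * θ ^ 2 / (32 * (2 * lam) ^ 2))) +
      T * (2 * Real.exp (-(M * θ ^ 2 / 2))) with hδ
  have hδ0 : 0 ≤ δ := by positivity
  have hsum := listProb_exists_le h0 h1 (T + M)
    ((Finset.univ : Finset (Fin n)) ×ˢ Finset.Icc 1 (r - 1))
    (fun uk s => ¬ RegressionCorrect rule r lam η uk.1 (p.partialDeriv uk.1) uk.2
      (s.take T) (s.drop T))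
  have hle := hsum.trans (Finset.sum_le_sum fun uk _ =>
    listProb_not_regressionCorrect_le (rule := rule) (k := uk.2) hlam0 hη h h' hlam uk.1 hT hM hθ
      hr hrθ hD)
  rw [Finset.sum_const, Finset.card_product, Finset.card_univ, Fintype.card_fin, Nat.card_Icc,
    nsmul_eq_mul, ← hδ] at hle
  have hcount : ((n * (r - 1 + 1 - 1) : ℕ) : ℝ) * δ ≤ n * r * δ := by
    refine mul_le_mul_of_nonneg_right ?_ hδ0
    rw [← Nat.cast_mul]
    exact_mod_cast Nat.mul_le_mul_left n (by omega)
  have hneg := listProb_not h1 (T + M) (fun s : List (Config n) => ∃ uk ∈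
    ((Finset.univ : Finset (Fin n)) ×ˢ Finset.Icc 1 (r - 1)),
      ¬ RegressionCorrect rule r lam η uk.1 (p.partialDeriv uk.1) uk.2 (s.take T) (s.drop T))
  refine le_trans ?_ (listProb_mono h0 (T + M) (E := fun s => ¬ ∃ uk ∈
    ((Finset.univ : Finset (Fin n)) ×ˢ Finset.Icc 1 (r - 1)),
      ¬ RegressionCorrect rule r lam η uk.1 (p.partialDeriv uk.1) uk.2 (s.take T) (s.drop T)) ?_)
  · rw [hneg]; linarith
  · intro s _ hs
    refine describes_of_regressionCorrect hlam0.le h h' s fun u k hk1 hk2 => ?_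
    by_contra hcon
    exact hs ⟨(u, k), by simp [hk1, hk2], hcon⟩

/-- When `η` is at least `2 * lam`, there are no monomials and nothing is ever selected. -/
theorem describes_of_two_mul_le {rule : OutputRule} {r T : ℕ} {lam η : ℝ} (hlam0 : 0 < lam)
    (hη : 2 * lam ≤ η) {G : SimpleGraph (Fin n)} {p : MultilinearPoly n} (h : IsRWise r G p)
    (h' : IsIdentifiable η G p) (hlam : ∀ i, (p.partialDeriv i).norm1 ≤ lam)
    (s : List (Config n)) : Describes (learnGraphT rule T r lam η s).val G := by
  refine describes_of_regressionCorrect hlam0.le h h' s fun u k _ _ => ?_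
  intro I _ _
  refine ⟨fun hne => ?_, fun _ c hc => ?_⟩
  · exfalso
    obtain ⟨B, -, hB⟩ := exists_maximalMonomial hne
    have h1 := le_abs_partialDeriv h' hB
    have h2 : |p.partialDeriv u B| ≤ (p.partialDeriv u).norm1 :=
      Finset.single_le_sum (f := fun B => |p.partialDeriv u B|) (fun _ _ => abs_nonneg _)
        (Finset.mem_univ B)
    linarith [hlam u]
  · have h1 := sum_abs_regressT_le rule hlam0.le u (idealFeatures r u (p.partialDeriv u) k)
      (s.take T) (s.drop T)
    have h2 := List.single_le_sum (l := (regressT rule lam u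
      (idealFeatures r u (p.partialDeriv u) k) (s.take T) (s.drop T)).val.map fun Ic => |Ic.2|)
      (by intro t ht; obtain ⟨Ic, -, rfl⟩ := List.mem_map.1 ht; exact abs_nonneg _) _
      (List.mem_map_of_mem hc)
    simp only at h2
    linarith

/-! ### From list expectations to the product measure -/

theorem listExp_eq_sum {Ω : Type} [Fintype Ω] (μ : Ω → ℝ) (N : ℕ) (f : List Ω → ℝ) :
    listExp μ N f = ∑ Z : Fin N → Ω, (∏ i, μ (Z i)) * f (List.ofFn Z) := by
  induction N generalizing f with
  | zero => simp [listExp]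
  | succ N ih =>
    rw [listExp, ← Equiv.sum_comp (Fin.consEquiv fun _ => Ω), Fintype.sum_prod_type]
    refine Finset.sum_congr rfl fun z _ => ?_
    rw [ih, Finset.mul_sum]
    refine Finset.sum_congr rfl fun Z _ => ?_
    simp [Fin.prod_univ_succ, mul_assoc]

theorem gibbs_apply_toReal (p : MultilinearPoly n) (z : Config n) :
    ((gibbs p).toMeasure {z}).toReal = gibbsWeight p z := by
  rw [PMF.toMeasure_apply_singleton _ _ (MeasurableSet.singleton z), gibbs, PMF.normalize_apply,
    ENNReal.toReal_mul, ENNReal.toReal_inv, tsum_fintype,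
    ENNReal.toReal_sum fun _ _ => ENNReal.ofReal_ne_top, ENNReal.toReal_ofReal (Real.exp_pos _).le,
    gibbsWeight, div_eq_mul_inv]
  congr 2
  exact Finset.sum_congr rfl fun z _ => ENNReal.toReal_ofReal (Real.exp_pos _).le

theorem sampleProb_eq_listProb (p : MultilinearPoly n) (N : ℕ) (E : List (Config n) → Prop) :
    sampleProb p N {Z | E (List.ofFn Z)} = listProb (gibbsWeight p) N E := by
  classical
  rw [listProb, listExp_eq_sum, sampleProb]
  have h1 : ({Z | E (List.ofFn Z)} : Set (Fin N → Config n)) =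
      ((Finset.univ.filter fun Z => E (List.ofFn Z) : Finset (Fin N → Config n)) : Set _) := by
    ext Z; simp
  rw [h1, ← sum_measureReal_singleton, Finset.sum_filter]
  refine Finset.sum_congr rfl fun Z _ => ?_
  split_ifs
  · rw [mul_one, measureReal_def, Measure.pi_singleton, ENNReal.toReal_prod]
    exact Finset.prod_congr rfl fun i _ => gibbs_apply_toReal p (Z i)
  · rw [mul_zero]

end Success

end MRF

namespace MRF

/-! ### The sample size suffices -/

section SampleSize

/-- The accuracy that the Sparsitron has to reach. -/
noncomputable def accuracy (r : ℕ) (lam η : ℝ) : ℝ :=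
  η ^ 2 * Real.exp (-(2 * lam * r + 2 * lam)) / 128

theorem accuracy_pos (r : ℕ) (lam : ℝ) {η : ℝ} (hη : 0 < η) : 0 < accuracy r lam η := by
  unfold accuracy; positivity

/-- The exponent in `accuracy` cancels both the loss `e^{4 lam}` of the Sparsitron and the loss
`e^{2 lam (r-1)}` of extracting a coefficient, and `128 = 2 · 64` leaves `η²/2`. -/
theorem exp_pow_mul_accuracy_lt {r : ℕ} (hr : 1 ≤ r) (lam : ℝ) {η : ℝ} (hη : 0 < η) :
    Real.exp (2 * lam) ^ (r - 1) * (64 * Real.exp (2 * (2 * lam)) * accuracy r lam η) < η ^ 2 := by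
  have h1 : Real.exp (2 * lam) ^ (r - 1) * Real.exp (2 * (2 * lam)) *
      Real.exp (-(2 * lam * r + 2 * lam)) = 1 := by
    rw [← Real.exp_nat_mul, ← Real.exp_add, ← Real.exp_add, Real.exp_eq_one_iff]
    push_cast [Nat.cast_sub hr]
    ring
  have h2 : Real.exp (2 * lam) ^ (r - 1) * (64 * Real.exp (2 * (2 * lam)) * accuracy r lam η) =
      η ^ 2 / 2 := by
    unfold accuracy
    linear_combination (η ^ 2 / 2) * h1
  rw [h2]
  have := pow_pos hη 2
  linarith

theorem exp_ten : (800 : ℝ) ≤ Real.exp 10 := by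
  have h := Real.exp_one_gt_d9
  have h1 : Real.exp 10 = Real.exp 1 ^ 10 := by rw [← Real.exp_nat_mul]; norm_num
  rw [h1]
  calc (800 : ℝ) ≤ 2 ^ 10 := by norm_num
    _ ≤ _ := pow_le_pow_left₀ (by norm_num) (by linarith) 10

/-- The quantity `max {1, log₂ (n r / (ρ η))}`. -/
noncomputable def logTerm (n r : ℕ) (ρ η : ℝ) : ℝ :=
  max 1 (Real.logb 2 ((n : ℝ) * r / (ρ * η)))

variable {n r N : ℕ} {lam η ρ : ℝ}

theorem one_le_logTerm : 1 ≤ logTerm n r ρ η := le_max_left _ _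

theorem log_le_logTerm : Real.log ((n : ℝ) * r / (ρ * η)) ≤ logTerm n r ρ η := by
  rcases le_or_gt (Real.log ((n : ℝ) * r / (ρ * η))) 0 with h | h
  · linarith [one_le_logTerm (n := n) (r := r) (ρ := ρ) (η := η)]
  · refine le_trans ?_ (le_max_right _ _)
    rw [Real.logb, le_div_iff₀ (Real.log_pos (by norm_num))]
    nlinarith [Real.log_two_lt_d9]

/-- Squaring the accuracy costs `η⁴ e^{-(4 lam r + 4 lam)} / 16384`. Of the exponents `60`, a part
`20 r` pays for `16384`, and `10 lam r` pays for the exponential. The remaining `40` and `50` are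
the reserve for all later polynomial factors. -/
theorem mul_logTerm_le (hr : 1 ≤ r) (hlam : 0 < lam) (hη : 0 < η)
    (hN : Real.exp (60 * r) * Real.exp (60 * lam * r) * logTerm n r ρ η / η ^ 4 ≤ N) :
    Real.exp (40 * r) * Real.exp (50 * (lam * r)) * logTerm n r ρ η ≤
      N * accuracy r lam η ^ 2 := by
  have hr' : (1:ℝ) ≤ r := by exact_mod_cast hr
  have hL : 1 ≤ logTerm n r ρ η := one_le_logTerm
  have h1 := mul_le_mul_of_nonneg_right hN (sq_nonneg (accuracy r lam η))
  refine le_trans ?_ h1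
  have h2 : accuracy r lam η ^ 2 =
      η ^ 4 * Real.exp (-(4 * lam * r + 4 * lam)) / 16384 := by
    have : Real.exp (-(4 * lam * r + 4 * lam)) = Real.exp (-(2 * lam * r + 2 * lam)) ^ 2 := by
      rw [← Real.exp_nat_mul]; congr 1; push_cast; ring
    unfold accuracy; rw [this]; ring
  have h3 : Real.exp (60 * r) * Real.exp (60 * lam * r) * logTerm n r ρ η / η ^ 4 *
      accuracy r lam η ^ 2 = Real.exp (60 * r) * Real.exp (60 * lam * r) *
      Real.exp (-(4 * lam * r + 4 * lam)) / 16384 * logTerm n r ρ η := by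
    rw [h2]; field_simp
  rw [h3]
  refine mul_le_mul_of_nonneg_right ?_ (by linarith)
  rw [le_div_iff₀ (by norm_num)]
  have h4 : (16384:ℝ) ≤ Real.exp 20 := by
    have : Real.exp 20 = Real.exp 10 * Real.exp 10 := by rw [← Real.exp_add]; norm_num
    rw [this]
    nlinarith [exp_ten]
  calc Real.exp (40 * r) * Real.exp (50 * (lam * r)) * 16384
      ≤ Real.exp (40 * r) * Real.exp (50 * (lam * r)) * Real.exp 20 :=
        mul_le_mul_of_nonneg_left h4 (by positivity)
    _ ≤ _ := by
        rw [← Real.exp_add, ← Real.exp_add, ← Real.exp_add, ← Real.exp_add]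
        refine Real.exp_le_exp.2 ?_
        nlinarith [mul_le_mul_of_nonneg_left hr' hlam.le]

/-- A bound for polynomial factors by the exponential ones. -/
theorem poly_le_exp (hr : 1 ≤ r) (hlam : 0 < lam) :
    800 * (1 + lam * r) ^ 6 * (1 + r : ℝ) ^ 2 ≤
      Real.exp (40 * r) * Real.exp (50 * (lam * r)) := by
  have hr' : (1:ℝ) ≤ r := by exact_mod_cast hr
  have h1 : (1 + r : ℝ) ^ 2 ≤ Real.exp r ^ 2 :=
    pow_le_pow_left₀ (by linarith) (by linarith [Real.add_one_le_exp (r : ℝ)]) 2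
  have h2 : (1 + lam * r) ^ 6 ≤ Real.exp (lam * r) ^ 6 :=
    pow_le_pow_left₀ (by positivity) (by linarith [Real.add_one_le_exp (lam * r)]) 6
  calc 800 * (1 + lam * r) ^ 6 * (1 + r : ℝ) ^ 2
      ≤ Real.exp 10 * Real.exp (lam * r) ^ 6 * Real.exp r ^ 2 := by
        gcongr; exact exp_ten
    _ ≤ _ := by
        rw [← Real.exp_nat_mul, ← Real.exp_nat_mul, ← Real.exp_add, ← Real.exp_add,
          ← Real.exp_add]
        refine Real.exp_le_exp.2 ?_
        push_cast
        have : 0 ≤ lam * r := by positivity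
        nlinarith

/-- `logTerm` contains `-log η`, which is very negative for large `η`; the gap is closed by `log η ≤
η - 1` and `η < 2 * lam`. -/
theorem log_two_mul_le (hr : 1 ≤ r) (hn : 1 ≤ n) (hη : 0 < η) (hη2 : η < 2 * lam) (hρ : 0 < ρ) :
    Real.log (2 * n * r / ρ) ≤ logTerm n r ρ η + 1 + 2 * lam := by
  have hn' : (0:ℝ) < n := by exact_mod_cast hn
  have hr' : (0:ℝ) < r := by exact_mod_cast hr
  have h1 : 2 * (n:ℝ) * r / ρ = (n : ℝ) * r / (ρ * η) * (2 * η) := by field_simp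
  rw [h1, Real.log_mul (by positivity) (by positivity), Real.log_mul (by norm_num) hη.ne']
  have h2 := log_le_logTerm (n := n) (r := r) (η := η) (ρ := ρ)
  have h3 := Real.log_le_sub_one_of_pos hη
  have h4 := Real.log_two_lt_d9
  linarith

/-- The dimension is at most `4 n^r`, and `n ≤ n r / ρ` bounds `log n` by `logTerm` plus `log η`.
The factor 2 covers the passage to base 2. -/
theorem logb_dim_le (hr : 1 ≤ r) (hn : 1 ≤ n) (hη : 0 < η) (hη2 : η < 2 * lam) (hρ : 0 < ρ)
    (hρ1 : ρ < 1) :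
    Real.logb 2 ((2 * n ^ (r - 1) + 1 : ℕ) : ℝ) ≤ 2 + 2 * r * (logTerm n r ρ η + 2 * lam) := by
  have hn' : (1:ℝ) ≤ n := by exact_mod_cast hn
  have hr' : (1:ℝ) ≤ r := by exact_mod_cast hr
  have hlog2 := Real.log_two_gt_d9
  have h1 : (2 * n ^ (r - 1) + 1 : ℕ) ≤ 4 * n ^ r := by
    have h2 : n ^ (r - 1) ≤ n ^ r := Nat.pow_le_pow_right hn (by omega)
    have h3 : 1 ≤ n ^ r := Nat.one_le_pow _ _ hn
    omega
  have h2 : Real.logb 2 ((2 * n ^ (r - 1) + 1 : ℕ) : ℝ) ≤ Real.logb 2 (4 * (n:ℝ) ^ r) := by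
    refine Real.logb_le_logb_of_le (by norm_num) (by positivity) ?_
    exact_mod_cast h1
  refine h2.trans ?_
  have h3 : Real.logb 2 (4 * (n:ℝ) ^ r) = 2 + r * Real.logb 2 n := by
    rw [Real.logb_mul (by norm_num) (by positivity), Real.logb_pow]
    congr 1
    rw [show (4:ℝ) = 2 ^ (2:ℕ) by norm_num, Real.logb_pow, Real.logb_self_eq_one (by norm_num)]
    norm_num
  rw [h3]
  have h4 : Real.log n ≤ logTerm n r ρ η + 2 * lam := by
    have h5 : Real.log n ≤ Real.log ((n : ℝ) * r / (ρ * η) * η) := by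
      refine Real.log_le_log (by linarith) ?_
      have : (n : ℝ) * r / (ρ * η) * η = n * r / ρ := by field_simp
      rw [this, le_div_iff₀ hρ]
      nlinarith
    rw [Real.log_mul (by positivity) hη.ne'] at h5
    have h6 := log_le_logTerm (n := n) (r := r) (η := η) (ρ := ρ)
    have h7 := Real.log_le_sub_one_of_pos hη
    linarith
  have h5 : Real.logb 2 n ≤ 2 * (logTerm n r ρ η + 2 * lam) := by
    rw [Real.logb, div_le_iff₀ (by linarith)]
    have : 0 ≤ Real.log n := Real.log_nonneg hn'
    nlinarith
  nlinarith

theorem learningRate_dim_le {T : ℕ} (hT : 0 < T) (hr : 1 ≤ r) (hn : 1 ≤ n) (hlam : 0 < lam)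
    (hη : 0 < η)
    (hη2 : η < 2 * lam) (hρ : 0 < ρ) (hρ1 : ρ < 1) (hNT : (N : ℝ) ≤ 3 * T)
    (hX : Real.exp (40 * r) * Real.exp (50 * (lam * r)) * logTerm n r ρ η ≤
      N * accuracy r lam η ^ 2) :
    12 * lam * learningRate (2 * n ^ (r - 1) + 1) T ≤ accuracy r lam η := by
  have hr' : (1:ℝ) ≤ r := by exact_mod_cast hr
  have hT' : (0:ℝ) < T := by exact_mod_cast hT
  have hL : 1 ≤ logTerm n r ρ η := one_le_logTerm
  set L := logTerm n r ρ η
  set θ := accuracy r lam η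
  have hθ : 0 < θ := accuracy_pos r lam hη
  have hpoly := poly_le_exp hr hlam
  have hd := logb_dim_le hr hn hη hη2 hρ hρ1
  have hlr : lam ≤ lam * r := by nlinarith
  set t := lam * r with ht
  have ht0 : 0 < t := by linarith
  -- Here `432 = 3 · 12²`: the square of the factor `12 * lam`, times 3 from `N ≤ 3 T`.
  have h1 : 432 * lam ^ 2 * Real.logb 2 ((2 * n ^ (r - 1) + 1 : ℕ) : ℝ) ≤
      800 * (1 + t) ^ 6 * (1 + r : ℝ) ^ 2 * L := by
    have h2 : Real.logb 2 ((2 * n ^ (r - 1) + 1 : ℕ) : ℝ) ≤ 4 * r * L * (1 + t) := by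
      refine hd.trans ?_
      have h3 : 2 * r * (2 * lam) = 4 * t := by rw [ht]; ring
      have h4 : 1 ≤ r * L := one_le_mul_of_one_le_of_one_le hr' hL
      have h5 : t ≤ t * (r * L) := le_mul_of_one_le_right ht0.le h4
      nlinarith
    have h3 : lam ^ 2 ≤ (1 + t) ^ 2 := pow_le_pow_left₀ hlam.le (by linarith) 2
    have h4 : (1 + t) ^ 3 ≤ (1 + t) ^ 6 := pow_le_pow_right₀ (by linarith) (by norm_num)
    have h5 : 4 * (r : ℝ) ≤ (1 + r : ℝ) ^ 2 := by nlinarith [sq_nonneg ((r:ℝ) - 1)]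
    calc 432 * lam ^ 2 * Real.logb 2 ((2 * n ^ (r - 1) + 1 : ℕ) : ℝ)
        ≤ 432 * lam ^ 2 * (4 * r * L * (1 + t)) := by gcongr
      _ ≤ 432 * (1 + t) ^ 2 * ((1 + r : ℝ) ^ 2 * L * (1 + t)) := by gcongr
      _ = 432 * (1 + t) ^ 3 * (1 + r : ℝ) ^ 2 * L := by ring
      _ ≤ 800 * (1 + t) ^ 6 * (1 + r : ℝ) ^ 2 * L := by gcongr; norm_num
  have h2 : 432 * lam ^ 2 * Real.logb 2 ((2 * n ^ (r - 1) + 1 : ℕ) : ℝ) ≤ 3 * T * θ ^ 2 :=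
    h1.trans ((mul_le_mul_of_nonneg_right hpoly (by linarith)).trans
      (hX.trans (mul_le_mul_of_nonneg_right hNT (sq_nonneg θ))))
  rw [learningRate, ← le_div_iff₀' (by positivity)]
  refine Real.sqrt_le_iff.2 ⟨by positivity, ?_⟩
  rw [div_le_iff₀ hT', div_pow, div_mul_eq_mul_div, le_div_iff₀ (by positivity)]
  nlinarith

/-- From `η < 2 * lam` and `x ≤ e^x` the accuracy is at most `lam / 32`, well below `6 * lam`. -/
theorem learningRate_le_half {ε : ℝ} (hlam : 0 < lam) (hη : 0 < η) (hη2 : η < 2 * lam)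
    (h : 12 * lam * ε ≤ accuracy r lam η) : ε ≤ 1 / 2 := by
  have h1 : accuracy r lam η ≤ 6 * lam := by
    have h2 : Real.exp (-(2 * lam * r + 2 * lam)) * lam ≤ 1 := by
      rw [Real.exp_neg, inv_mul_le_iff₀ (Real.exp_pos _), mul_one]
      have : 0 ≤ lam * r := by positivity
      linarith [Real.add_one_le_exp (2 * lam * r + 2 * lam)]
    have h3 : η ^ 2 ≤ 4 * lam ^ 2 := by nlinarith
    have h4 := Real.exp_pos (-(2 * lam * r + 2 * lam))
    unfold accuracy
    calc η ^ 2 * Real.exp (-(2 * lam * r + 2 * lam)) / 128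
        ≤ 4 * lam ^ 2 * Real.exp (-(2 * lam * r + 2 * lam)) / 128 := by gcongr
      _ = 4 * lam * (Real.exp (-(2 * lam * r + 2 * lam)) * lam) / 128 := by ring
      _ ≤ 4 * lam * 1 / 128 := by gcongr
      _ ≤ 6 * lam := by linarith
  nlinarith

/-- The exponent has to exceed `log (2 n r / ρ)`; the factor 2 leaves the other half of `ρ` to the
validation. -/
theorem train_failure_le {T : ℕ} (hr : 1 ≤ r) (hn : 1 ≤ n) (hlam : 0 < lam) (hη : 0 < η)
    (hη2 : η < 2 * lam) (hρ : 0 < ρ) (hNT : (N : ℝ) ≤ 3 * T)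
    (hX : Real.exp (40 * r) * Real.exp (50 * (lam * r)) * logTerm n r ρ η ≤
      N * accuracy r lam η ^ 2) :
    2 * n * r * Real.exp (-(T * accuracy r lam η ^ 2 / (32 * (2 * lam) ^ 2))) ≤ ρ := by
  have hn' : (0:ℝ) < n := by exact_mod_cast hn
  have hr' : (1:ℝ) ≤ r := by exact_mod_cast hr
  have hL : 1 ≤ logTerm n r ρ η := one_le_logTerm
  have hlog := log_two_mul_le hr hn hη hη2 hρ
  have hpoly := poly_le_exp hr hlam
  set L := logTerm n r ρ η
  set θ := accuracy r lam η
  have hlr : lam ≤ lam * r := by nlinarith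
  set t := lam * r with ht
  have ht0 : 0 < t := by linarith
  have h1 : Real.log (2 * n * r / ρ) ≤ T * θ ^ 2 / (32 * (2 * lam) ^ 2) := by
    refine hlog.trans ?_
    rw [le_div_iff₀ (by positivity)]
    have h2 : L + 1 + 2 * lam ≤ 2 * L * (1 + t) := by nlinarith
    have h3 : lam ^ 2 ≤ (1 + t) ^ 2 := pow_le_pow_left₀ hlam.le (by linarith) 2
    have h4 : (1 + t) ^ 3 ≤ (1 + t) ^ 6 := pow_le_pow_right₀ (by linarith) (by norm_num)
    have h5 : (4:ℝ) ≤ (1 + r : ℝ) ^ 2 := by nlinarith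
    have h6 : 3 * ((L + 1 + 2 * lam) * (32 * (2 * lam) ^ 2)) ≤ 3 * T * θ ^ 2 := by
      calc 3 * ((L + 1 + 2 * lam) * (32 * (2 * lam) ^ 2))
          = 384 * lam ^ 2 * (L + 1 + 2 * lam) := by ring
        _ ≤ 384 * (1 + t) ^ 2 * (2 * L * (1 + t)) := by gcongr
        _ = 192 * (1 + t) ^ 3 * 4 * L := by ring
        _ ≤ 800 * (1 + t) ^ 6 * (1 + r : ℝ) ^ 2 * L := by gcongr; norm_num
        _ ≤ _ := (mul_le_mul_of_nonneg_right hpoly (by linarith)).trans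
            (hX.trans (mul_le_mul_of_nonneg_right hNT (sq_nonneg θ)))
    linarith
  have h2 : 2 * n * r / ρ ≤ Real.exp (T * θ ^ 2 / (32 * (2 * lam) ^ 2)) :=
    (Real.log_le_iff_le_exp (by positivity)).1 h1
  rw [Real.exp_neg, ← div_eq_mul_inv, div_le_iff₀ (Real.exp_pos _)]
  rw [div_le_iff₀ hρ] at h2
  linarith

/-- The union bound over `T` vectors brings a factor `N` that the exponent must beat. Multiplying by
`θ²` turns `N` into `X = N θ²`, and `X e^{-X/4} ≤ 8 e^{-X/8}`. The price is `log (1/θ²)`, which is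
of the order of `logTerm` plus `lam * r`. -/
theorem valid_failure_le {T M : ℕ} (hr : 1 ≤ r) (hn : 1 ≤ n) (hlam : 0 < lam) (hη : 0 < η)
    (hη2 : η < 2 * lam) (hρ : 0 < ρ) (hρ1 : ρ < 1) (hTN : 2 * (T : ℝ) ≤ N) (hNM : (N : ℝ) ≤ 2 * M)
    (hX : Real.exp (40 * r) * Real.exp (50 * (lam * r)) * logTerm n r ρ η ≤
      N * accuracy r lam η ^ 2) :
    2 * n * r * (T * (2 * Real.exp (-(M * accuracy r lam η ^ 2 / 2)))) ≤ ρ := by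
  have hn' : (1:ℝ) ≤ n := by exact_mod_cast hn
  have hr' : (1:ℝ) ≤ r := by exact_mod_cast hr
  have hL : 1 ≤ logTerm n r ρ η := one_le_logTerm
  have hlog := log_two_mul_le hr hn hη hη2 hρ
  have hlog2 := log_le_logTerm (n := n) (r := r) (η := η) (ρ := ρ)
  have hpoly := poly_le_exp hr hlam
  have hθ : 0 < accuracy r lam η := accuracy_pos r lam hη
  have hθlog : -(2 * Real.log (accuracy r lam η)) ≤
      4 * logTerm n r ρ η + 4 * (lam * r) + 4 * lam + 20 := by
    have h1 : Real.log (accuracy r lam η) =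
        2 * Real.log η - (2 * lam * r + 2 * lam) - Real.log 128 := by
      unfold accuracy
      rw [Real.log_div (by positivity) (by norm_num), Real.log_mul (by positivity)
        (Real.exp_pos _).ne', Real.log_exp, Real.log_pow]
      push_cast; ring
    -- Small `η` is harmless: `1/η ≤ n r / (ρ η)`, because `n r ≥ 1` and `ρ < 1`.
    have h2 : -Real.log η ≤ logTerm n r ρ η := by
      refine le_trans ?_ hlog2
      rw [← Real.log_inv]
      refine Real.log_le_log (by positivity) ?_
      rw [inv_eq_one_div, div_le_div_iff₀ hη (by positivity), one_mul]
      have h3 : 1 ≤ (n:ℝ) * r := one_le_mul_of_one_le_of_one_le hn' hr'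
      nlinarith
    have h3 : Real.log 128 ≤ 10 := by
      rw [Real.log_le_iff_le_exp (by norm_num)]
      linarith [exp_ten]
    rw [h1]
    linarith
  set L := logTerm n r ρ η
  set θ := accuracy r lam η
  have hlr : lam ≤ lam * r := by nlinarith
  set t := lam * r with ht
  have ht0 : 0 < t := by linarith
  set X := N * θ ^ 2 with hXdef
  have hX0 : 0 ≤ X := by positivity
  have hX1 : 8 * (L + 1 + 2 * lam + (4 * L + 4 * t + 4 * lam + 20) + 3) ≤ X := by
    refine le_trans ?_ ((mul_le_mul_of_nonneg_right hpoly (by linarith)).trans hX)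
    have h1 : 1 + t ≤ (1 + t) ^ 6 := le_self_pow₀ (by linarith) (by norm_num)
    have h5 : (4:ℝ) ≤ (1 + r : ℝ) ^ 2 := by nlinarith
    calc 8 * (L + 1 + 2 * lam + (4 * L + 4 * t + 4 * lam + 20) + 3)
        ≤ 800 * (1 + t) * 4 * L := by nlinarith
      _ ≤ 800 * (1 + t) ^ 6 * (1 + r : ℝ) ^ 2 * L := by gcongr
  have h8 : Real.log 8 ≤ 3 := by
    rw [Real.log_le_iff_le_exp (by norm_num), show (3:ℝ) = ((3:ℕ):ℝ) * 1 by norm_num,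
      Real.exp_nat_mul]
    calc (8:ℝ) = 2 ^ 3 := by norm_num
      _ ≤ _ := pow_le_pow_left₀ (by norm_num) (by linarith [Real.exp_one_gt_d9]) 3
  -- the factor `N` is absorbed by half of the exponent
  have h1 : X * Real.exp (-(X / 4)) ≤ 8 * Real.exp (-(X / 8)) := by
    have h2 : X / 8 ≤ Real.exp (X / 8) := by linarith [Real.add_one_le_exp (X / 8)]
    have h3 : Real.exp (-(X / 4)) * Real.exp (X / 8) = Real.exp (-(X / 8)) := by
      rw [← Real.exp_add]; congr 1; ring
    have h4 := Real.exp_pos (-(X / 4))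
    nlinarith
  have h2 : Real.exp (-(X / 8)) ≤ θ ^ 2 * ρ / (8 * (2 * n * r)) := by
    have h3 : Real.log (8 * (2 * n * r / ρ) / θ ^ 2) ≤ X / 8 := by
      rw [Real.log_div (by positivity) (by positivity), Real.log_mul (by norm_num) (by positivity),
        Real.log_pow]
      push_cast
      linarith
    rw [Real.log_le_iff_le_exp (by positivity)] at h3
    rw [Real.exp_neg, inv_le_comm₀ (Real.exp_pos _) (by positivity)]
    refine le_trans (le_of_eq ?_) h3
    field_simp
  have h3 : T * (2 * Real.exp (-(M * θ ^ 2 / 2))) ≤ N * Real.exp (-(X / 4)) := by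
    have h4 : Real.exp (-(M * θ ^ 2 / 2)) ≤ Real.exp (-(X / 4)) := by
      refine Real.exp_le_exp.2 ?_
      have := mul_le_mul_of_nonneg_right hNM (sq_nonneg θ)
      linarith
    have h5 := Real.exp_pos (-(M * θ ^ 2 / 2))
    calc T * (2 * Real.exp (-(M * θ ^ 2 / 2))) = 2 * T * Real.exp (-(M * θ ^ 2 / 2)) := by ring
      _ ≤ N * Real.exp (-(X / 4)) := mul_le_mul hTN h4 h5.le (by positivity)
  have h4 : θ ^ 2 * (N * Real.exp (-(X / 4))) ≤ θ ^ 2 * (ρ / (2 * n * r)) := by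
    calc θ ^ 2 * (N * Real.exp (-(X / 4))) = X * Real.exp (-(X / 4)) := by rw [hXdef]; ring
      _ ≤ 8 * (θ ^ 2 * ρ / (8 * (2 * n * r))) := h1.trans (by linarith)
      _ = _ := by field_simp
  have h5 := h3.trans (le_of_mul_le_mul_left h4 (by positivity))
  rw [le_div_iff₀ (by positivity)] at h5
  linarith

/-- Ensures that half of the samples, rounded down, is positive and at least a third of them. The
bound `η < 2 * lam` makes `η⁴` smaller than the exponential in `lam * r`. -/
theorem three_le_of_sample_size (hr : 1 ≤ r) (hlam : 0 < lam) (hη : 0 < η) (hη2 : η < 2 * lam)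
    (hN : Real.exp (60 * r) * Real.exp (60 * lam * r) * logTerm n r ρ η / η ^ 4 ≤ N) : 3 ≤ N := by
  have hr' : (1:ℝ) ≤ r := by exact_mod_cast hr
  have hL : 1 ≤ logTerm n r ρ η := one_le_logTerm
  have hlr : lam ≤ lam * r := by nlinarith
  have h1 : η ^ 4 ≤ Real.exp (60 * lam * r) := by
    have h2 : η ≤ Real.exp (2 * lam) := by linarith [Real.add_one_le_exp (2 * lam)]
    calc η ^ 4 ≤ Real.exp (2 * lam) ^ 4 := pow_le_pow_left₀ hη.le h2 4
      _ ≤ _ := by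
        rw [← Real.exp_nat_mul]
        refine Real.exp_le_exp.2 ?_
        push_cast
        nlinarith
  have h2 : (3:ℝ) ≤ Real.exp (60 * r) := by linarith [Real.add_one_le_exp (60 * (r:ℝ))]
  have h3 : (3:ℝ) ≤ N := by
    refine le_trans ?_ hN
    rw [le_div_iff₀ (by positivity)]
    calc 3 * η ^ 4 ≤ Real.exp (60 * r) * Real.exp (60 * lam * r) * 1 := by
          rw [mul_one]; exact mul_le_mul h2 h1 (by positivity) (by positivity)
      _ ≤ _ := by gcongr
  exact_mod_cast h3

/-- The algorithm learns the graph with probability at least `1 - ρ`. -/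
theorem sampleProb_describes_ge (hr : 1 ≤ r) (hrn : r ≤ n) (hlam : 0 < lam) (hη : 0 < η)
    (hρ : 0 < ρ) (hρ1 : ρ < 1)
    (hN : Real.exp (60 * r) * Real.exp (60 * lam * r) * logTerm n r ρ η / η ^ 4 ≤ N)
    {G : SimpleGraph (Fin n)} {p : MultilinearPoly n} (h : IsRWise r G p)
    (h' : IsIdentifiable η G p) (hp : ∀ i, (p.partialDeriv i).norm1 ≤ lam) (rule : OutputRule) :
    1 - ρ ≤ sampleProb p N
      {Z | Describes (learnGraphT rule (N / 2) r lam η (List.ofFn Z)).val G} := by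
  rw [sampleProb_eq_listProb p N fun s => Describes (learnGraphT rule (N / 2) r lam η s).val G]
  -- For large `η` the sample size condition may give almost no samples; this case is settled
  -- without any probability estimate.
  rcases le_or_gt (2 * lam) η with hcase | hcase
  · have h2 : listProb (gibbsWeight p) N
        (fun s => Describes (learnGraphT rule (N / 2) r lam η s).val G) = 1 :=
      (listExp_congr N fun s _ => if_pos (describes_of_two_mul_le hlam hcase h h' hp s)).trans
        (listExp_const (sum_gibbsWeight p) N 1)
    rw [h2]; linarith
  · have hn : 1 ≤ n := hr.trans hrn
    have h3 := three_le_of_sample_size hr hlam hη hcase hN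
    have hX := mul_logTerm_le hr hlam hη hN
    obtain ⟨M, hM⟩ : ∃ M, N = N / 2 + M := ⟨N - N / 2, by omega⟩
    have hT : 0 < N / 2 := by omega
    have hNT : (N : ℝ) ≤ 3 * (N / 2 : ℕ) := by
      have : N ≤ 3 * (N / 2) := by omega
      exact_mod_cast this
    have hTN : 2 * ((N / 2 : ℕ) : ℝ) ≤ N := by
      have : 2 * (N / 2) ≤ N := by omega
      exact_mod_cast this
    have hNM : (N : ℝ) ≤ 2 * M := by
      have : N ≤ 2 * M := by omega
      exact_mod_cast this
    have hrate := learningRate_dim_le hT hr hn hlam hη hcase hρ hρ1 hNT hX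
    have h4 := train_failure_le hr hn hlam hη hcase hρ hNT hX
    have h5 := valid_failure_le hr hn hlam hη hcase hρ hρ1 hTN hNM hX
    set T := N / 2
    rw [hM]
    refine listProb_describes_ge hlam hη h h' hp hT (by omega) (accuracy_pos r lam hη)
      (learningRate_le_half (r := r) hlam hη hcase hrate) (le_of_eq_of_le (by ring) hrate)
      (exp_pow_mul_accuracy_lt hr lam hη) ?_
    linarith

end SampleSize

end MRF

namespace MRF

/-! ### Running times of the basic operations -/

section BasicTime

variable {α β γ σ : Type}

theorem mapT_time_le {f : α → Timed β} {l : List α} {c : ℕ} (h : ∀ a ∈ l, (f a).time ≤ c) :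
    (mapT f l).time ≤ (c + 1) * l.length + 1 := by
  induction l with
  | nil => simp [mapT]
  | cons a l ih =>
    have h1 := ih fun b hb => h b (List.mem_cons_of_mem _ hb)
    have h2 := h a List.mem_cons_self
    simp only [mapT, Timed.bind_time, op_time, List.length_cons, Nat.mul_succ]
    omega

theorem zipWithT_time_le {f : α → β → Timed γ} {c : ℕ} (h : ∀ a b, (f a b).time ≤ c)
    (l : List α) (m : List β) : (zipWithT f l m).time ≤ (c + 1) * l.length + 1 := by
  induction l generalizing m with
  | nil => simp [zipWithT]
  | cons a l ih =>
    cases m with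
    | nil => simp [zipWithT]
    | cons b m =>
      have h1 := ih m
      have h2 := h a b
      simp only [zipWithT, Timed.bind_time, op_time, List.length_cons, Nat.mul_succ]
      omega

theorem zipWithT_time_le_right {f : α → β → Timed γ} {c : ℕ} (h : ∀ a b, (f a b).time ≤ c)
    (l : List α) (m : List β) : (zipWithT f l m).time ≤ (c + 1) * m.length + 1 := by
  induction l generalizing m with
  | nil => simp [zipWithT]
  | cons a l ih =>
    cases m with
    | nil => simp [zipWithT]
    | cons b m =>
      have h1 := ih m
      have h2 := h a b
      simp only [zipWithT, Timed.bind_time, op_time, List.length_cons, Nat.mul_succ]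
      omega

theorem foldT_time_le {f : σ → α → Timed σ} {l : List α} {c : ℕ}
    (h : ∀ s, ∀ a ∈ l, (f s a).time ≤ c) (s : σ) :
    (foldT f s l).time ≤ (c + 1) * l.length + 1 := by
  induction l generalizing s with
  | nil => simp [foldT]
  | cons a l ih =>
    have h1 := ih (fun s b hb => h s b (List.mem_cons_of_mem _ hb)) (f s a).val
    have h2 := h s a List.mem_cons_self
    simp only [foldT, Timed.bind_time, op_time, op_val, List.length_cons, Nat.mul_succ]
    omega

theorem filterT_time_le {f : α → Timed Bool} {l : List α} {c : ℕ}
    (h : ∀ a ∈ l, (f a).time ≤ c) : (filterT f l).time ≤ (c + 1) * l.length + 1 := by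
  induction l with
  | nil => simp [filterT]
  | cons a l ih =>
    have h1 := ih fun b hb => h b (List.mem_cons_of_mem _ hb)
    have h2 := h a List.mem_cons_self
    simp only [filterT, Timed.bind_time, List.length_cons, Nat.mul_succ]
    split_ifs <;> simp only [op_time] <;> omega

theorem anyT_time_le {f : α → Timed Bool} {l : List α} {c : ℕ}
    (h : ∀ a ∈ l, (f a).time ≤ c) : (anyT f l).time ≤ (c + 2) * l.length + 1 :=
  foldT_time_le (c := c + 1) (fun s a ha => by
    simp only [Timed.bind_time, op_time]
    have := h a ha
    omega) false

theorem allT_time_le {f : α → Timed Bool} {l : List α} {c : ℕ}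
    (h : ∀ a ∈ l, (f a).time ≤ c) : (allT f l).time ≤ (c + 2) * l.length + 1 :=
  foldT_time_le (c := c + 1) (fun s a ha => by
    simp only [Timed.bind_time, op_time]
    have := h a ha
    omega) true

theorem lengthT_time_le (l : List α) : (lengthT l).time ≤ 2 * l.length + 1 :=
  foldT_time_le (c := 1) (fun _ _ _ => le_rfl) 0

theorem appendT_time (l m : List α) : (appendT l m).time = l.length + 1 := by
  induction l with
  | nil => rfl
  | cons a l ih => simp only [appendT, Timed.bind_time, op_time, ih, List.length_cons]

theorem splitT_time_le (k : ℕ) (l : List α) : (splitT k l).time ≤ k + 1 := by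
  induction k generalizing l with
  | zero => simp [splitT]
  | succ k ih =>
    cases l with
    | nil => simp [splitT]
    | cons a l =>
      have := ih l
      simp only [splitT, Timed.bind_time, op_time]
      omega

theorem sumT_time_le (l : List ℝ) : (sumT l).time ≤ 2 * l.length + 1 :=
  foldT_time_le (c := 1) (fun _ _ _ => le_rfl) 0

theorem dotT_time_le (v x : List ℝ) : (dotT v x).time ≤ 4 * v.length + 2 := by
  have h1 := zipWithT_time_le (f := fun a b : ℝ => op (a * b)) (c := 1) (fun _ _ => le_rfl) v x
  have h2 := sumT_time_le (List.zipWith (fun a b => a * b) v x)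
  rw [List.length_zipWith] at h2
  simp only [dotT, Timed.bind_time, zipWithT_val, op_val]
  omega

theorem norm1T_time_le (v : List ℝ) : (norm1T v).time ≤ 4 * v.length + 2 := by
  have h1 := mapT_time_le (f := fun a : ℝ => op |a|) (l := v) (c := 1) (fun _ _ => le_rfl)
  have h2 := sumT_time_le (v.map fun a => |a|)
  rw [List.length_map] at h2
  simp only [norm1T, Timed.bind_time, mapT_val, op_val]
  omega

theorem argminT_time_le {f : α → Timed ℝ} {dflt : α} {l : List α} {c : ℕ}
    (h : ∀ a ∈ l, (f a).time ≤ c) : (argminT f dflt l).time ≤ (c + 3) * l.length + 1 := by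
  cases l with
  | nil => simp [argminT]
  | cons a l =>
    have h1 := h a List.mem_cons_self
    have h2 := foldT_time_le (f := fun (s : α × ℝ) b => do
      let cb ← f b
      let lt ← op (decide (cb < s.2))
      if lt then op (b, cb) else op s) (l := l) (c := c + 2) (fun s b hb => by
        have := h b (List.mem_cons_of_mem _ hb)
        simp only [Timed.bind_time, op_time]
        split_ifs <;> simp only [op_time] <;> omega) (a, (f a).val)
    rw [show c + 2 + 1 = c + 3 from rfl] at h2
    simp only [argminT, Timed.bind_time, op_time, List.length_cons, Nat.mul_succ]
    omega

variable {n : ℕ}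

theorem memT_time_le (v : Fin n) (S : List (Fin n)) : (memT v S).time ≤ 3 * S.length + 1 :=
  anyT_time_le (c := 1) fun _ _ => le_rfl

/-- The growing union never has repetitions, so each membership test scans at most `n` entries. -/
theorem unionT_time_le (I S : List (Fin n)) (hS : S.Nodup) :
    (unionT I S).time ≤ (3 * n + 3) * I.length + 1 := by
  induction I generalizing S with
  | nil => simp [unionT, foldT]
  | cons a I ih =>
    have hlen : S.length ≤ n := by simpa using hS.length_le_card
    have h1 := memT_time_le a S
    have h2 : ∀ S' : List (Fin n), S'.Nodup → (foldT (fun S' v => do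
        let b ← memT v S'
        if b then op S' else op (v :: S')) S' I).time ≤ (3 * n + 3) * I.length + 1 := ih
    simp only [unionT, foldT, Timed.bind_time, op_time, op_val, List.length_cons, Nat.mul_succ,
      Timed.bind_val, memT_val, Timed.ite_val, decide_eq_true_eq]
    split_ifs with h
    · have h3 := h2 S hS
      simp only [op_time]
      omega
    · have h3 := h2 (a :: S) (List.nodup_cons.2 ⟨h, hS⟩)
      simp only [op_time]
      omega

theorem subsetT_time_le {I A : List (Fin n)} {r : ℕ} (hI : I.length ≤ r) (hA : A.length ≤ r) :
    (subsetT I A).time ≤ (3 * r + 3) * r + 1 := by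
  have h := allT_time_le (f := fun v => memT v A) (l := I) (c := 3 * r + 1) (fun v _ => by
    have := memT_time_le v A
    omega)
  refine h.trans (Nat.add_le_add_right (Nat.mul_le_mul_left _ hI) 1)

theorem coveredT_time_le {J : List (List (Fin n))} {I : List (Fin n)} {r : ℕ}
    (hI : I.length ≤ r) (hJ : ∀ A ∈ J, A.length ≤ r) :
    (coveredT J I).time ≤ ((3 * r + 3) * r + 3) * J.length + 1 :=
  anyT_time_le fun A hA => subsetT_time_le hI (hJ A hA)

/-! ### Counting subsets of bounded size -/

theorem numSubsets_pos (k m : ℕ) : 1 ≤ numSubsets k m := by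
  induction m generalizing k with
  | zero => cases k <;> simp [numSubsets]
  | succ m ih =>
    cases k with
    | zero => simp [numSubsets]
    | succ k => have := ih k; simp only [numSubsets]; omega

theorem subsetsT_time_le (k : ℕ) (l : List α) :
    (subsetsT k l).time ≤ 8 * (k + 1) * numSubsets k l.length := by
  induction l generalizing k with
  | nil => cases k <;> simp [subsetsT, numSubsets]; omega
  | cons a l ih =>
    cases k with
    | zero => simp [subsetsT, numSubsets]
    | succ k =>
      have h1 := ih (k + 1)
      have h2 := ih k
      have h3 := mapT_time_le (f := fun I : List α => op (a :: I)) (l := (subsetsT k l).val)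
        (c := 1) (fun _ _ => le_rfl)
      have h4 := numSubsets_pos k l.length
      rw [length_subsetsT_val] at h3
      simp only [subsetsT, Timed.bind_time, appendT_time, mapT_val, List.length_map,
        length_subsetsT_val, List.length_cons, numSubsets] at h3 ⊢
      nlinarith

theorem numSubsets_succ (k m : ℕ) :
    numSubsets (k + 1) m = numSubsets k m + m.choose (k + 1) := by
  induction m generalizing k with
  | zero => cases k <;> simp [numSubsets]
  | succ m ih =>
    cases k with
    | zero => simp [numSubsets, ih 0]; omega
    | succ k =>
      have h1 := ih (k + 1)
      have h2 := ih k
      have h3 : (m + 1).choose (k + 1 + 1) = m.choose (k + 1) + m.choose (k + 1 + 1) :=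
        Nat.choose_succ_succ _ _
      rw [h3]
      simp only [numSubsets]
      omega

/-- In the induction, `(k+1)!` times the new binomial coefficient is a falling factorial, and the
old terms gain a factor `k + 1 ≤ m + 1`. -/
theorem numSubsets_mul_factorial_le {k m : ℕ} (h : k ≤ m) :
    numSubsets k m * k.factorial ≤ (k + 1) * (m + 1) ^ k := by
  induction k with
  | zero => simp [numSubsets]
  | succ k ih =>
    have h1 := ih (by omega)
    have h2 : m.choose (k + 1) * (k + 1).factorial ≤ (m + 1) ^ (k + 1) := by
      rw [mul_comm, ← Nat.descFactorial_eq_factorial_mul_choose]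
      exact (Nat.descFactorial_le_pow _ _).trans (Nat.pow_le_pow_left (by omega) _)
    calc numSubsets (k + 1) m * (k + 1).factorial
        = (k + 1) * (numSubsets k m * k.factorial) + m.choose (k + 1) * (k + 1).factorial := by
          rw [numSubsets_succ, Nat.add_mul, Nat.factorial_succ]; ring
      _ ≤ (k + 1) * ((k + 1) * (m + 1) ^ k) + (m + 1) ^ (k + 1) :=
          add_le_add (Nat.mul_le_mul_left _ h1) h2
      _ ≤ (k + 1) * ((m + 1) * (m + 1) ^ k) + (m + 1) ^ (k + 1) := by
          gcongr; omega
      _ = (k + 1 + 1) * (m + 1) ^ (k + 1) := by ring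

/-- One of the five powers cancels the factor `k + 1` of `numSubsets_mul_factorial_le`; the other
four are those in the cost of the algorithm. -/
theorem pow_five_le_factorial (k : ℕ) : (k + 1) ^ 5 ≤ 200 * k.factorial := by
  rcases Nat.lt_or_ge k 3 with h | h
  · interval_cases k <;> decide
  -- The step needs `(k+2)^5 ≤ (k+1)^6`, which holds from `k = 3` on and fails for `k = 2`.
  · induction k, h using Nat.le_induction with
    | base => decide
    | succ k hk ih =>
      have h1 : (k + 1 + 1) ^ 5 ≤ (k + 1) ^ 6 := by
        obtain ⟨j, rfl⟩ := Nat.exists_eq_add_of_le hk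
        have h2 : (3 + j + 1) ^ 6 = (3 + j + 1 + 1) ^ 5 + (971 + 3019 * j + 2590 * j ^ 2 +
            1030 * j ^ 3 + 215 * j ^ 4 + 23 * j ^ 5 + j ^ 6) := by ring
        rw [h2]
        exact Nat.le_add_right _ _
      calc (k + 1 + 1) ^ 5 ≤ (k + 1) * (k + 1) ^ 5 := h1.trans (le_of_eq (by ring))
        _ ≤ (k + 1) * (200 * k.factorial) := Nat.mul_le_mul_left _ ih
        _ = 200 * (k + 1).factorial := by rw [Nat.factorial_succ]; ring

/-- Three powers of `r` come from a single round and one from the number of rounds. The factorial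
saved in counting subsets absorbs them, so that no power of `r` remains in the final bound. -/
theorem pow_four_mul_numSubsets_le {r n : ℕ} (hr : 1 ≤ r) (hrn : r ≤ n) :
    r ^ 4 * numSubsets (r - 1) (n - 1) ≤ 200 * n ^ (r - 1) := by
  obtain ⟨k, rfl⟩ := Nat.exists_eq_add_of_le' hr
  obtain ⟨m, rfl⟩ := Nat.exists_eq_add_of_le' (hr.trans hrn)
  simp only [Nat.add_sub_cancel]
  have h1 := numSubsets_mul_factorial_le (show k ≤ m by omega)
  have h2 := pow_five_le_factorial k
  refine Nat.le_of_mul_le_mul_right ?_ (Nat.factorial_pos k)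
  calc (k + 1) ^ 4 * numSubsets k m * k.factorial
      = (k + 1) ^ 4 * (numSubsets k m * k.factorial) := by ring
    _ ≤ (k + 1) ^ 4 * ((k + 1) * (m + 1) ^ k) := Nat.mul_le_mul_left _ h1
    _ = (k + 1) ^ 5 * (m + 1) ^ k := by ring
    _ ≤ 200 * k.factorial * (m + 1) ^ k := Nat.mul_le_mul_right _ h2
    _ = _ := by ring

end BasicTime

/-! ### Running time of the Sparsitron -/

section SparsitronTime

theorem hedgeT_time_le (lam β : ℝ) {d : ℕ} (w : List ℝ) (s : List (List ℝ × ℝ))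
    (hw : w.length ≤ d) (hs : ∀ e ∈ s, e.1.length ≤ d) :
    (hedgeT lam β w s).time ≤ (19 * d + 11) * s.length + 1 ∧
      (hedgeT lam β w s).val.length = s.length ∧
      ∀ v ∈ (hedgeT lam β w s).val, v.length ≤ d := by
  induction s generalizing w with
  | nil => simp [hedgeT]
  | cons e s ih =>
    obtain ⟨x, y⟩ := e
    have hx : x.length ≤ d := hs (x, y) List.mem_cons_self
    set c := (norm1T w).val
    set v := w.map fun a => lam * (a / c) with hv
    set h := (dotT v x).val
    set g := Real.sigmoid h - y
    set ls := x.map fun a => (1 + g * a) / 2 with hls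
    set w' := List.zipWith (fun a b => a * β ^ b) w ls with hw'
    have hw'l : w'.length ≤ d := by rw [hw', List.length_zipWith]; omega
    obtain ⟨h1, h2, h3⟩ := ih w' hw'l fun e he => hs e (List.mem_cons_of_mem _ he)
    have hval : (hedgeT lam β w ((x, y) :: s)).val = v :: (hedgeT lam β w' s).val := by
      simp only [hedgeT, Timed.bind_val, mapT_val, op_val, zipWithT_val, List.map_map,
        Function.comp_def]
      rfl
    refine ⟨?_, ?_, ?_⟩
    · have t1 := norm1T_time_le w
      have t2 := mapT_time_le (f := fun a : ℝ => op (a / c)) (l := w) (c := 1) fun _ _ => le_rfl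
      have t3 := mapT_time_le (f := fun a : ℝ => op (lam * a)) (l := w.map fun a => a / c)
        (c := 1) fun _ _ => le_rfl
      have t4 := dotT_time_le v x
      have t5 := mapT_time_le (f := fun a : ℝ => do
        let b ← op (g * a)
        let b' ← op (1 + b)
        op (b' / 2)) (l := x) (c := 3) fun _ _ => le_rfl
      have t6 := zipWithT_time_le (f := fun a b : ℝ => do
        let f ← op (β ^ b)
        op (a * f)) (c := 2) (fun _ _ => le_rfl) w ls
      have hvl : v.length = w.length := List.length_map _
      rw [List.length_map] at t3
      have ht : (hedgeT lam β w ((x, y) :: s)).time =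
          (norm1T w).time + ((mapT (fun a : ℝ => op (a / c)) w).time +
          ((mapT (fun a : ℝ => op (lam * a)) (w.map fun a => a / c)).time +
          ((dotT v x).time + (1 + (1 + ((mapT (fun a : ℝ => do
            let b ← op (g * a)
            let b' ← op (1 + b)
            op (b' / 2)) x).time + ((zipWithT (fun a b : ℝ => do
            let f ← op (β ^ b)
            op (a * f)) w ls).time + ((hedgeT lam β w' s).time + 1)))))))) := by
        simp only [hedgeT, Timed.bind_time, Timed.bind_val, mapT_val, op_val, zipWithT_val,
          List.map_map, Function.comp_def, op_time]
        rfl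
      rw [ht]
      simp only [List.length_cons, Nat.mul_succ]
      omega
    · rw [hval, List.length_cons, List.length_cons, h2]
    · rw [hval]
      intro v' hv'
      rcases List.mem_cons.1 hv' with rfl | hv'
      · rw [hv, List.length_map]; exact hw
      · exact h3 v' hv'

theorem riskT_time_le {d : ℕ} (valid : List (List ℝ × ℝ)) {v : List ℝ} (hv : v.length ≤ d) :
    (riskT valid v).time ≤ (4 * d + 10) * valid.length + 4 := by
  have h1 := mapT_time_le (f := fun e : List ℝ × ℝ => do
    let h ← dotT v e.1
    let q ← op (Real.sigmoid h)
    let g ← op (q - e.2)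
    op (g * g)) (l := valid) (c := 4 * d + 5) (fun e _ => by
      have := dotT_time_le v e.1
      simp only [Timed.bind_time, op_time]
      omega)
  simp only [riskT, Timed.bind_time, op_time, mapT_val]
  have h2 := fun l : List ℝ => sumT_time_le l
  have h3 := lengthT_time_le valid
  refine le_trans (Nat.add_le_add h1 (Nat.add_le_add (h2 _) (Nat.add_le_add h3 le_rfl))) ?_
  rw [List.length_map]
  simp only [Nat.add_mul]
  omega

theorem averageT_time_le {d : ℕ} {w : List ℝ} (hw : w.length ≤ d) {vs : List (List ℝ)}
    (hvs : ∀ v ∈ vs, v.length ≤ d) :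
    (averageT w vs).time ≤ (2 * d + 4) * vs.length + 4 * d + 4 := by
  have hlen : ∀ (vs : List (List ℝ)) (s : List ℝ), s.length ≤ d →
      (vs.foldl (fun s v => List.zipWith (fun a b => a + b) s v) s).length ≤ d := by
    intro vs
    induction vs with
    | nil => intro s hs; exact hs
    | cons v vs ih =>
      intro s hs
      refine ih _ ?_
      rw [List.length_zipWith]
      omega
  have h1 := mapT_time_le (f := fun _ : ℝ => op (0:ℝ)) (l := w) (c := 1) fun _ _ => le_rfl
  have h2 := fun s : List ℝ => foldT_time_le
    (f := fun s v => zipWithT (fun a b : ℝ => op (a + b)) s v) (l := vs) (c := 2 * d + 1)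
    (fun s v hv => by
      have h3 := zipWithT_time_le_right (f := fun a b : ℝ => op (a + b)) (c := 1)
        (fun _ _ => le_rfl) s v
      have := hvs v hv
      omega) s
  have h3 := lengthT_time_le vs
  have h4 := fun (t : ℕ) (s : List ℝ) => mapT_time_le (f := fun a : ℝ => op (a / (t : ℝ))) (l := s)
    (c := 1) fun _ _ => le_rfl
  have h5 := hlen vs (w.map fun _ => 0) (by rw [List.length_map]; exact hw)
  simp only [averageT, Timed.bind_time, mapT_val, foldT_val, zipWithT_val, op_val]
  refine le_trans (Nat.add_le_add h1 (Nat.add_le_add (h2 _) (Nat.add_le_add h3 (h4 _ _)))) ?_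
  simp only [Nat.add_mul] at h5 ⊢
  omega

/-- The factor by which the running time depends on the number of samples. -/
def OutputRule.cost (rule : OutputRule) (N : ℕ) : ℕ :=
  match rule with
  | .average => N
  | .validate => N ^ 2

theorem le_cost (rule : OutputRule) (N : ℕ) : N ≤ rule.cost N := by
  cases rule with
  | average => exact le_rfl
  | validate => exact Nat.le_self_pow (by norm_num) N

/-- Training and averaging touch each of the `d` coordinates a bounded number of times per example.
Validation evaluates every vector on every validation example, hence `N²`. -/
theorem sparsitronT_time_le (rule : OutputRule) {d N : ℕ} (hd : 1 ≤ d) (hN : 1 ≤ N) (lam : ℝ)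
    {train valid : List (List ℝ × ℝ)} (ht : train.length ≤ N) (hv : valid.length ≤ N)
    (htd : ∀ e ∈ train, e.1.length ≤ d) :
    (sparsitronT rule d lam train valid).time ≤ 70 * d * rule.cost N := by
  set w := (List.range d).map fun _ => 1 / (d : ℝ) with hw
  have hwl : w.length ≤ d := by rw [hw, List.length_map, List.length_range]
  have h1 := lengthT_time_le train
  have h2 := mapT_time_le (f := fun _ : ℕ => op (1 / (d : ℝ))) (l := List.range d) (c := 1)
    fun _ _ => le_rfl
  rw [List.length_range] at h2
  have hdN : 1 ≤ d * N := Nat.mul_pos hd hN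
  have hdN1 : d ≤ d * N := Nat.le_mul_of_pos_right d hN
  have hdT : d * train.length ≤ d * N := Nat.mul_le_mul_left d ht
  have hNd : N ≤ d * N := Nat.le_mul_of_pos_left N hd
  set β : ℝ := 1 - Real.sqrt (Real.logb 2 (d : ℝ) / (train.length : ℝ)) with hβ
  obtain ⟨h3, h4, h5⟩ := hedgeT_time_le lam β w train hwl htd
  set vs := (hedgeT lam β w train).val with hvs
  have h3' : (hedgeT lam β w train).time ≤ 30 * (d * N) + 1 := by
    refine h3.trans ?_
    nlinarith
  cases rule with
  | average =>
    have h6 := averageT_time_le hwl h5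
    rw [h4] at h6
    have htime : (sparsitronT .average d lam train valid).time =
        (lengthT train).time + (1 + (1 + (1 + (1 +
        ((mapT (fun _ : ℕ => op (1 / (d : ℝ))) (List.range d)).time +
        ((hedgeT lam β w train).time + (averageT w vs).time)))))) := by
      simp only [sparsitronT, Timed.bind_time, mapT_val, op_val, op_time,
        lengthT_val]
      rfl
    rw [htime, OutputRule.cost, mul_assoc]
    have h7 : (averageT w vs).time ≤ 14 * (d * N) := h6.trans (by nlinarith)
    omega
  | validate =>
    have h6 := argminT_time_le (f := riskT valid) (dflt := []) (l := vs)
      (c := (4 * d + 10) * valid.length + 4) fun v hv => riskT_time_le valid (h5 v hv)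
    rw [h4] at h6
    have htime : (sparsitronT .validate d lam train valid).time =
        (lengthT train).time + (1 + (1 + (1 + (1 +
        ((mapT (fun _ : ℕ => op (1 / (d : ℝ))) (List.range d)).time +
        ((hedgeT lam β w train).time + (argminT (riskT valid) [] vs).time)))))) := by
      simp only [sparsitronT, Timed.bind_time, mapT_val, op_val, op_time,
        lengthT_val]
      rfl
    rw [htime, OutputRule.cost]
    have h7 : (argminT (riskT valid) [] vs).time ≤ 22 * (d * N ^ 2) := by
      refine h6.trans ?_
      have h8 : (4 * d + 10) * valid.length + 4 + 3 ≤ 21 * (d * N) := by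
        have : d * valid.length ≤ d * N := Nat.mul_le_mul_left d hv
        nlinarith
      have h9 : ((4 * d + 10) * valid.length + 4 + 3) * train.length ≤ 21 * (d * N) * N :=
        Nat.mul_le_mul h8 ht
      have h10 : 1 ≤ d * N ^ 2 := Nat.mul_pos hd (pow_pos hN 2)
      nlinarith
    have h8 : d * N ≤ d * N ^ 2 := Nat.mul_le_mul_left d (Nat.le_self_pow (by norm_num) N)
    rw [mul_assoc]
    omega

end SparsitronTime

end MRF

namespace MRF

/-! ### Running time of the algorithm -/

section AlgorithmTime

variable {n : ℕ}

theorem monomialT_time_le (z : Config n) (I : List (Fin n)) :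
    (monomialT z I).time ≤ 3 * I.length + 1 :=
  foldT_time_le (c := 2) (fun _ _ _ => le_rfl) 1

theorem exampleT_time_le (u : Fin n) {F : List (List (Fin n))} {r : ℕ}
    (hF : ∀ I ∈ F, I.length ≤ r) (z : Config n) :
    (exampleT u F z).time ≤ (3 * r + 6) * F.length + 8 := by
  have h1 := mapT_time_le (f := monomialT z) (l := F) (c := 3 * r + 1) fun I hI => by
    have := monomialT_time_le z I
    have := hF I hI
    omega
  have h2 := fun x : List ℝ => mapT_time_le (f := fun a : ℝ => op (-a)) (l := x) (c := 1)
    fun _ _ => le_rfl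
  simp only [exampleT, Timed.bind_time, mapT_val, op_val, appendT_time, op_time]
  have h3 := h2 (F.map fun I => (monomialT z I).val)
  simp only [List.length_map, Nat.add_mul] at h1 h3 ⊢
  omega

theorem regressT_time_le (rule : OutputRule) {r N K : ℕ} (hr : 1 ≤ r) (hN : 1 ≤ N) (hK : 1 ≤ K)
    (lam : ℝ) (u : Fin n) {F : List (List (Fin n))} (hF : ∀ I ∈ F, I.length ≤ r)
    (hFK : F.length ≤ K) {train valid : List (Config n)} (ht : train.length ≤ N)
    (hv : valid.length ≤ N) :
    (regressT rule lam u F train valid).time ≤ 300 * (r * K * rule.cost N) := by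
  have hB := le_cost rule N
  have h1 := lengthT_time_le F
  have h2 : ∀ z, (exampleT u F z).time ≤ 17 * (r * K) := fun z => by
    have h3 := exampleT_time_le u hF z
    have h4 : (3 * r + 6) * F.length ≤ (3 * r + 6) * K := Nat.mul_le_mul_left _ hFK
    have h5 : K ≤ r * K := Nat.le_mul_of_pos_left K hr
    nlinarith
  have h3 := mapT_time_le (f := exampleT u F) (l := train) fun z _ => h2 z
  have h4 := mapT_time_le (f := exampleT u F) (l := valid) fun z _ => h2 z
  have h5 := sparsitronT_time_le rule (d := 2 * F.length + 1) (by omega) hN (2 * lam)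
    (train := train.map fun z => (exampleT u F z).val)
    (valid := valid.map fun z => (exampleT u F z).val) (by rwa [List.length_map])
    (by rwa [List.length_map]) (by
      intro e he
      obtain ⟨z, -, rfl⟩ := List.mem_map.1 he
      rw [exampleT_val, List.length_map, length_eq_card (sum_map_coordList F.length),
        card_coordIndex])
  have h6 := fun l : List ℝ => splitT_time_le F.length l
  have h7 := fun l m : List ℝ => zipWithT_time_le (f := fun a b : ℝ => op (a - b)) (c := 1)
    (fun _ _ => le_rfl) (l.take F.length) m
  have h8 := fun m : List ℝ => zipWithT_time_le (f := fun (I : List (Fin n)) (c : ℝ) => op (I, c))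
    (c := 1) (fun _ _ => le_rfl) F m
  simp only [regressT, Timed.bind_time, mapT_val, op_val, lengthT_val, splitT_val, op_time]
  refine le_trans (Nat.add_le_add h1 (Nat.add_le_add le_rfl (Nat.add_le_add h3 (Nat.add_le_add h4
    (Nat.add_le_add h5 (Nat.add_le_add (h6 _) (Nat.add_le_add (h6 _) (Nat.add_le_add (h7 _ _)
    (h8 _))))))))) ?_
  set B := rule.cost N
  have h9 : ∀ l : List ℝ, (l.take F.length).length ≤ F.length := fun l => by
    rw [List.length_take]; omega
  have h10 := h9 ((sparsitronT rule (2 * F.length + 1) (2 * lam)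
    (train.map fun z => (exampleT u F z).val) (valid.map fun z => (exampleT u F z).val)).val)
  have h11 : (17 * (r * K) + 1) * train.length ≤ 18 * (r * K * B) := by
    have : 1 ≤ r * K := Nat.mul_pos hr hK
    calc (17 * (r * K) + 1) * train.length ≤ (18 * (r * K)) * B :=
          Nat.mul_le_mul (by omega) (ht.trans hB)
      _ = _ := by ring
  have h12 : (17 * (r * K) + 1) * valid.length ≤ 18 * (r * K * B) := by
    have : 1 ≤ r * K := Nat.mul_pos hr hK
    calc (17 * (r * K) + 1) * valid.length ≤ (18 * (r * K)) * B :=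
          Nat.mul_le_mul (by omega) (hv.trans hB)
      _ = _ := by ring
  have h13 : 70 * (2 * F.length + 1) * B ≤ 210 * (r * K * B) := by
    calc 70 * (2 * F.length + 1) * B ≤ 70 * (3 * K) * B :=
          Nat.mul_le_mul_right _ (Nat.mul_le_mul_left _ (by omega))
      _ = 210 * (1 * K * B) := by ring
      _ ≤ _ := by gcongr
  have h14 : K ≤ r * K * B := by
    calc K = 1 * K * 1 := by ring
      _ ≤ r * K * B := Nat.mul_le_mul (Nat.mul_le_mul_right K hr) (hN.trans hB)
  omega

theorem isFeatureT_time_le {l r : ℕ} {J : List (List (Fin n))} {I : List (Fin n)}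
    (hI : I.length ≤ r) (hJ : ∀ A ∈ J, A.length ≤ r) :
    (isFeatureT l J I).time ≤ 2 * r + 3 + ((3 * r + 3) * r + 3) * J.length := by
  have h1 := lengthT_time_le I
  have h2 := coveredT_time_le hI hJ
  simp only [isFeatureT, Timed.bind_time, op_time]
  split_ifs
  · simp only [op_time]; omega
  · omega

open Classical in
-- The witness `a` counts the selected features. Only these pay for a union, and each has a
-- coefficient above `η`, so the 1-norm of the coefficients limits their number.
theorem foldT_updateT_time_le {η : ℝ} {l r : ℕ} {J : List (List (Fin n))}
    (hJ : ∀ A ∈ J, A.length ≤ r) (q : List (List (Fin n) × ℝ)) (hq : ∀ Ic ∈ q, Ic.1.length ≤ r)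
    (JS : List (List (Fin n)) × List (Fin n)) (hS : JS.2.Nodup) :
    ∃ a : ℕ, (foldT (updateT η l J) JS q).time ≤
        (2 * r + 7 + ((3 * r + 3) * r + 3) * J.length) * q.length +
          ((3 * n + 3) * r + 1) * a + 1 ∧
      (foldT (updateT η l J) JS q).val.1.length = JS.1.length + a ∧
      a * η ≤ (q.map fun Ic => |Ic.2|).sum := by
  induction q generalizing JS with
  | nil => exact ⟨0, by simp [foldT], by simp, by simp⟩
  | cons Ic q ih =>
    have hIc := hq Ic List.mem_cons_self
    have h1 := lengthT_time_le Ic.1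
    have h2 := coveredT_time_le hIc hJ
    have h3 := unionT_time_le Ic.1 JS.2 hS
    have hval : (foldT (updateT η l J) JS (Ic :: q)).val =
        (foldT (updateT η l J) (updateT η l J JS Ic).val q).val := by
      simp only [foldT, Timed.bind_val, op_val]
    have htime : (foldT (updateT η l J) JS (Ic :: q)).time = (updateT η l J JS Ic).time +
        (1 + (foldT (updateT η l J) (updateT η l J JS Ic).val q).time) := by
      simp only [foldT, Timed.bind_time, op_val, op_time]
    have h4 : (updateT η l J JS Ic).time ≤ 2 * r + 6 + ((3 * r + 3) * r + 3) * J.length +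
        if Selected η l J Ic then (3 * n + 3) * r + 1 else 0 := by
      have h5 : (3 * n + 3) * Ic.1.length ≤ (3 * n + 3) * r := Nat.mul_le_mul_left _ hIc
      unfold Selected
      simp only [updateT, Timed.bind_time, op_time, lengthT_val, op_val, decide_eq_true_eq,
        Bool.and_eq_true, Bool.not_eq_true']
      by_cases h6 : Ic.1.length = l
      · by_cases h7 : (¬ ∃ A ∈ J, Ic.1 ⊆ A) ∧ η < |Ic.2|
        · rw [if_pos h6, if_pos ⟨h6, h7⟩]
          simp only [Timed.bind_time, op_time, op_val, coveredT_val, decide_eq_true_eq,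
            decide_eq_false_iff_not]
          rw [if_pos h7]
          simp only [Timed.bind_time, op_time]
          omega
        · rw [if_pos h6, if_neg fun h => h7 h.2]
          simp only [Timed.bind_time, op_time, op_val, coveredT_val, decide_eq_true_eq,
            decide_eq_false_iff_not]
          rw [if_neg h7]
          simp only [op_time]
          omega
      · rw [if_neg h6, if_neg fun h => h6 h.1]
        simp only [op_time]
        omega
    have hS' : (updateT η l J JS Ic).val.2.Nodup := by
      rw [updateT_val]
      split_ifs
      · exact nodup_unionT_val _ _ hS
      · exact hS
    obtain ⟨a, h5, h6, h7⟩ := ih (fun Ic hIc => hq Ic (List.mem_cons_of_mem _ hIc))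
      (updateT η l J JS Ic).val hS'
    rw [htime, hval, h6, List.map_cons, List.sum_cons, List.length_cons]
    by_cases hsel : Selected η l J Ic
    · rw [if_pos hsel] at h4
      refine ⟨a + 1, ?_, ?_, ?_⟩
      · simp only [Nat.mul_succ]; omega
      · rw [updateT_val, if_pos hsel, List.length_cons]; omega
      · push_cast; linarith [hsel.2.2]
    · rw [if_neg hsel] at h4
      refine ⟨a, ?_, ?_, ?_⟩
      · simp only [Nat.mul_succ]; omega
      · rw [updateT_val, if_neg hsel]
      · linarith [abs_nonneg Ic.2]

theorem levelsT_time_succ (rule : OutputRule) (r : ℕ) (lam η : ℝ) (u : Fin n)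
    (train valid : List (Config n)) (l : ℕ) (J : List (List (Fin n))) (S : List (Fin n)) :
    (levelsT rule r lam η u train valid (l + 1) J S).time = (lengthT S).time + (1 +
      if S.length < n - 1 then
        (filterT (fun v => op (decide (v ≠ u))) (List.finRange n)).time +
        ((subsetsT (r - 1) ((List.finRange n).filter fun v => decide (v ≠ u))).time +
        ((filterT (isFeatureT (l + 1) J) (vertexSubsets r u)).time +
        ((regressT rule lam u (features r u (l + 1) J) train valid).time +
        ((foldT (updateT η (l + 1) J) (J, S)
          (regressT rule lam u (features r u (l + 1) J) train valid).val).time +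
        (levelsT rule r lam η u train valid l
          (nextState rule r lam η u train valid (l + 1) J S).1
          (nextState rule r lam η u train valid (l + 1) J S).2).time))))
      else 1) := by
  rw [levelsT_succ]
  simp only [Timed.bind_time, lengthT_val, op_val, decide_eq_true_eq, op_time]
  split_ifs with h
  · simp only [Timed.bind_time, filterT_val, op_val, isFeatureT_val, foldT_val]
    rfl
  · rfl

/-- The arithmetic behind the running time of one round of the main loop. -/
theorem round_time_le {r K B j m a : ℕ} (hr : 1 ≤ r) (hB : 1 ≤ B) (hK : 1 ≤ K) (hj : j ≤ r * B) (hm : m ≤ K)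
    (ha : a ≤ B) (hn : n ≤ K) :
    4 * n + 20 * K + 8 * r * K + (2 * r + 3 + ((3 * r + 3) * r + 3) * j + 1) * K +
      300 * (r * K * B) + (2 * r + 7 + ((3 * r + 3) * r + 3) * j) * m +
      ((3 * n + 3) * r + 1) * a ≤ 500 * (r ^ 3 * K * B) := by
  have hr3 : r ≤ r ^ 3 := Nat.le_self_pow (by norm_num) r
  set W := r ^ 3 * K * B with hW
  have b3 : r * K * B ≤ W := Nat.mul_le_mul_right B (Nat.mul_le_mul_right K hr3)
  have b2 : r * K ≤ W := (Nat.le_mul_of_pos_right _ hB).trans b3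
  have b1 : K ≤ W := (Nat.le_mul_of_pos_left _ hr).trans b2
  have b4 : ((3 * r + 3) * r + 3) * j ≤ 9 * (r ^ 3 * B) := by
    have h1 : (3 * r + 3) * r + 3 ≤ 9 * r ^ 2 := by nlinarith
    calc ((3 * r + 3) * r + 3) * j ≤ (9 * r ^ 2) * (r * B) := Nat.mul_le_mul h1 hj
      _ = 9 * (r ^ 3 * B) := by ring
  have b5 : (2 * r + 7 + ((3 * r + 3) * r + 3) * j) * K ≤ 18 * W := by
    calc (2 * r + 7 + ((3 * r + 3) * r + 3) * j) * K ≤ (9 * r + 9 * (r ^ 3 * B)) * K :=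
          Nat.mul_le_mul_right K (by omega)
      _ = 9 * (r * K) + 9 * W := by rw [hW]; ring
      _ ≤ 18 * W := by omega
  have b6 : (2 * r + 3 + ((3 * r + 3) * r + 3) * j + 1) * K ≤ 18 * W :=
    le_trans (Nat.mul_le_mul_right K (by omega)) b5
  have b7 : (2 * r + 7 + ((3 * r + 3) * r + 3) * j) * m ≤ 18 * W :=
    le_trans (Nat.mul_le_mul_left _ hm) b5
  have b8 : ((3 * n + 3) * r + 1) * a ≤ 3 * W + 4 * (r * B) := by
    calc ((3 * n + 3) * r + 1) * a ≤ (3 * (r * K) + 4 * r) * B :=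
          Nat.mul_le_mul (by nlinarith [Nat.mul_le_mul_right r hn]) ha
      _ = 3 * (r * K * B) + 4 * (r * B) := by ring
      _ ≤ _ := by omega
  have b9 : r * B ≤ W := by
    calc r * B = r * 1 * B := by ring
      _ ≤ r * K * B := Nat.mul_le_mul_right B (Nat.mul_le_mul_left r hK)
      _ ≤ W := b3
  have b10 : 8 * r * K = 8 * (r * K) := by ring
  omega

/-- A round selects at most `N` features for any samples, since the Sparsitron's 1-norm bound is
deterministic. The hypothesis on `J.length + l * N` reserves room for `N` new members in each
remaining round, which keeps `J` at `r N` throughout. -/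
theorem levelsT_time_le (rule : OutputRule) {r N : ℕ} (hr : 2 ≤ r) (hrn : r ≤ n) (hN : 1 ≤ N)
    {lam η : ℝ} (hlam : 0 ≤ lam) (hadds : ∀ a : ℕ, a * η ≤ 2 * lam → a ≤ N)
    (u : Fin n) {train valid : List (Config n)} (ht : train.length ≤ N) (hv : valid.length ≤ N)
    (l : ℕ) (J : List (List (Fin n))) (S : List (Fin n)) (hJ : J ⊆ vertexSubsets r u)
    (hJN : J.length + l * N ≤ r * N) (hS : S.Nodup) :
    (levelsT rule r lam η u train valid l J S).time ≤
      500 * l * (r ^ 3 * numSubsets (r - 1) (n - 1) * rule.cost N) + 1 := by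
  induction l generalizing J S with
  | zero => simp [levelsT]
  | succ l ih =>
    have hlenV := length_vertexSubsets r u
    set K := numSubsets (r - 1) (n - 1) with hK
    have hB := le_cost rule N
    -- For `r ≥ 2` the empty set and the singletons already give `n` subsets, so work linear in `n`
    -- is covered by `K`.
    have hnK : n ≤ K := by
      have h1 : r - 1 = (r - 2) + 1 := by omega
      have h2 : ∀ k m : ℕ, m + 1 ≤ numSubsets (k + 1) m := by
        intro k m
        induction m with
        | zero => simp [numSubsets]
        | succ m ih =>
          have := numSubsets_pos k m
          simp only [numSubsets]; omega
      have h3 := h2 (r - 2) (n - 1)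
      rw [hK, h1]; omega
    have hK1 : 1 ≤ K := numSubsets_pos _ _
    have hV : ∀ I ∈ vertexSubsets r u, I.length ≤ r := fun I hI => by
      have := length_le_of_mem_vertexSubsets hI; omega
    have hJr : ∀ A ∈ J, A.length ≤ r := fun A hA => hV A (hJ hA)
    have hSn : S.length ≤ n := by simpa using hS.length_le_card
    have hJl : J.length ≤ r * N := by omega
    have t1 := lengthT_time_le S
    have t2 := filterT_time_le (f := fun v : Fin n => op (decide (v ≠ u))) (l := List.finRange n)
      (c := 1) fun _ _ => le_rfl
    rw [List.length_finRange] at t2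
    have t3 := subsetsT_time_le (r - 1) ((List.finRange n).filter fun v => decide (v ≠ u))
    rw [length_filter_ne, ← hK, show r - 1 + 1 = r by omega] at t3
    have t4 := filterT_time_le (f := isFeatureT (l + 1) J) (l := vertexSubsets r u)
      fun I hI => isFeatureT_time_le (hV I hI) hJr
    rw [hlenV] at t4
    set F := features r u (l + 1) J with hF
    have hFV : ∀ I ∈ F, I ∈ vertexSubsets r u := fun I hI => List.mem_of_mem_filter hI
    have hFK : F.length ≤ K := by
      rw [← hlenV]; exact List.length_filter_le _ _
    have t5 := regressT_time_le rule (r := r) (by omega) hN hK1 lam u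
      (fun I hI => hV I (hFV I hI)) hFK ht hv
    set B := rule.cost N
    set q := (regressT rule lam u F train valid).val with hq
    have hqF : (∀ Ic ∈ q, Ic.1 ∈ F) ∧ q.length ≤ K := by
      rcases map_fst_regressT_sublist rule lam hlam u F train valid with h0 | h0
      · rw [hq, h0]; simp
      · refine ⟨fun Ic hIc => by rw [← h0]; exact List.mem_map_of_mem hIc, ?_⟩
        rw [← List.length_map (f := Prod.fst), h0]; exact hFK
    obtain ⟨a, t6, hlen, hsum⟩ := foldT_updateT_time_le (n := n) (η := η) (l := l + 1) hJr q
      (fun Ic hIc => hV _ (hFV _ (hqF.1 Ic hIc))) (J, S) hS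
    have ha : a ≤ N := hadds a (hsum.trans (sum_abs_regressT_le rule hlam u F train valid))
    obtain ⟨s1, s2, s3⟩ := foldl_updateT η (l + 1) J q (J, S) hS
    have hnext : nextState rule r lam η u train valid (l + 1) J S =
        q.foldl (fun JS Ic => (updateT η (l + 1) J JS Ic).val) (J, S) := rfl
    have t7 := ih (nextState rule r lam η u train valid (l + 1) J S).1
      (nextState rule r lam η u train valid (l + 1) J S).2 (by
        intro A hA
        rw [hnext] at hA
        rcases (s1 A).1 hA with hA | ⟨Ic, hIc, -, rfl⟩
        · exact hJ hA
        · exact hFV _ (hqF.1 Ic hIc)) (by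
        rw [foldT_val] at hlen
        rw [hnext, hlen]
        simp only [Nat.add_mul, one_mul] at hJN ⊢
        omega) (by rw [hnext]; exact s3)
    rw [levelsT_time_succ, ← hF, ← hq]
    have hsum := round_time_le (show 1 ≤ r by omega) (hN.trans hB) hK1 (hJl.trans
      (Nat.mul_le_mul_left r hB)) hqF.2 (ha.trans hB) hnK
    have hmul : 500 * (l + 1) * (r ^ 3 * K * B) =
        500 * l * (r ^ 3 * K * B) + 500 * (r ^ 3 * K * B) := by ring
    rw [hmul]
    split_ifs <;> omega

/-- For `r = 1` the loop is empty. Otherwise the product of the number of vertices, the number of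
rounds and the cost of a round is at most `500 · 200 · B n^r`; the remaining constant covers the
bookkeeping per vertex and the split of the samples. -/
theorem learnGraphT_time_le (rule : OutputRule) {r N : ℕ} (hr : 1 ≤ r) (hrn : r ≤ n) (hN : 1 ≤ N)
    {lam η : ℝ} (hlam : 0 ≤ lam) (hadds : ∀ a : ℕ, a * η ≤ 2 * lam → a ≤ N)
    (s : List (Config n)) (hs : s.length = N) :
    (learnGraphT rule (N / 2) r lam η s).time ≤ 110000 * (rule.cost N * n ^ r) := by
  have hB := le_cost rule N
  set B := rule.cost N with hBdef
  have hn : 1 ≤ n := hr.trans hrn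
  have t1 := splitT_time_le (N / 2) s
  set E := 500 * (r ^ 4 * numSubsets (r - 1) (n - 1)) * B with hE
  have t2 : ∀ u : Fin n, (neighboursT rule r lam η u (s.take (N / 2)) (s.drop (N / 2))).time ≤
      E + 1 := by
    intro u
    rcases hr.eq_or_lt with rfl | hr2
    · simp [neighboursT, levelsT]
    · have h1 := levelsT_time_le rule hr2 hrn hN hlam hadds u
        (train := s.take (N / 2)) (valid := s.drop (N / 2))
        (by rw [List.length_take]; omega) (by rw [List.length_drop]; omega) (r - 1) [] []
        (by simp) (by
          have : (r - 1) * N ≤ r * N := Nat.mul_le_mul_right N (by omega)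
          simpa using this) List.nodup_nil
      refine h1.trans (Nat.add_le_add_right ?_ 1)
      calc 500 * (r - 1) * (r ^ 3 * numSubsets (r - 1) (n - 1) * B)
          ≤ 500 * r * (r ^ 3 * numSubsets (r - 1) (n - 1) * B) :=
            Nat.mul_le_mul_right _ (Nat.mul_le_mul_left _ (by omega))
        _ = E := by rw [hE]; ring
  have t3 := mapT_time_le (f := fun u : Fin n => do
      let S ← neighboursT rule r lam η u (s.take (N / 2)) (s.drop (N / 2))
      op (u, S)) (l := List.finRange n) (c := E + 2) (fun u _ => by
        have := t2 u
        simp only [Timed.bind_time, op_time]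
        omega)
  rw [List.length_finRange] at t3
  simp only [learnGraphT, Timed.bind_time, splitT_val]
  have h1 : n ≤ n ^ r := Nat.le_self_pow (by omega) n
  have h2 : E * n ≤ 100000 * (B * n ^ r) := by
    have h3 := pow_four_mul_numSubsets_le hr hrn
    calc E * n ≤ 500 * (200 * n ^ (r - 1)) * B * n :=
          Nat.mul_le_mul_right n (Nat.mul_le_mul_right B (Nat.mul_le_mul_left 500 h3))
      _ = 100000 * (B * (n ^ (r - 1) * n)) := by ring
      _ = 100000 * (B * n ^ r) := by rw [← pow_succ, Nat.sub_add_cancel hr]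
  have h3 : n ≤ B * n ^ r := h1.trans (Nat.le_mul_of_pos_left _ (hN.trans hB))
  have h4 : N ≤ B * n ^ r := hB.trans (Nat.le_mul_of_pos_right _ (Nat.pow_pos hn))
  have h5 : (E + 2 + 1) * n = E * n + 3 * n := by ring
  omega

/-- The sample size exceeds the number of features that can be selected in one round. -/
theorem le_of_mul_le {r N : ℕ} {lam η ρ : ℝ} (hr : 1 ≤ r) (hlam : 0 < lam) (hη : 0 < η)
    (hN : Real.exp (60 * r) * Real.exp (60 * lam * r) * logTerm n r ρ η / η ^ 4 ≤ N) (a : ℕ)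
    (ha : a * η ≤ 2 * lam) : a ≤ N := by
  have hr' : (1:ℝ) ≤ r := by exact_mod_cast hr
  have hL : 1 ≤ logTerm n r ρ η := one_le_logTerm
  have hN0 : (0:ℝ) < N := lt_of_lt_of_le (by positivity) hN
  have hN1 : 1 ≤ N := by exact_mod_cast hN0
  -- For `a ≤ 1` it is enough that `N ≥ 1`. For `a ≥ 2` the hypothesis forces `η ≤ lam`, and then `a
  -- η⁴ ≤ 2 lam⁴` is below the exponential.
  rcases Nat.lt_or_ge a 2 with h2 | h2
  · omega
  have h2' : (2:ℝ) ≤ a := by exact_mod_cast h2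
  have h3 : η ≤ lam := by nlinarith
  have h4 : (a:ℝ) ≤ N := by
    refine le_trans ?_ hN
    rw [le_div_iff₀ (by positivity)]
    have h5 : lam ≤ Real.exp lam := by linarith [Real.add_one_le_exp lam]
    have h6 : (2:ℝ) ≤ Real.exp (60 * r) := by linarith [Real.add_one_le_exp (60 * (r:ℝ))]
    have h7 : lam ^ 4 ≤ Real.exp (60 * lam * r) := by
      calc lam ^ 4 ≤ Real.exp lam ^ 4 := pow_le_pow_left₀ hlam.le h5 4
        _ ≤ _ := by
          rw [← Real.exp_nat_mul]
          refine Real.exp_le_exp.2 ?_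
          push_cast
          nlinarith
    calc a * η ^ 4 = a * η * η ^ 3 := by ring
      _ ≤ 2 * lam * lam ^ 3 := by gcongr
      _ = 2 * lam ^ 4 * 1 := by ring
      _ ≤ Real.exp (60 * r) * Real.exp (60 * lam * r) * logTerm n r ρ η := by gcongr
  exact_mod_cast h4

end AlgorithmTime

end MRF

theorem mainTheorem1 :
    ∃ C : ℝ, 0 < C ∧
      ∀ (n r : ℕ) (lam η ρ : ℝ), 1 ≤ r → r ≤ n → 0 < lam → 0 < η → 0 < ρ → ρ < 1 →
      ∀ N : ℕ,
        Real.exp (C * r) * Real.exp (C * lam * r) *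
          max 1 (Real.logb 2 ((n : ℝ) * r / (ρ * η))) / η ^ 4 ≤ (N : ℝ) →
        (∀ (G : SimpleGraph (Fin n)) (p : MRF.MultilinearPoly n),
          MRF.IsRWise r G p → MRF.IsIdentifiable η G p →
          (∀ i : Fin n, (p.partialDeriv i).norm1 ≤ lam) →
          ∀ rule : MRF.OutputRule,
            1 - ρ ≤ MRF.sampleProb p N
              {Z | MRF.Describes
                (MRF.learnGraphT rule (N / 2) r lam η (List.ofFn Z)).val G}) ∧
        (∀ Z : Fin N → MRF.Config n,
          ((MRF.learnGraphT .average (N / 2) r lam η (List.ofFn Z)).time : ℝ)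
            ≤ C * N * (n : ℝ) ^ r ∧
          ((MRF.learnGraphT .validate (N / 2) r lam η (List.ofFn Z)).time : ℝ)
            ≤ C * (N : ℝ) ^ 2 * (n : ℝ) ^ r) := by
  -- The running time dictates the constant; the sample size would need only 60.
  refine ⟨110000, by norm_num, ?_⟩
  intro n r lam η ρ hr hrn hlam hη hρ hρ1 N hNC
  have hN : Real.exp (60 * r) * Real.exp (60 * lam * r) * MRF.logTerm n r ρ η / η ^ 4 ≤ N := by
    refine le_trans ?_ hNC
    have hL : 1 ≤ MRF.logTerm n r ρ η := MRF.one_le_logTerm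
    have h1 : Real.exp (60 * r) ≤ Real.exp (110000 * r) :=
      Real.exp_le_exp.2 (by gcongr; norm_num)
    have h2 : Real.exp (60 * lam * r) ≤ Real.exp (110000 * lam * r) :=
      Real.exp_le_exp.2 (by gcongr; norm_num)
    change _ ≤ Real.exp (110000 * r) * Real.exp (110000 * lam * r) * MRF.logTerm n r ρ η / η ^ 4
    gcongr
  have hN0 : (0:ℝ) < N := by
    have hL : 1 ≤ MRF.logTerm n r ρ η := MRF.one_le_logTerm
    exact lt_of_lt_of_le (by positivity) hN
  have hN1 : 1 ≤ N := by exact_mod_cast hN0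
  refine ⟨fun G p h h' hp rule => MRF.sampleProb_describes_ge hr hrn hlam hη hρ hρ1 hN h h' hp rule,
    fun Z => ⟨?_, ?_⟩⟩
  · have := MRF.learnGraphT_time_le .average hr hrn hN1 hlam.le
      (MRF.le_of_mul_le hr hlam hη hN) (List.ofFn Z) (List.length_ofFn)
    rw [mul_assoc]
    exact_mod_cast this
  · have := MRF.learnGraphT_time_le .validate hr hrn hN1 hlam.le
      (MRF.le_of_mul_le hr hlam hη hN) (List.ofFn Z) (List.length_ofFn)
    rw [mul_assoc]
    exact_mod_cast this
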